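/- Let $n\ge 1$, let $X=(x_1,\dots,x_n)$ and $Y=(y_1,\dots,y_n)$ be independent commuting variables, and let $S_n$ be the symmetric group with simple transpositions $s_i=(i\;\,i+1)$, $1\le i\le n-1$, and longest element $\varpi_0=(n,n-1,\dots,1)$. Let $W_n$ be the group of barred permutations $w=(w_1,\dots,w_n)$ (permutations of $\{1,\dots,n\}$ with a sign, written as a bar, attached to each entry; all products are compositions of maps, $(uv)(i)=u(v(i))$). For $n\ge 2$ let $s_\Box=(\overline 2,\overline 1,3,\dots,n)$, so that $(u_1,u_2,u_3,\dots,u_n)s_\Box=(\overline u_2,\overline u_1,u_3,\dots,u_n)$. The Weyl group $\widetilde W_n$ of type $D_n$ is the subgroup of $W_n$ generated by the $s_i$ and (if $n\ge2$) $s_\Box$; it contains $S_n$, and $\ell$ denotes word length with respect to these generators. Its longest element is $\widetilde w_0=(\overline 1,\overline 2,\dots,\overline n)$ if $n$ is even and $\widetilde w_0=(1,\overline 2,\dots,\overline n)$ if $n$ is odd. Let $H\subset\widetilde W_n$ be the subgroup of the elements that are equal to $(1,\dots,n)$ in absolute value. *Divided differences.* On polynomials in $X$ with coefficients in a polynomial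 ring in $Y$, $s_i$ interchanges $x_i$ and $x_{i+1}$, and $s_\Box$ sends $(x_1,x_2)$ to $(-x_2,-x_1)$ and fixes the other variables. Set $$\partial_i f=\frac{f-s_if}{x_i-x_{i+1}},\qquad \partial_\Box f=\frac{f-s_\Box f}{x_1+x_2},\qquad \partial_i'=-\partial_i,\qquad \partial_\Box'=\partial_\Box .$$ For a reduced decomposition $w=s_{a_1}\cdots s_{a_r}$ set $\partial_w=\partial_{a_1}\circ\cdots\circ\partial_{a_r}$ and $\partial'_w=\partial'_{a_1}\circ\cdots\circ\partial'_{a_r}$; these do not depend on the reduced decomposition. *Type $A$.* Let $\Delta(X,Y)=\prod_{i+j\le n}(x_i-y_j)$ (product over $i,j\ge 1$), and for $\varpi\in S_n$ let $$\mathfrak S_\varpi(X,Y)=\partial_{\varpi^{-1}\varpi_0}\bigl(\Delta(X,Y)\bigr)\in\mathbb Z[X,Y],\qquad \varpi^*=\varpi_0\varpi\varpi_0 .$$ *Kernel.* Let $\widetilde Q_i(X)=e_i(X)$ be the elementary symmetric polynomials, let $$\widetilde Q_{i,j}(X)=\widetilde Q_i(X)\widetilde Q_j(X)+2\sum_{k=1}^{j}(-1)^k\widetilde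 Q_{i+k}(X)\widetilde Q_{j-k}(X),$$ and for a strict partition $\lambda=(\lambda_1>\cdots>\lambda_r\ge 0)$, with $r$ made even by adding a part $0$ if necessary, let $\widetilde Q_\lambda(X)=\mathrm{Pfaffian}[\widetilde Q_{\lambda_i,\lambda_j}(X)]_{1\le i<j\le r}$. Let $\widetilde P_\lambda=2^{-\ell(\lambda)}\widetilde Q_\lambda$, where $\ell(\lambda)$ is the number of nonzero parts, and let $$\widetilde P_{n-1}(X,Y)=\sum_{\lambda}\widetilde P_\lambda(X)\,\widetilde P_{\lambda'}(Y),$$ where $\lambda$ runs over the strict partitions with parts in $\{1,\dots,n-1\}$ and $\lambda'$ is the strict partition whose parts are the elements of $\{1,\dots,n-1\}$ that are not parts of $\lambda$. *Type $D$.* For $w\in\widetilde W_n$ let $$\mathfrak D_w(X,Y)=(-1)^{n(n-1)/2}\,\partial'_{w^{-1}\widetilde w_0}\bigl(\Delta(X,Y)\,\widetilde P_{n-1}(X,Y)\bigr)\in\mathbb Z[1/2][X,Y].$$ **Theorem (Positivity, type $D$).** For every $\varpi\in S_n$, with $L(\varpi)=\{w\in\varpi H\mid \ell(w)=\ell(\varpi)\}$,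 $$\sum_{w\in L(\varpi)}\mathfrak D_w(X,Y)=\mathfrak S_{\varpi^*}(\varpi_0X,-Y),$$ where the right-hand side is $\mathfrak S_{\varpi^*}$ evaluated at $(x_n,x_{n-1},\dots,x_1)$ and $(-y_1,\dots,-y_n)$. -/

import Mathlib

open MvPolynomial

namespace TypeD

noncomputable section

/-! ### Reduced words -/

section Words

variable {G ι : Type*} [Group G]

/-- The list `l = [a₁, …, a_r]` is a reduced word for `w` in the generators `s`:
`w = s a₁ * ⋯ * s a_r`, and no shorter word represents `w`. -/
def IsReducedWord (s : ι → G) (w : G) (l : List ι) : Prop :=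
  (l.map s).prod = w ∧ ∀ l' : List ι, (l'.map s).prod = w → l.length ≤ l'.length

/-- The length of `w` with respect to the generators `s`. -/
def wordLength (s : ι → G) (w : G) : ℕ :=
  sInf {k | ∃ l : List ι, (l.map s).prod = w ∧ l.length = k}

theorem exists_isReducedWord {s : ι → G} {w : G} (h : ∃ l : List ι, (l.map s).prod = w) :
    ∃ l, IsReducedWord s w l := by
  classical
  have hne : ∃ k, ∃ l : List ι, (l.map s).prod = w ∧ l.length = k := by
    obtain ⟨l, hl⟩ := h
    exact ⟨_, l, hl, rfl⟩
  obtain ⟨l, hl, hk⟩ := Nat.find_spec hne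
  refine ⟨l, hl, fun l' hl' => ?_⟩
  rw [hk]
  exact Nat.find_min' hne ⟨l', hl', rfl⟩

theorem exists_word_of_mem_closure {s : ι → G} (hs : ∀ i, s i * s i = 1) {w : G}
    (hw : w ∈ Subgroup.closure (Set.range s)) : ∃ l : List ι, (l.map s).prod = w := by
  induction hw using Subgroup.closure_induction with
  | mem x hx => obtain ⟨i, rfl⟩ := hx; exact ⟨[i], by simp⟩
  | one => exact ⟨[], rfl⟩
  | mul x y _ _ hx hy =>
    obtain ⟨l, rfl⟩ := hx
    obtain ⟨l', rfl⟩ := hy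
    exact ⟨l ++ l', by simp⟩
  | inv x _ hx =>
    obtain ⟨l, rfl⟩ := hx
    have hinv : ∀ i, (s i)⁻¹ = s i := fun i => inv_eq_of_mul_eq_one_left (hs i)
    refine ⟨l.reverse, ?_⟩
    rw [List.prod_inv_reverse, List.map_map, List.map_reverse]
    congr 2
    exact List.map_congr_left fun i _ => (hinv i).symm

end Words

/-! ### The symmetric group -/

/-- For a simple transposition `s_{i+1}` with `i ∈ {0, …, n-2}`, the first of the two adjacent
positions that it interchanges (positions are numbered from `0`). -/
def lo {n : ℕ} (i : Fin (n - 1)) : Fin n := ⟨i, by omega⟩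

/-- The second of the two adjacent positions. -/
def hi {n : ℕ} (i : Fin (n - 1)) : Fin n := ⟨i + 1, by omega⟩

theorem lo_ne_hi {n : ℕ} (i : Fin (n - 1)) : lo i ≠ hi i := by
  simp [lo, hi]

/-- The simple transpositions of `S_n`. -/
def simpleA (n : ℕ) (i : Fin (n - 1)) : Equiv.Perm (Fin n) := Equiv.swap (lo i) (hi i)

theorem exists_wordA {n : ℕ} (σ : Equiv.Perm (Fin n)) :
    ∃ l : List (Fin (n - 1)), (l.map (simpleA n)).prod = σ := by
  cases n with
  | zero => exact ⟨[], Subsingleton.elim _ _⟩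
  | succ m =>
    apply exists_word_of_mem_closure (fun i => by simp [simpleA])
    have h : σ ∈ Submonoid.closure
        (Set.range fun i : Fin m => Equiv.swap i.castSucc i.succ) := by
      rw [Equiv.Perm.mclosure_swap_castSucc_succ]; trivial
    exact Submonoid.closure_le (S := (Subgroup.closure (Set.range (simpleA (m + 1)))).toSubmonoid)
      |>.2 (by rintro _ ⟨i, rfl⟩; exact Subgroup.subset_closure ⟨i, rfl⟩) h

/-- A reduced word of a permutation. -/
def reducedWordA {n : ℕ} (σ : Equiv.Perm (Fin n)) : List (Fin (n - 1)) :=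
  (exists_isReducedWord (exists_wordA σ)).choose

/-- The longest permutation `(n, n-1, …, 1)`. -/
def longA (n : ℕ) : Equiv.Perm (Fin n) := Fin.revPerm

/-- The involution `σ ↦ ϖ₀ σ ϖ₀` of `S_n`. -/
def star {n : ℕ} (σ : Equiv.Perm (Fin n)) : Equiv.Perm (Fin n) := longA n * σ * longA n

/-! ### Signed permutations and the Weyl group of type `D` -/

/-- The hyperoctahedral group `W_n`. The element `⟨η, σ⟩` is the barred permutation whose entry in
position `i` has absolute value `σ i` and sign `η (σ i)`; the product is composition,
`(u v)(i) = u (v i)`, where `u (-i) = - u i`. -/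
abbrev SignedPerm (n : ℕ) : Type := (Fin n → ℤˣ) ⋊[mulAutArrow] Equiv.Perm (Fin n)

/-- The `i`-th entry of a barred permutation: its sign (`-1` means barred) and absolute value. -/
def entry {n : ℕ} (w : SignedPerm n) (i : Fin n) : ℤˣ × Fin n :=
  (w.left (w.right i), w.right i)

theorem mul_left_apply {n : ℕ} (u v : SignedPerm n) (k : Fin n) :
    (u * v).left k = u.left k * v.left (u.right⁻¹ k) := rfl

theorem entry_mul {n : ℕ} (u v : SignedPerm n) (i : Fin n) :
    entry (u * v) i =
      ((entry v i).1 * (entry u (entry v i).2).1, (entry u (entry v i).2).2) := by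
  simp [entry, mul_left_apply, mul_comm]

theorem entry_ext {n : ℕ} {u v : SignedPerm n} (h : ∀ i, entry u i = entry v i) : u = v := by
  have h2 : u.right = v.right := Equiv.ext fun i => congrArg Prod.snd (h i)
  refine SemidirectProduct.ext (funext fun i => ?_) h2
  have := congrArg Prod.fst (h (u.right⁻¹ i))
  simpa [entry, ← h2] using this

/-- The index set of the simple reflections of type `D_n`: the simple transpositions, and (for
`n ≥ 2`) one further reflection. -/
inductive GenD (n : ℕ) : Type
  | s (i : Fin (n - 1)) : GenD n
  | box (h : 2 ≤ n) : GenD n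

/-- The element of `W_n` which exchanges the first two entries and puts a bar on both of them:
it sends `1` to `-2` and `2` to `-1`. -/
def reflBox (n : ℕ) (h : 2 ≤ n) : SignedPerm n :=
  ⟨fun k => if (k : ℕ) < 2 then -1 else 1, Equiv.swap ⟨0, by omega⟩ ⟨1, by omega⟩⟩

/-- The generators of the Weyl group of type `D_n`, as elements of `W_n`. -/
def simpleD (n : ℕ) : GenD n → SignedPerm n
  | .s i => SemidirectProduct.inr (simpleA n i)
  | .box h => reflBox n h

theorem entry_mul_reflBox {n : ℕ} (h : 2 ≤ n) (u : SignedPerm n) (i : Fin n) :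
    entry (u * reflBox n h) i =
      if (i : ℕ) = 0 then (-(entry u ⟨1, by omega⟩).1, (entry u ⟨1, by omega⟩).2)
      else if (i : ℕ) = 1 then (-(entry u ⟨0, by omega⟩).1, (entry u ⟨0, by omega⟩).2)
      else entry u i := by
  rw [entry_mul]
  obtain ⟨i, hi⟩ := i
  rcases i with _ | _ | i
  · simp [entry, reflBox]
  · simp [entry, reflBox]
  · have : Equiv.swap (⟨0, by omega⟩ : Fin n) ⟨1, by omega⟩ ⟨i + 2, hi⟩ = ⟨i + 2, hi⟩ :=
      Equiv.swap_apply_of_ne_of_ne (by simp) (by simp)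
    simp [entry, reflBox, this]

theorem simpleD_mul_self {n : ℕ} (g : GenD n) : simpleD n g * simpleD n g = 1 := by
  cases g with
  | s i => rw [simpleD, ← map_mul, simpleA, Equiv.swap_mul_self, map_one]
  | box h =>
    apply entry_ext
    rintro ⟨i, hi⟩
    rw [simpleD, entry_mul_reflBox]
    rcases i with _ | _ | i
    · simp [entry, reflBox]
    · simp [entry, reflBox]
    · have : Equiv.swap (⟨0, by omega⟩ : Fin n) ⟨1, by omega⟩ ⟨i + 2, hi⟩ = ⟨i + 2, hi⟩ :=
        Equiv.swap_apply_of_ne_of_ne (by simp) (by simp)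
      simp [entry, reflBox, this]

/-- The Weyl group of type `D_n`, as a subgroup of `W_n`. -/
def WeylD (n : ℕ) : Subgroup (SignedPerm n) := Subgroup.closure (Set.range (simpleD n))

theorem inr_mem_weylD {n : ℕ} (σ : Equiv.Perm (Fin n)) :
    (SemidirectProduct.inr σ : SignedPerm n) ∈ WeylD n := by
  obtain ⟨l, rfl⟩ := exists_wordA σ
  rw [map_list_prod]
  refine Subgroup.list_prod_mem _ fun x hx => ?_
  obtain ⟨y, hy, rfl⟩ := List.mem_map.1 hx
  obtain ⟨i, _, rfl⟩ := List.mem_map.1 hy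
  exact Subgroup.subset_closure ⟨.s i, rfl⟩

theorem flip_mem_weylD {n : ℕ} {i j : Fin n} (hij : i ≠ j) :
    (SemidirectProduct.inl fun k => if k = i ∨ k = j then -1 else 1 : SignedPerm n) ∈ WeylD n := by
  have hn : 2 ≤ n := by
    have := i.2
    have := j.2
    have : (i : ℕ) ≠ j := fun h => hij (Fin.ext h)
    omega
  let a : Fin n := ⟨0, by omega⟩
  let b : Fin n := ⟨1, by omega⟩
  have hab : a ≠ b := by simp [a, b]
  obtain ⟨σ, hσ⟩ : ∃ σ : Equiv.Perm (Fin n), σ a = i ∧ σ b = j := by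
    refine ⟨Equiv.swap (Equiv.swap a i b) j * Equiv.swap a i, ?_, ?_⟩
    · have h1 : i ≠ Equiv.swap a i b := fun h =>
        hab ((Equiv.swap a i).injective ((Equiv.swap_apply_left a i).trans h))
      simp [Equiv.swap_apply_of_ne_of_ne h1 hij]
    · simp
  have key : (SemidirectProduct.inl fun k => if k = i ∨ k = j then -1 else 1 : SignedPerm n) =
      SemidirectProduct.inr σ * (reflBox n hn * SemidirectProduct.inr (Equiv.swap a b)) *
        SemidirectProduct.inr σ⁻¹ := by
    refine SemidirectProduct.ext (funext fun k => ?_) ?_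
    · have h1 : (σ⁻¹ k : ℕ) < 2 ↔ k = i ∨ k = j := by
        rw [← hσ.1, ← hσ.2, ← Equiv.Perm.inv_eq_iff_eq, ← Equiv.Perm.inv_eq_iff_eq, Fin.ext_iff,
          Fin.ext_iff]
        simp only [a, b]
        omega
      simp only [mul_left_apply, SemidirectProduct.left_inl, SemidirectProduct.left_inr,
        SemidirectProduct.right_inr, Pi.one_apply, mul_one, one_mul, reflBox, h1]
    · simp [reflBox, a, b]
  rw [key]
  exact mul_mem (mul_mem (inr_mem_weylD σ)
    (mul_mem (Subgroup.subset_closure ⟨.box hn, rfl⟩) (inr_mem_weylD _))) (inr_mem_weylD _)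

theorem inl_mem_weylD {n : ℕ} (η : Fin n → ℤˣ) (h : ∏ i, η i = 1) :
    (SemidirectProduct.inl η : SignedPerm n) ∈ WeylD n := by
  induction hc : (Finset.univ.filter fun i => η i = -1).card using Nat.strong_induction_on
    generalizing η with
  | _ c ih =>
    by_cases h1 : ∀ i, η i = 1
    · rw [show η = 1 from funext h1, map_one]
      exact one_mem _
    · push Not at h1
      obtain ⟨i, hi⟩ := h1
      have hi : η i = -1 := (Int.units_eq_one_or _).resolve_left hi
      obtain ⟨j, hji, hj⟩ : ∃ j, j ≠ i ∧ η j = -1 := by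
        by_contra! hcon
        have : ∏ k, η k = -1 := by
          rw [Finset.prod_eq_single i (fun k _ hk =>
            (Int.units_eq_one_or _).resolve_right (hcon k hk)) (by simp), hi]
        rw [this] at h
        exact absurd h (by decide)
      let f : Fin n → ℤˣ := fun k => if k = i ∨ k = j then -1 else 1
      have hf : f * f = 1 := funext fun k => Int.units_mul_self _
      have hη : η = f * (f * η) := by rw [← mul_assoc, hf, one_mul]
      have hfp : ∏ k, f k = 1 := by
        have : ∀ k, f k = (if k = i then -1 else 1) * (if k = j then -1 else 1) := by
          intro k
          by_cases h1 : k = i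
          · subst h1; simp [f, hji.symm]
          · simp [f, h1]
        rw [Finset.prod_congr rfl fun k _ => this k, Finset.prod_mul_distrib]
        simp
      rw [hη, map_mul]
      refine mul_mem (flip_mem_weylD hji.symm) (ih _ ?_ (f * η) ?_ rfl)
      · rw [← hc]
        apply Finset.card_lt_card
        refine ⟨fun k hk => ?_, fun hsub => ?_⟩
        · simp only [Finset.mem_filter, Finset.mem_univ, true_and, Pi.mul_apply] at hk ⊢
          by_cases h2 : k = i ∨ k = j
          · rcases h2 with rfl | rfl <;> assumption
          · simpa [f, h2] using hk
        · have := hsub (show i ∈ _ by simp [hi])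
          simp [f, hi] at this
      · simp [Finset.prod_mul_distrib, hfp, h]

/-- The Weyl group of type `D_n` consists of the barred permutations with an even number of bars. -/
theorem mem_weylD_iff {n : ℕ} (w : SignedPerm n) : w ∈ WeylD n ↔ ∏ i, w.left i = 1 := by
  constructor
  · intro hw
    obtain ⟨l, rfl⟩ := exists_word_of_mem_closure simpleD_mul_self hw
    clear hw
    induction l with
    | nil => simp
    | cons g l ih =>
      have hg : ∏ i, (simpleD n g).left i = 1 := by
        cases g with
        | s i => simp [simpleD]
        | box h =>
          obtain ⟨m, rfl⟩ := Nat.exists_eq_add_of_le' h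
          simp [simpleD, reflBox, Fin.prod_univ_succ]
      have hp : ∀ (σ : Equiv.Perm (Fin n)) (f : Fin n → ℤˣ), ∏ i, f (σ⁻¹ i) = ∏ i, f i :=
        fun σ f => Equiv.prod_comp σ⁻¹ f
      rw [List.map_cons, List.prod_cons, SemidirectProduct.mul_left]
      simp only [Pi.mul_apply, Finset.prod_mul_distrib, hg, one_mul]
      exact (hp _ _).trans ih
  · intro h
    rw [← SemidirectProduct.inl_left_mul_inr_right w]
    exact mul_mem (inl_mem_weylD _ h) (inr_mem_weylD _)

instance (n : ℕ) : Finite (SignedPerm n) := Finite.of_equiv _ SemidirectProduct.equivProd.symm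

instance (n : ℕ) : Fintype (WeylD n) := Fintype.ofFinite _

/-- The inclusion of `S_n` in the Weyl group of type `D_n`. -/
def permD {n : ℕ} (σ : Equiv.Perm (Fin n)) : WeylD n := ⟨SemidirectProduct.inr σ, inr_mem_weylD σ⟩

/-- The longest element of the Weyl group of type `D_n`: all entries of `(1, …, n)` are barred,
except that `1` is unbarred when `n` is odd. -/
def longD (n : ℕ) : WeylD n :=
  ⟨SemidirectProduct.inl fun k => if Odd n ∧ (k : ℕ) = 0 then 1 else -1, by
    rw [mem_weylD_iff, SemidirectProduct.left_inl]
    rcases n with _ | m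
    · simp
    · rcases Nat.even_or_odd (m + 1) with h | h
      · simp [Nat.not_odd_iff_even.2 h, h.neg_one_pow]
      · have hm : Even m := by simpa [Nat.odd_add_one] using h
        simp [Fin.prod_univ_succ, h, hm.neg_one_pow]⟩

theorem exists_wordD {n : ℕ} (w : WeylD n) :
    ∃ l : List (GenD n), (l.map (simpleD n)).prod = (w : SignedPerm n) :=
  exists_word_of_mem_closure simpleD_mul_self w.2

/-- A reduced word of an element of the Weyl group of type `D_n`. -/
def reducedWordD {n : ℕ} (w : WeylD n) : List (GenD n) :=
  (exists_isReducedWord (exists_wordD w)).choose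

/-- The length in the Weyl group of type `D_n`. -/
def lengthD {n : ℕ} (w : WeylD n) : ℕ := wordLength (simpleD n) (w : SignedPerm n)

/-- The subgroup `H` of the elements that are equal to `(1, …, n)` in absolute value. -/
def signSubgroup (n : ℕ) : Subgroup (WeylD n) :=
  ((SemidirectProduct.rightHom : SignedPerm n →* Equiv.Perm (Fin n)).comp (WeylD n).subtype).ker

open Classical in
/-- The set `L(ϖ)` of the elements of the coset `ϖ H` that have the same length as `ϖ`. -/
def lengthCoset {n : ℕ} (σ : Equiv.Perm (Fin n)) : Finset (WeylD n) :=
  Finset.univ.filter fun w =>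
    (∃ h ∈ signSubgroup n, w = permD σ * h) ∧ lengthD w = lengthD (permD σ)

/-! ### Divided differences -/

/-- The polynomial ring `R[X, Y] = R[Y][X]` in `x₁, …, x_n` and `y₁, …, y_n`. -/
abbrev PolyXY (n : ℕ) (R : Type*) [CommRing R] := MvPolynomial (Fin n ⊕ Fin n) R

section Divided

variable {n : ℕ} {R : Type*} [CommRing R]

/-- The variable `x_{i+1}`. -/
def x (i : Fin n) : PolyXY n R := X (Sum.inl i)

/-- The variable `y_{i+1}`. -/
def y (i : Fin n) : PolyXY n R := X (Sum.inr i)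

/-- A simple transposition acts by exchanging two adjacent `x`-variables. -/
def actS (i : Fin (n - 1)) : PolyXY n R →ₐ[R] PolyXY n R :=
  aeval (Sum.elim (fun k => x (simpleA n i k)) y)

/-- The further simple reflection of type `D` acts by sending `(x₁, x₂)` to `(-x₂, -x₁)`. -/
def actBox (h : 2 ≤ n) : PolyXY n R →ₐ[R] PolyXY n R :=
  aeval (Sum.elim
    (fun k => if (k : ℕ) = 0 then -x ⟨1, by omega⟩ else if (k : ℕ) = 1 then -x ⟨0, by omega⟩
      else x k) y)

theorem dvd_sub_of_forall_X {σ : Type*} (d : MvPolynomial σ R)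
    (φ : MvPolynomial σ R →ₐ[R] MvPolynomial σ R) (h : ∀ k, d ∣ X k - φ (X k))
    (f : MvPolynomial σ R) : d ∣ f - φ f := by
  have key : (Ideal.Quotient.mkₐ R (Ideal.span {d})) =
      (Ideal.Quotient.mkₐ R (Ideal.span {d})).comp φ := by
    apply MvPolynomial.algHom_ext
    intro k
    exact Ideal.Quotient.eq.2 (Ideal.mem_span_singleton.2 (h k))
  exact Ideal.mem_span_singleton.1 (Ideal.Quotient.eq.1 (DFunLike.congr_fun key f))

theorem dvd_sub_actS (i : Fin (n - 1)) (f : PolyXY n R) :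
    x (lo i) - x (hi i) ∣ f - actS i f := by
  apply dvd_sub_of_forall_X
  rintro (k | k)
  · simp only [actS, aeval_X, Sum.elim_inl, simpleA]
    by_cases h1 : k = lo i
    · subst h1; simp [x]
    · by_cases h2 : k = hi i
      · subst h2
        rw [Equiv.swap_apply_right, ← neg_dvd, neg_sub]
        simp [x]
      · rw [Equiv.swap_apply_of_ne_of_ne h1 h2]; simp [x]
  · simp [actS, y]

theorem dvd_sub_actBox (h : 2 ≤ n) (f : PolyXY n R) :
    x ⟨0, by omega⟩ + x ⟨1, by omega⟩ ∣ f - actBox h f := by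
  apply dvd_sub_of_forall_X
  rintro (⟨k, hk⟩ | k)
  · simp only [actBox, aeval_X, Sum.elim_inl]
    rcases k with _ | _ | k
    · simp [x]
    · simp [x, add_comm]
    · simp [x]
  · simp [actBox, y]

/-- The divided difference `∂_i f = (f - s_i f) / (x_i - x_{i+1})`. -/
def dd (i : Fin (n - 1)) (f : PolyXY n R) : PolyXY n R := (dvd_sub_actS i f).choose

theorem dd_spec (i : Fin (n - 1)) (f : PolyXY n R) :
    f - actS i f = (x (lo i) - x (hi i)) * dd i f := (dvd_sub_actS i f).choose_spec

/-- The quotient that defines `∂_i f` is unique. -/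
theorem dd_unique [IsDomain R] (i : Fin (n - 1)) {f g : PolyXY n R}
    (h : f - actS i f = (x (lo i) - x (hi i)) * g) : dd i f = g := by
  have hne : (x (lo i) - x (hi i) : PolyXY n R) ≠ 0 :=
    sub_ne_zero.2 fun e => lo_ne_hi i (Sum.inl_injective (X_injective e))
  exact mul_left_cancel₀ hne ((dd_spec i f).symm.trans h)

/-- The divided difference `∂_□ f = (f - s_□ f) / (x₁ + x₂)`. -/
def ddBox (h : 2 ≤ n) (f : PolyXY n R) : PolyXY n R := (dvd_sub_actBox h f).choose

theorem ddBox_spec (h : 2 ≤ n) (f : PolyXY n R) :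
    f - actBox h f = (x ⟨0, by omega⟩ + x ⟨1, by omega⟩) * ddBox h f :=
  (dvd_sub_actBox h f).choose_spec

/-- The operators `∂'_i = -∂_i` and `∂'_□ = ∂_□`. -/
def ddSigned : GenD n → PolyXY n R → PolyXY n R
  | .s i, f => -dd i f
  | .box h, f => ddBox h f

/-- `∂_σ = ∂_{a₁} ∘ ⋯ ∘ ∂_{a_r}` for a reduced decomposition `σ = s_{a₁} ⋯ s_{a_r}` in `S_n`
(the operator does not depend on the reduced decomposition). -/
def ddPerm (σ : Equiv.Perm (Fin n)) (f : PolyXY n R) : PolyXY n R :=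
  (reducedWordA σ).foldr dd f

/-- `∂'_w = ∂'_{a₁} ∘ ⋯ ∘ ∂'_{a_r}` for a reduced decomposition `w = s_{a₁} ⋯ s_{a_r}` in the Weyl
group of type `D_n` (the operator does not depend on the reduced decomposition). -/
def ddWeylD (w : WeylD n) (f : PolyXY n R) : PolyXY n R :=
  (reducedWordD w).foldr ddSigned f

/-- `Δ(X, Y) = ∏_{i + j ≤ n} (x_i - y_j)`, the product over `i, j ∈ {1, …, n}`. -/
def Delta (n : ℕ) (R : Type*) [CommRing R] : PolyXY n R :=
  ∏ i : Fin n, ∏ j : Fin n, if (i + 1 : ℕ) + (j + 1) ≤ n then x i - y j else 1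

end Divided

/-! ### Type `A` double Schubert polynomials -/

/-- The type `A` double Schubert polynomial `𝔖_σ(X, Y) ∈ ℤ[X, Y]`. -/
def schubertA {n : ℕ} (σ : Equiv.Perm (Fin n)) : PolyXY n ℤ :=
  ddPerm (σ⁻¹ * longA n) (Delta n ℤ)

/-- The value `𝔖_σ(a, b)` for `a = (a₁, …, a_n)` and `b = (b₁, …, b_n)` in a commutative ring. -/
def schubertAAt {n : ℕ} {S : Type*} [CommRing S] (σ : Equiv.Perm (Fin n)) (a b : Fin n → S) : S :=
  eval₂ (Int.castRingHom S) (Sum.elim a b) (schubertA σ)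

/-! ### `Q̃`- and `P̃`-polynomials -/

/-- The Pfaffian of the skew-symmetric array with entries `a (l_i) (l_j)`, `i < j`, above the
diagonal, for a list `l = [l₁, …, l_r]` with `r` even. It is defined by expansion along the first
row: `∑_{j = 2}^r (-1)^j a (l₁) (l_j) Pf(l without l₁ and l_j)`. -/
def pfaffian {ι S : Type*} [CommRing S] (a : ι → ι → S) : List ι → S
  | [] => 1
  | i :: l => ∑ j : Fin l.length, (-1) ^ (j : ℕ) * a i (l.get j) * pfaffian a (l.eraseIdx j)
termination_by l => l.length
decreasing_by
  simp only [List.length_cons]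
  exact Nat.lt_succ_of_le (List.length_eraseIdx_le l j)

/-- The polynomial `Q̃_{i,j}(X)`, where `Q̃_i(X) = e_i(X)`. -/
def Qtilde₂ (n : ℕ) (R : Type*) [CommRing R] (i j : ℕ) : MvPolynomial (Fin n) R :=
  esymm (Fin n) R i * esymm (Fin n) R j +
    2 * ∑ k ∈ Finset.Icc 1 j, (-1) ^ k * (esymm (Fin n) R (i + k) * esymm (Fin n) R (j - k))

/-- The parts of a strict partition in decreasing order, followed by a part `0` if their number is
odd. A strict partition is given by the finite set of its nonzero parts. -/
def paddedParts (lam : Finset ℕ) : List ℕ :=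
  lam.sort (· ≥ ·) ++ if Odd lam.card then [0] else []

/-- The polynomial `Q̃_λ(X)` of a strict partition `λ`. -/
def Qtilde (n : ℕ) (R : Type*) [CommRing R] (lam : Finset ℕ) : MvPolynomial (Fin n) R :=
  pfaffian (Qtilde₂ n R) (paddedParts lam)

/-- The ring `ℤ[1/2]`. -/
abbrev ZHalf : Type := Localization.Away (2 : ℤ)

/-- The polynomial `P̃_λ(X) = 2^{-ℓ(λ)} Q̃_λ(X)` of a strict partition `λ`. -/
def Ptilde (n : ℕ) (lam : Finset ℕ) : MvPolynomial (Fin n) ZHalf :=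
  C (IsLocalization.Away.invSelf (2 : ℤ) ^ lam.card) * Qtilde n ZHalf lam

/-- The set `𝒟_k` of the strict partitions contained in `ρ_k = (k, k-1, …, 1)`, that is, of the
strict partitions whose parts lie in `{1, …, k}`. -/
def strictPartitions (k : ℕ) : Finset (Finset ℕ) := (Finset.Icc 1 k).powerset

/-- The reproducing kernel `P̃_k(X, Y) = ∑_{λ ∈ 𝒟_k} P̃_λ(X) P̃_{ρ_k ∖ λ}(Y)`, where `X` and `Y`
are the full alphabets of `n` variables. -/
def kernelP (n k : ℕ) : PolyXY n ZHalf :=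
  ∑ lam ∈ strictPartitions k,
    rename Sum.inl (Ptilde n lam) * rename Sum.inr (Ptilde n (Finset.Icc 1 k \ lam))

/-! ### Type `D` double Schubert polynomials -/

/-- The type `D` double Schubert polynomial `𝔇_w(X, Y) ∈ ℤ[1/2][X, Y]`. -/
def schubertD {n : ℕ} (w : WeylD n) : PolyXY n ZHalf :=
  (-1) ^ (n * (n - 1) / 2) *
    ddWeylD (w⁻¹ * longD n) (Delta n ZHalf * kernelP n (n - 1))

end

end TypeD

/-! Both sides, as functions of `ϖ`, obey the same recursion: if `ϖ s_i` is shorter than `ϖ`, then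
`-∂_i` carries the value at `ϖ` to the value at `ϖ s_i` (`opS_opCoset` on the left, `opS_schubertFn`
on the right). Every permutation is reached from the longest one in this way (`eq_of_longA`), so
only `ϖ = ϖ₀` needs a computation. There the right-hand side is `∏_{b < a} (x_a + y_b)`
(`schubertFn_longA`).

On the left, the operators `∂'_{w⁻¹ w̃₀}` for `w ∈ L(ϖ₀)` add up to the operator `Θ_n`, the sum of
`∂'_w` over all `w` equal to `(n, …, 1)` in absolute value (`opCoset_longA`). All these `w` have
length `n(n-1)/2`, and `Θ_n = (∂'_1 + ∂'_□) ∂'_2 ⋯ ∂'_{n-1} Θ_{n-1}` (`theta_eq_sum`). The central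
computation is `theta_upperProd`: if `φ` is symmetric in `X`, then `Θ_n(Δ φ) = (-1)^{n(n-1)/2} ∏_{b
< a} (x_a + y_b) Ψ_n(φ)`, where `Ψ_n(φ)` is the sum of `φ / ∏_{i < j} (x_i + x_j)` over all even
sign changes of `X`. It is an induction on `n` whose step is Lagrange interpolation
(`ratio_interpolation`).

It remains to see that `Ψ_n` sends the kernel to `1` (`psi_evFn_kernelP`). On symmetric functions
`Ψ_n = Θ_n`, and `Θ_n` lowers degrees by `n(n-1)/2`. Hence `Ψ_n` kills every `P̃_λ(X)` of the kernel
except the one of the full staircase, which it sends to a constant. This constant is found by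
setting the last variable to zero and using the factorization `pfaffian_qPair_staircase`.

Divided differences are studied on functions of points where no root vanishes, so that they are
genuine quotients; in the end the point consists of independent variables and evaluation is
injective. Coordinates and generators are numbered from `0`, so that `opS 0` is `-∂_1`. -/

namespace TypeD

noncomputable section

/-! ### Divided differences on functions of generic points, and their braid relations. -/

section Points

variable {K : Type*} [Field K]

/-- Sequences on which no root of type `D` vanishes. -/
structure GenPt (K : Type*) [Field K] where
  /-- The underlying sequence. -/
  val : ℕ → K
  generic : ∀ i j, i ≠ j → val i - val j ≠ 0 ∧ val i + val j ≠ 0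

instance : CoeFun (GenPt K) fun _ => ℕ → K := ⟨GenPt.val⟩

namespace GenPt

@[ext] theorem ext {p q : GenPt K} (h : ∀ i, p i = q i) : p = q := by
  cases p; cases q; congr; exact _root_.funext h

theorem sub_ne (p : GenPt K) {i j : ℕ} (h : i ≠ j) : p i - p j ≠ 0 := (p.2 i j h).1

theorem add_ne (p : GenPt K) {i j : ℕ} (h : i ≠ j) : p i + p j ≠ 0 := (p.2 i j h).2

/-- Permute the coordinates of a point. -/
def perm (e : Equiv.Perm ℕ) (p : GenPt K) : GenPt K :=
  ⟨fun i => p (e i), fun _ _ h => p.2 _ _ (e.injective.ne h)⟩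

/-- Change the sign of the coordinates with index in `N`. -/
def flip (N : Finset ℕ) (p : GenPt K) : GenPt K :=
  ⟨fun i => if i ∈ N then -p i else p i, fun i j h => by
    have h1 := p.sub_ne h
    have h2 := p.add_ne h
    have h3 : -p i - p j ≠ 0 := fun h => h2 (by linear_combination -h)
    have h4 : -p i + p j ≠ 0 := fun h => h1 (by linear_combination -h)
    split_ifs
    · exact ⟨fun h => h1 (by linear_combination -h), fun h => h2 (by linear_combination -h)⟩
    · exact ⟨h3, h4⟩
    · exact ⟨by simpa using h2, by simpa [sub_eq_add_neg] using h1⟩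
    · exact ⟨h1, h2⟩⟩

@[simp] theorem perm_apply (e : Equiv.Perm ℕ) (p : GenPt K) (i : ℕ) : perm e p i = p (e i) := rfl

@[simp] theorem flip_apply (N : Finset ℕ) (p : GenPt K) (i : ℕ) :
    flip N p i = if i ∈ N then -p i else p i := rfl

/-- Exchange the coordinates `i` and `i + 1`. -/
abbrev sw (i : ℕ) (p : GenPt K) : GenPt K := perm (Equiv.swap i (i + 1)) p

/-- Change the sign of the first coordinate. -/
abbrev neg0 (p : GenPt K) : GenPt K := flip {0} p

theorem perm_perm (e f : Equiv.Perm ℕ) (p : GenPt K) : perm e (perm f p) = perm (f * e) p := rfl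

theorem sw_left (i : ℕ) (p : GenPt K) : sw i p i = p (i + 1) := by simp

theorem sw_right (i : ℕ) (p : GenPt K) : sw i p (i + 1) = p i := by simp

theorem sw_of_ne {i k : ℕ} (p : GenPt K) (h1 : k ≠ i) (h2 : k ≠ i + 1) : sw i p k = p k := by
  simp [Equiv.swap_apply_of_ne_of_ne h1 h2]

@[simp] theorem flip_empty (p : GenPt K) : flip ∅ p = p := by ext; simp

@[simp] theorem sw_sw (i : ℕ) (p : GenPt K) : sw i (sw i p) = p := by ext; simp

theorem flip_flip (M N : Finset ℕ) (p : GenPt K) : flip M (flip N p) = flip (symmDiff M N) p := by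
  ext i
  simp only [flip_apply, Finset.mem_symmDiff]
  by_cases h1 : i ∈ M <;> by_cases h2 : i ∈ N <;> simp [h1, h2]

@[simp] theorem flip_flip_self (N : Finset ℕ) (p : GenPt K) : flip N (flip N p) = p := by
  simp [flip_flip]

@[simp] theorem neg0_neg0 (p : GenPt K) : neg0 (neg0 p) = p := flip_flip_self _ _

theorem flip_perm (N : Finset ℕ) (e : Equiv.Perm ℕ) (p : GenPt K) :
    flip N (perm e p) = perm e (flip (N.map e.toEmbedding) p) := by
  ext i; simp

theorem neg0_sw {i : ℕ} (hi : 1 ≤ i) (p : GenPt K) : neg0 (sw i p) = sw i (neg0 p) := by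
  have : ({0} : Finset ℕ).map (Equiv.swap i (i + 1)).toEmbedding = {0} := by
    simp [Equiv.swap_apply_of_ne_of_ne (show 0 ≠ i by omega) (show 0 ≠ i + 1 by omega)]
  rw [neg0, flip_perm, this]

theorem sw_comm {i j : ℕ} (h : i + 2 ≤ j) (p : GenPt K) : sw i (sw j p) = sw j (sw i p) := by
  ext k
  simp only [perm_apply]
  congr 1
  simp only [Equiv.swap_apply_def]
  grind

theorem sw_braid (i : ℕ) (p : GenPt K) :
    sw i (sw (i + 1) (sw i p)) = sw (i + 1) (sw i (sw (i + 1) p)) := by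
  ext k
  simp only [perm_apply]
  congr 1
  simp only [Equiv.swap_apply_def]
  grind

end GenPt

open GenPt

/-- The operator `-∂_i` on functions of generic points. -/
def opS (i : ℕ) (φ : GenPt K → K) (p : GenPt K) : K := (φ (sw i p) - φ p) / (p i - p (i + 1))

/-- The operator `∂_□` on functions of generic points. -/
def opBox (φ : GenPt K → K) (p : GenPt K) : K :=
  (φ p - φ (neg0 (sw 0 (neg0 p)))) / (p 0 + p 1)

/-- Changing the sign of the first coordinate turns the root `x₁ + x₂` into `x₂ - x₁`. Conjugation
by `neg0` therefore reduces the relations of `opBox` with `opS j`, `j ≥ 1`, to type `A`. -/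
theorem opBox_apply (φ : GenPt K → K) (p : GenPt K) :
    opBox φ p = opS 0 (fun q => φ (neg0 q)) (neg0 p) := by
  have h1 : neg0 p 0 - neg0 p (0 + 1) = -(p 0 + p 1) := by simp; ring
  rw [opBox, opS, h1, neg0_neg0, div_neg, ← neg_div, neg_sub]

theorem opS_comp_neg0 {i : ℕ} (hi : 1 ≤ i) (φ : GenPt K → K) (p : GenPt K) :
    opS i φ (neg0 p) = opS i (fun q => φ (neg0 q)) p := by
  have h0 : i ≠ 0 := by omega
  simp only [opS]
  rw [← neg0_sw hi]
  simp [h0]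

theorem opS_opS (i : ℕ) (φ : GenPt K → K) : opS i (opS i φ) = 0 := by
  funext p
  simp only [opS, sw_sw, sw_left, sw_right, Pi.zero_apply]
  have := p.sub_ne (show i ≠ i + 1 by omega)
  have h2 : p (i + 1) - p i ≠ 0 := p.sub_ne (by omega)
  field_simp
  ring

theorem opBox_opBox (φ : GenPt K → K) : opBox (opBox φ) = 0 := by
  funext p
  have : opBox (opBox φ) p = opS 0 (opS 0 fun q => φ (neg0 q)) (neg0 p) := by
    rw [opBox_apply]
    congr 1
    funext q
    rw [opBox_apply, neg0_neg0]
  rw [this, opS_opS]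
  rfl

theorem opS_comm {i j : ℕ} (h : i + 2 ≤ j) (φ : GenPt K → K) :
    opS i (opS j φ) = opS j (opS i φ) := by
  funext p
  simp only [opS]
  rw [sw_of_ne p (show j ≠ i by omega) (by omega), sw_of_ne p (show j + 1 ≠ i by omega) (by omega),
    sw_of_ne p (show i ≠ j by omega) (by omega), sw_of_ne p (show i + 1 ≠ j by omega) (by omega),
    sw_comm h p]
  have := p.sub_ne (show i ≠ i + 1 by omega)
  have := p.sub_ne (show j ≠ j + 1 by omega)
  field_simp
  ring

theorem opS_braid (i : ℕ) (φ : GenPt K → K) :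
    opS i (opS (i + 1) (opS i φ)) = opS (i + 1) (opS i (opS (i + 1) φ)) := by
  funext p
  have e1 : i + 1 + 1 = i + 2 := rfl
  simp only [opS, e1]
  have hb := sw_braid i p
  rw [hb, sw_sw, sw_sw]
  have a1 : ∀ q : GenPt K, sw i q i = q (i + 1) := sw_left i
  have a2 : ∀ q : GenPt K, sw i q (i + 1) = q i := sw_right i
  have a3 : ∀ q : GenPt K, sw i q (i + 2) = q (i + 2) := fun q =>
    sw_of_ne q (by omega) (by omega)
  have b1 : ∀ q : GenPt K, sw (i + 1) q (i + 1) = q (i + 2) := sw_left (i + 1)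
  have b2 : ∀ q : GenPt K, sw (i + 1) q (i + 2) = q (i + 1) := sw_right (i + 1)
  have b3 : ∀ q : GenPt K, sw (i + 1) q i = q i := fun q => sw_of_ne q (by omega) (by omega)
  simp only [a1, a2, a3, b1, b2, b3]
  have h1 := p.sub_ne (show i ≠ i + 1 by omega)
  have h2 := p.sub_ne (show i + 1 ≠ i + 2 by omega)
  have h3 := p.sub_ne (show i ≠ i + 2 by omega)
  have h4 := p.sub_ne (show i + 1 ≠ i by omega)
  have h5 := p.sub_ne (show i + 2 ≠ i + 1 by omega)
  -- The six values of `φ` on the `S₃`-orbit and the three coordinates become free variables; what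
  -- is left is an identity of rational functions.
  generalize φ (sw (i + 1) (sw i (sw (i + 1) p))) = A at *
  generalize φ (sw i (sw (i + 1) p)) = B at *
  generalize φ (sw (i + 1) (sw i p)) = C at *
  generalize φ (sw i p) = D at *
  generalize φ (sw (i + 1) p) = E at *
  generalize φ p = F at *
  generalize p i = a at *
  generalize p (i + 1) = b at *
  generalize p (i + 2) = c at *
  rw [show b - a = -(a - b) by ring] at *
  rw [show c - b = -(b - c) by ring] at *
  field_simp
  ring

/-- For `j = 0` the roots `x₁ - x₂` and `x₁ + x₂` are orthogonal, and a direct computation is needed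
because `neg0` does not commute with `sw 0`. For `j ≥ 2` conjugation by `neg0` gives commuting
operators of type `A`. -/
theorem opBox_comm_opS {j : ℕ} (h : j ≠ 1) (φ : GenPt K → K) :
    opBox (opS j φ) = opS j (opBox φ) := by
  funext p
  rcases Nat.eq_zero_or_pos j with rfl | hj
  · have e : neg0 (sw 0 (neg0 (sw 0 p))) = sw 0 (neg0 (sw 0 (neg0 p))) := by
      ext k
      simp only [perm_apply, flip_apply, Equiv.swap_apply_def, Finset.mem_singleton]
      rcases k with _ | _ | k <;> simp
    simp only [opS, opBox, e]
    have h1 := p.sub_ne (show 0 ≠ 1 by omega)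
    have h2 := p.add_ne (show 0 ≠ 1 by omega)
    have h3 := p.add_ne (show 1 ≠ 0 by omega)
    have h4 : -p 1 + p 0 ≠ 0 := fun h => h1 (by linear_combination h)
    simp [zero_add]
    rw [add_comm (p 1) (p 0), add_comm (-p 1) (p 0), ← sub_eq_add_neg]
    field_simp
    ring
  · have hj : 2 ≤ j := by omega
    have : opS j (opBox φ) p = opS j (fun q => opBox φ (neg0 q)) (neg0 p) := by
      rw [← opS_comp_neg0 (by omega), neg0_neg0]
    have e2 : (fun q => opBox φ (neg0 q)) = opS 0 fun q => φ (neg0 q) := by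
      funext q; rw [opBox_apply, neg0_neg0]
    have e3 : (fun q => opS j φ (neg0 q)) = opS j fun q => φ (neg0 q) :=
      _root_.funext fun q => opS_comp_neg0 (by omega) φ q
    rw [this, e2, ← opS_comm (by omega), ← e3, ← opBox_apply]

theorem opBox_braid (φ : GenPt K → K) :
    opBox (opS 1 (opBox φ)) = opS 1 (opBox (opS 1 φ)) := by
  have e2 : ∀ φ : GenPt K → K, (fun q => opBox φ (neg0 q)) = opS 0 fun q => φ (neg0 q) := by
    intro φ; funext q; rw [opBox_apply, neg0_neg0]
  have e3 : ∀ φ : GenPt K → K, (fun q => opS 1 φ (neg0 q)) = opS 1 fun q => φ (neg0 q) :=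
    fun φ => _root_.funext fun q => opS_comp_neg0 le_rfl φ q
  have key : (fun q => opBox (opS 1 (opBox φ)) (neg0 q)) =
      fun q => opS 1 (opBox (opS 1 φ)) (neg0 q) := by
    rw [e2, e3, e2, e3, e2, e3]
    exact opS_braid 0 _
  funext p
  simpa using congrFun key (neg0 p)

end Points

/-! ### A homogeneous Lagrange interpolation formula. -/

section Lagrange

variable {K : Type*} [Field K]

theorem sum_insert_mul_prod_erase {ι : Type*} [DecidableEq ι] {S : Finset ι} {a : ι} (ha : a ∉ S)
    (f : ι → K) (h : ι → ι → K) :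
    ∑ m ∈ insert a S, f m * ∏ l ∈ (insert a S).erase m, h m l =
      f a * ∏ l ∈ S, h a l + ∑ m ∈ S, f m * (h m a * ∏ l ∈ S.erase m, h m l) := by
  rw [Finset.sum_insert ha, Finset.erase_insert ha]
  congr 1
  refine Finset.sum_congr rfl fun m hm => ?_
  have hma : m ≠ a := fun h => ha (h ▸ hm)
  rw [Finset.erase_insert_of_ne hma.symm, Finset.prod_insert (by simp [ha])]

/-- Lagrange interpolation of `∏ (X + v l)` at the points `v l` and one more point, in
homogeneous form. -/
theorem lagrange_prod_add {ι : Type*} [DecidableEq ι] {P : Finset ι} {o : ι} (ho : o ∉ P)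
    {v : ι → K} (hv : Set.InjOn v (insert o P : Finset ι)) (e y : K) :
    ∑ i ∈ insert o P, (∏ l ∈ P, (v l + v i)) *
      ∏ j ∈ (insert o P).erase i, (y - e * v j) / (v i - v j) = ∏ l ∈ P, (e * v l + y) := by
  let f : Polynomial K := ∏ l ∈ P, (Polynomial.X + Polynomial.C (v l))
  have hf : f.Monic := Polynomial.monic_prod_of_monic _ _ fun i _ => Polynomial.monic_X_add_C _
  have hdeg : f.natDegree = P.card := by
    rw [Polynomial.natDegree_prod_of_monic _ _ fun i _ => Polynomial.monic_X_add_C _]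
    simp
  have hcard : (insert o P).card = P.card + 1 := Finset.card_insert_of_notMem ho
  have hev : ∀ t, f.eval t = ∏ l ∈ P, (v l + t) := fun t => by
    simp [f, Polynomial.eval_prod, add_comm]
  have hd : f.degree = P.card := by rw [Polynomial.degree_eq_natDegree hf.ne_zero, hdeg]
  by_cases he : e = 0
  -- For `e = 0` there is no evaluation point `y / e`; the identity becomes the formula for the
  -- leading coefficient of `f`, which is `1`.
  · have h1 := Lagrange.leadingCoeff_eq_sum hv (P := f) (by rw [hd, hcard]; norm_cast)
    rw [hf.leadingCoeff] at h1
    subst he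
    simp only [zero_mul, sub_zero, zero_add, Finset.prod_const]
    rw [← one_mul (y ^ _), h1, Finset.sum_mul]
    refine Finset.sum_congr rfl fun i hi => ?_
    rw [Finset.prod_div_distrib, hev, Finset.prod_const, Finset.card_erase_of_mem hi, hcard,
      Nat.add_sub_cancel]
    ring
  -- Interpolation evaluated at `y / e`; multiplication by `e ^ P.card` then clears the
  -- denominators.
  · have h1 := congrArg (Polynomial.eval (y / e)) (Lagrange.eq_interpolate hv (f := f)
      (by rw [hd, hcard]; norm_cast; omega))
    rw [Lagrange.interpolate_eq_sum, Polynomial.eval_finsetSum, hev] at h1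
    have h2 : ∏ l ∈ P, (e * v l + y) = e ^ P.card * ∏ l ∈ P, (v l + y / e) := by
      rw [← Finset.prod_const, ← Finset.prod_mul_distrib]
      exact Finset.prod_congr rfl fun l _ => by field_simp
    rw [h2, h1, Finset.mul_sum]
    refine Finset.sum_congr rfl fun i hi => ?_
    simp only [Polynomial.eval_mul, Polynomial.eval_C, Polynomial.eval_prod, Polynomial.eval_sub,
      Polynomial.eval_X, hev]
    have h3 : ∏ j ∈ (insert o P).erase i, (y - e * v j) =
        e ^ P.card * ∏ j ∈ (insert o P).erase i, (y / e - v j) := by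
      have : P.card = ((insert o P).erase i).card := by
        rw [Finset.card_erase_of_mem hi, hcard, Nat.add_sub_cancel]
      rw [this, ← Finset.prod_const, ← Finset.prod_mul_distrib]
      exact Finset.prod_congr rfl fun l _ => by field_simp
    rw [Finset.prod_div_distrib, h3]
    ring

end Lagrange

open GenPt

/-! ### Sums over sign changes, and the interpolation identity for a fixed set of signs. -/

section SignSums

variable {K : Type*} [Field K]

/-- The product of the sums `p i + p j` over the pairs of distinct elements of `S`. -/
def pairProd (S : Finset ℕ) (p : GenPt K) : K := ∏ u ∈ S.powersetCard 2, ∑ i ∈ u, p i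

/-- The sum of `F` over the points obtained by changing the signs of a set of coordinates in `S`
whose cardinality has parity `s`. -/
def signSum (S : Finset ℕ) (s : ℤˣ) (F : GenPt K → K) (p : GenPt K) : K :=
  ∑ N ∈ S.powerset with (-1 : ℤˣ) ^ N.card = s, F (flip N p)

theorem pairProd_insert {S : Finset ℕ} {a : ℕ} (ha : a ∉ S) (p : GenPt K) :
    pairProd (insert a S) p = pairProd S p * ∏ i ∈ S, (p a + p i) := by
  rw [pairProd, Finset.powersetCard_succ_insert ha, Finset.prod_union, ← pairProd,
    Finset.powersetCard_one, Finset.prod_image, Finset.prod_map]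
  · congr 1
    refine Finset.prod_congr rfl fun i hi => ?_
    have : a ≠ i := fun h => ha (h ▸ hi)
    simp [this]
  · intro u hu v hv h
    obtain ⟨i, hi, rfl⟩ := Finset.mem_map.1 hu
    obtain ⟨j, hj, rfl⟩ := Finset.mem_map.1 hv
    have h1 : a ≠ i := fun h => ha (h ▸ hi)
    have : i ∈ insert a ({j} : Finset ℕ) := by
      have h3 : i ∈ insert a ({i} : Finset ℕ) := by simp
      exact h ▸ h3
    simp [h1.symm] at this
    simp [this]
  · rw [Finset.disjoint_left]
    intro u hu hu'
    obtain ⟨v, _, rfl⟩ := Finset.mem_image.1 hu'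
    exact ha ((Finset.mem_powersetCard.1 hu).1 (Finset.mem_insert_self _ _))

theorem pairProd_perm (S : Finset ℕ) (e : Equiv.Perm ℕ) (p : GenPt K) :
    pairProd S (perm e p) = pairProd (S.map e.toEmbedding) p := by
  simp [pairProd, Finset.powersetCard_map, Finset.prod_map]

theorem pairProd_ne_zero (S : Finset ℕ) (p : GenPt K) : pairProd S p ≠ 0 := by
  refine Finset.prod_ne_zero_iff.2 fun u hu => ?_
  obtain ⟨i, j, hij, rfl⟩ := Finset.card_eq_two.1 (Finset.mem_powersetCard.1 hu).2
  rw [Finset.sum_pair hij]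
  exact p.add_ne hij

theorem signSum_congr {S : Finset ℕ} {s : ℤˣ} {F F' : GenPt K → K} {p p' : GenPt K}
    (h : ∀ N ⊆ S, F (flip N p) = F' (flip N p')) : signSum S s F p = signSum S s F' p' :=
  Finset.sum_congr rfl fun _ hN => h _ (Finset.mem_powerset.1 (Finset.mem_filter.1 hN).1)

theorem signSum_perm (S : Finset ℕ) (s : ℤˣ) (F : GenPt K → K) (e : Equiv.Perm ℕ) (p : GenPt K) :
    signSum S s F (perm e p) = signSum (S.map e.toEmbedding) s (fun q => F (perm e q)) p := by
  refine Finset.sum_bij (fun N _ => N.map e.toEmbedding) ?_ ?_ ?_ ?_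
  · intro N hN
    simp only [Finset.mem_filter, Finset.mem_powerset] at hN ⊢
    exact ⟨Finset.map_subset_map.2 hN.1, by simpa using hN.2⟩
  · intro M _ N _ h
    exact Finset.map_injective _ h
  · intro N hN
    simp only [Finset.mem_filter, Finset.mem_powerset] at hN
    refine ⟨N.map e.symm.toEmbedding, ?_, ?_⟩
    · simp only [Finset.mem_filter, Finset.mem_powerset, Finset.card_map]
      refine ⟨fun i hi => ?_, hN.2⟩
      obtain ⟨j, hj, rfl⟩ := Finset.mem_map.1 hi
      obtain ⟨k, hk, rfl⟩ := Finset.mem_map.1 (hN.1 hj)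
      simpa using hk
    · ext i; simp
  · intro N _
    rw [flip_perm]

theorem units_pow_card_insert {N : Finset ℕ} {o : ℕ} (h : o ∉ N) :
    (-1 : ℤˣ) ^ (insert o N).card = -(-1) ^ N.card := by
  rw [Finset.card_insert_of_notMem h, pow_succ]; simp

theorem flip_insert {N : Finset ℕ} {o : ℕ} (h : o ∉ N) (p : GenPt K) :
    flip (insert o N) p = flip N (flip {o} p) := by
  rw [GenPt.flip_flip]
  congr 1
  ext i
  simp only [Finset.mem_insert, Finset.mem_symmDiff, Finset.mem_singleton]
  grind

theorem signSum_insert {T : Finset ℕ} {o : ℕ} (ho : o ∉ T) (s : ℤˣ) (F : GenPt K → K)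
    (p : GenPt K) :
    signSum (insert o T) s F p = signSum T s F p + signSum T (-s) F (flip {o} p) := by
  rw [signSum, Finset.powerset_insert, Finset.filter_union, Finset.sum_union]
  · congr 1
    rw [Finset.filter_image, Finset.sum_image]
    · refine Finset.sum_congr ?_ ?_
      · ext N
        simp only [Finset.mem_filter, Finset.mem_powerset]
        refine and_congr_right fun hN => ?_
        rw [units_pow_card_insert fun h => ho (hN h), neg_eq_iff_eq_neg]
      · intro N hN
        simp only [Finset.mem_filter, Finset.mem_powerset] at hN
        rw [flip_insert fun h => ho (hN.1 h)]
    · intro M hM N hN h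
      simp only [Finset.coe_filter, Finset.mem_powerset, Set.mem_ofPred_eq] at hM hN
      rw [← Finset.erase_insert fun h => ho (hM.1 h), h, Finset.erase_insert fun h => ho (hN.1 h)]
  · rw [Finset.disjoint_left]
    intro N hN hN'
    simp only [Finset.mem_filter, Finset.mem_powerset, Finset.mem_image] at hN hN'
    obtain ⟨⟨M, _, rfl⟩, _⟩ := hN'
    exact ho (hN.1 (Finset.mem_insert_self _ _))

/-- One extra sign change inside `S` exchanges the even and the odd sign changes. -/
theorem signSum_flip {S : Finset ℕ} {o : ℕ} (ho : o ∈ S) (s : ℤˣ) (F : GenPt K → K)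
    (p : GenPt K) : signSum S s F (flip {o} p) = signSum S (-s) F p := by
  rw [← Finset.insert_erase ho, signSum_insert (Finset.notMem_erase _ _),
    signSum_insert (Finset.notMem_erase _ _), flip_flip_self, neg_neg, add_comm]

/-- `∑ φ(q) / ∏_{i < j} (q_i + q_j)` over the points `q` obtained from `p` by changing an even
number of signs among the first `n` coordinates. -/
def psi (n : ℕ) (φ : GenPt K → K) : GenPt K → K :=
  signSum (Finset.range n) 1 fun q => φ q / pairProd (Finset.range n) q

/-- The quotient `∏ (e q_i - y) / ∏_{i < j} (q_i + q_j)`. -/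
def ratio (e y : K) (S : Finset ℕ) (q : GenPt K) : K := (∏ i ∈ S, (e * q i - y)) / pairProd S q

/-- At a flipped index the quotient `(c + flip N p i) / (c - p i)` is `1`, so the factor no longer
depends on `c`. Only the unflipped indices survive as interpolation nodes. -/
theorem prod_flip_ratio (e y c : K) (p : GenPt K) {A N : Finset ℕ} (hN : N ⊆ A)
    (hc : ∀ i ∈ A, c - p i ≠ 0) :
    ∏ i ∈ A, (e * flip N p i - y) * (c + flip N p i) / (c - p i) =
      (-1) ^ A.card * ((∏ i ∈ N, (e * p i + y)) *
        ∏ i ∈ A \ N, (y - e * p i) * (c + p i) / (c - p i)) := by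
  rw [← Finset.prod_sdiff hN, mul_comm (∏ i ∈ N, _), ← Finset.prod_const]
  rw [← Finset.prod_sdiff hN (f := fun _ => (-1 : K)), mul_mul_mul_comm, ← Finset.prod_mul_distrib,
    ← Finset.prod_mul_distrib]
  congr 1
  · refine Finset.prod_congr rfl fun i hi => ?_
    rw [flip_apply, if_neg (Finset.mem_sdiff.1 hi).2]
    ring
  · refine Finset.prod_congr rfl fun i hi => ?_
    rw [flip_apply, if_pos hi]
    have := hc i (hN hi)
    rw [mul_div_assoc, ← sub_eq_add_neg, div_self this]
    ring

theorem ratio_mul_pairProd_insert (e y : K) {S : Finset ℕ} {a : ℕ} (ha : a ∉ S) (q : GenPt K) :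
    ratio e y S q * pairProd (insert a S) q = ∏ i ∈ S, (e * q i - y) * (q a + q i) := by
  rw [pairProd_insert ha, ratio, Finset.prod_mul_distrib]
  have := pairProd_ne_zero S q
  field_simp

/-- After multiplication by `pairProd (insert o T) (flip N p)`, this is `lagrange_prod_add` with the
nodes `p i`, `i ∈ insert o (T \ N)`. The first summand is the term of the node `o`, and the indices
in `N` contribute a common factor. -/
theorem ratio_interpolation (e y : K) (p : GenPt K) {T N : Finset ℕ} {o : ℕ} (ho : o ∉ T)
    (hN : N ⊆ T) :
    ratio e y T (flip N p) / ∏ l ∈ T, (p o - p l) +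
      ∑ m ∈ T \ N, ratio e y (insert o (T.erase m)) (flip N p) *
        ((1 / (p m - p o) + 1 / (p m + p o)) / ∏ l ∈ T.erase m, (p m - p l)) =
      (-1) ^ T.card * (∏ k ∈ T, (e * p k + y)) / pairProd (insert o T) (flip N p) := by
  have hV := pairProd_ne_zero (insert o T) (flip N p)
  rw [eq_div_iff hV]
  have hoN : o ∉ N := fun h => ho (hN h)
  have hoP : o ∉ T \ N := fun h => ho (Finset.mem_sdiff.1 h).1
  have hinj : Set.InjOn (fun i => p i) (insert o (T \ N) : Finset ℕ) := fun i _ j _ h =>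
    by_contra fun hij => p.sub_ne hij (sub_eq_zero.2 h)
  have hL := lagrange_prod_add hoP hinj e y
  rw [← Finset.prod_sdiff hN (f := fun k => e * p k + y), ← hL, sum_insert_mul_prod_erase hoP,
    add_mul, Finset.sum_mul, add_mul, mul_add, Finset.sum_mul, Finset.mul_sum]
  congr 1
  · rw [div_mul_eq_mul_div, ratio_mul_pairProd_insert e y ho, ← Finset.prod_div_distrib]
    have h1 : flip N p o = p o := by simp [hoN]
    rw [h1, prod_flip_ratio e y (p o) p hN fun i hi => p.sub_ne fun h => ho (h ▸ hi)]
    simp only [mul_div_assoc, Finset.prod_mul_distrib]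
    simp only [add_comm (p o), Finset.prod_div_distrib]
    ring
  · refine Finset.sum_congr rfl fun m hm => ?_
    obtain ⟨hmT, hmN⟩ := Finset.mem_sdiff.1 hm
    have hmo : m ≠ o := fun h => ho (h ▸ hmT)
    have h1 : flip N p m = p m := by simp [hmN]
    have h2 : flip N p o = p o := by simp [hoN]
    have hins : insert o T = insert m (insert o (T.erase m)) := by
      rw [Finset.insert_comm, Finset.insert_erase hmT]
    have hm' : m ∉ insert o (T.erase m) := by simp [hmo]
    rw [mul_right_comm, hins, ratio_mul_pairProd_insert e y hm', Finset.prod_insert (by simp [ho]),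
      h1, h2]
    have hNe : N ⊆ T.erase m := fun i hi => Finset.mem_erase.2 ⟨fun h => hmN (h ▸ hi), hN hi⟩
    have key := prod_flip_ratio e y (p m) p hNe fun i hi => p.sub_ne (Finset.mem_erase.1 hi).1.symm
    have hcard : T.card = (T.erase m).card + 1 := (Finset.card_erase_add_one hmT).symm
    have hsd : T.erase m \ N = (T \ N).erase m := by
      ext i; simp only [Finset.mem_sdiff, Finset.mem_erase]; tauto
    rw [← Finset.mul_prod_erase (T \ N) _ hm]
    rw [Finset.prod_div_distrib, hsd] at key
    have ha := p.add_ne hmo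
    have hb := p.sub_ne hmo
    have h3 : ∀ A X B D : K, A * X * (B / D) = A * B * (X / D) := fun A X B D => by ring
    rw [h3, key, hcard, pow_succ]
    simp only [Finset.prod_div_distrib, Finset.prod_mul_distrib, add_comm (p m)]
    have h4 : p o + p m ≠ 0 := by rwa [add_comm]
    -- The numerator `2 p_m` is the factor `l = m` of `∏ (p l + p m)` in the interpolation formula;
    -- the sum `p o + p m` in the denominator cancels a factor of `pairProd`.
    have h5 : 1 / (p m - p o) + 1 / (p o + p m) = (p m + p m) / ((p m - p o) * (p o + p m)) := by
      field_simp; ring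
    rw [h5]
    field_simp
    ring

end SignSums

open GenPt

/-! ### Evaluation of `theta n` on a product of `upperProd` and a symmetric function. -/

section Recursion

variable {K : Type*} [Field K]

theorem signSum_ratio (e y : K) (φ : GenPt K → K) (s : ℤˣ) (p : GenPt K) {T : Finset ℕ} {o : ℕ}
    (ho : o ∉ T) :
    signSum T s (fun q => φ q * ratio e y T q) p / ∏ l ∈ T, (p o - p l) +
      ∑ m ∈ T, signSum (T.erase m) s (fun q => φ q * ratio e y (insert o (T.erase m)) q) p *
        ((1 / (p m - p o) + 1 / (p m + p o)) / ∏ l ∈ T.erase m, (p m - p l)) =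
      (-1) ^ T.card * (∏ k ∈ T, (e * p k + y)) *
        signSum T s (fun q => φ q / pairProd (insert o T) q) p := by
  simp only [signSum, Finset.sum_mul]
  -- A sign set `N ⊆ T` avoids `m` exactly when `m ∈ T \ N`, which is the range of summation in
  -- `ratio_interpolation`.
  rw [Finset.sum_comm' (s := T) (t' := T.powerset.filter fun N => (-1 : ℤˣ) ^ N.card = s)
    (s' := fun N => T \ N)]
  · rw [Finset.sum_div, ← Finset.sum_add_distrib, Finset.mul_sum]
    refine Finset.sum_congr rfl fun N hN => ?_
    have hN := Finset.mem_powerset.1 (Finset.mem_filter.1 hN).1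
    have := ratio_interpolation e y p ho hN
    rw [mul_div_left_comm, ← this, mul_add, Finset.mul_sum]
    congr 1
    · rw [mul_div_assoc]
    · exact Finset.sum_congr rfl fun m _ => by rw [mul_assoc]
  · intro m N
    simp only [Finset.mem_filter, Finset.mem_powerset, Finset.mem_sdiff, Finset.subset_erase]
    tauto

/-- The two sums come from the two summands `opS 0` and `opBox` of the recursion for `theta`. For `m
≠ o`, splitting by the sign at `o` makes each inner sum occur once with weight `1 / (p m - p o)` and
once with `1 / (p m + p o)`, as `signSum_ratio` requires at `p` and at `flip {o} p`. -/
theorem signSum_ratio_insert (e y : K) (φ : GenPt K → K) (p : GenPt K) {T : Finset ℕ} {o : ℕ}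
    (ho : o ∉ T) :
    ∑ m ∈ insert o T, signSum ((insert o T).erase m) 1
        (fun q => φ q * ratio e y ((insert o T).erase m) q) p *
          ∏ l ∈ (insert o T).erase m, 1 / (p m - p l) +
      ∑ m ∈ insert o T, signSum ((insert o T).erase m) (-1)
        (fun q => φ q * ratio e y ((insert o T).erase m) q) (flip {o} p) *
          ∏ l ∈ (insert o T).erase m, 1 / (flip {o} p m - flip {o} p l) =
      (-1) ^ T.card * (∏ k ∈ T, (e * p k + y)) *
        signSum (insert o T) 1 (fun q => φ q / pairProd (insert o T) q) p := by
  have hT : ∀ k ∈ T, flip {o} p k = p k := fun k hk => by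
    have : k ≠ o := fun h => ho (h ▸ hk)
    simp [this]
  have h1 := signSum_ratio e y φ 1 p ho
  have h2 := signSum_ratio e y φ (-1) (flip {o} p) ho
  have h0 : ∏ k ∈ T, (e * flip {o} p k + y) = ∏ k ∈ T, (e * p k + y) :=
    Finset.prod_congr rfl fun k hk => by rw [hT k hk]
  rw [h0] at h2
  rw [signSum_insert ho, mul_add, ← h1, ← h2, Finset.sum_insert ho, Finset.sum_insert ho,
    Finset.erase_insert ho]
  simp only [Finset.prod_div_distrib, Finset.prod_const_one, mul_one_div]
  rw [add_add_add_comm]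
  conv_rhs => rw [add_add_add_comm]
  congr 1
  rw [← Finset.sum_add_distrib, ← Finset.sum_add_distrib]
  refine Finset.sum_congr rfl fun m hm => ?_
  have hmo : m ≠ o := fun h => ho (h ▸ hm)
  have he : (insert o T).erase m = insert o (T.erase m) := Finset.erase_insert_of_ne hmo.symm
  have hoe : o ∉ T.erase m := by simp [ho]
  rw [he, signSum_flip (Finset.mem_insert_self _ _), neg_neg, signSum_insert hoe,
    Finset.prod_insert hoe, Finset.prod_insert hoe]
  have h3 : ∏ l ∈ T.erase m, (flip {o} p m - flip {o} p l) = ∏ l ∈ T.erase m, (p m - p l) :=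
    Finset.prod_congr rfl fun l hl => by rw [hT m hm, hT l (Finset.mem_erase.1 hl).2]
  have h4 : flip {o} p o = -p o := by simp
  rw [h3, hT m hm, h4, sub_neg_eq_add, ← sub_eq_add_neg]
  simp only [div_eq_mul_inv, mul_inv]
  ring

/-- `∏_{b < a < n} (e p_a + y_b)`. -/
def lowerProd (e : K) (y : ℕ → K) (n : ℕ) (p : GenPt K) : K :=
  ∏ a ∈ Finset.range n, ∏ b ∈ Finset.range a, (e * p a + y b)

/-- `∏_{i + j + 2 ≤ n} (e p_i - y_j)`. -/
def upperProd (e : K) (y : ℕ → K) (n : ℕ) (p : GenPt K) : K :=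
  ∏ i ∈ Finset.range n, ∏ j ∈ Finset.range (n - 1 - i), (e * p i - y j)

/-- The factors that contain `y 0` form a symmetric function of the first `n` coordinates. It can be
absorbed into `φ`, and the same problem for `n` with shifted `y` is left. -/
theorem upperProd_succ (e : K) (y : ℕ → K) (n : ℕ) (p : GenPt K) :
    upperProd e y (n + 1) p =
      (∏ i ∈ Finset.range n, (e * p i - y 0)) * upperProd e (fun j => y (j + 1)) n p := by
  rw [upperProd, Finset.prod_range_succ, upperProd, ← Finset.prod_mul_distrib]
  simp only [Nat.add_sub_cancel, Nat.sub_self, Finset.range_zero, Finset.prod_empty, mul_one]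
  refine Finset.prod_congr rfl fun i hi => ?_
  have hi := Finset.mem_range.1 hi
  rw [show n - i = n - 1 - i + 1 by omega, Finset.prod_range_succ', mul_comm]

/-- The composition of the operators `opS k, …, opS (k + d - 1)`. -/
def opRun : ℕ → ℕ → (GenPt K → K) → GenPt K → K
  | _, 0, φ => φ
  | k, d + 1, φ => opS k (opRun (k + 1) d φ)

/-- The sum of the operators `∂'_w` over the signed permutations `w` of type `D` that are equal to
`(n, …, 1)` in absolute value. -/
def theta : ℕ → (GenPt K → K) → GenPt K → K
  | 0, φ => φ
  | 1, φ => φ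
  | n + 2, φ => opS 0 (opRun 1 n (theta (n + 1) φ)) + opBox (opRun 1 n (theta (n + 1) φ))

/-- Invariance under the permutations of the first `n` coordinates. -/
def SymmOn (n : ℕ) (φ : GenPt K → K) : Prop :=
  ∀ a b, a < n → b < n → ∀ p, φ (perm (Equiv.swap a b) p) = φ p

/-- The product of `e p_a + y_b` over `k + 2 ≤ a ≤ n` and `k ≤ b ≤ a - 2`. -/
def runFactor (e : K) (y : ℕ → K) (k n : ℕ) (p : GenPt K) : K :=
  ∏ a ∈ Finset.Icc (k + 2) n, ∏ b ∈ Finset.Ico k (a - 1), (e * p a + y b)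

/-- A sum over the choices of a coordinate with index in `[k, n]`. -/
def runSum (e : K) (y : ℕ → K) (k n : ℕ) (γ : GenPt K → K) (p : GenPt K) : K :=
  ∑ m ∈ Finset.Icc k n, γ (perm (Equiv.swap m n) p) *
    ∏ l ∈ (Finset.Icc k n).erase m, (∏ j ∈ Finset.range k, (e * p l + y j)) / (p m - p l)

theorem runFactor_succ (e : K) (y : ℕ → K) (k n : ℕ) (p : GenPt K) :
    runFactor e y k n p =
      runFactor e y (k + 1) n p * ∏ a ∈ Finset.Icc (k + 2) n, (e * p a + y k) := by
  have h : runFactor e y (k + 1) n p =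
      ∏ a ∈ Finset.Icc (k + 2) n, ∏ b ∈ Finset.Ico (k + 1) (a - 1), (e * p a + y b) := by
    rw [runFactor]
    refine Finset.prod_subset (Finset.Icc_subset_Icc_left (by omega)) fun a ha ha' => ?_
    simp only [Finset.mem_Icc, not_and, not_le] at ha ha'
    rw [Finset.Ico_eq_empty (by omega), Finset.prod_empty]
  rw [h, runFactor, ← Finset.prod_mul_distrib]
  refine Finset.prod_congr rfl fun a ha => ?_
  have ha := Finset.mem_Icc.1 ha
  rw [Finset.prod_eq_prod_Ico_succ_bot (by omega), mul_comm]

/-- As `γ` is symmetric in the first `n` coordinates, only the coordinate in position `n` matters;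
exchanging the coordinates `k` and `k + 1` does not change it for `m ≥ k + 2`. -/
theorem swap_point {n k : ℕ} {γ : GenPt K → K} (hγ : SymmOn n γ) (hk : k + 1 ≤ n) (p : GenPt K)
    {m : ℕ} (hm : k + 2 ≤ m) (hmn : m ≤ n) :
    γ (perm (Equiv.swap m n) (sw k p)) = γ (perm (Equiv.swap m n) p) := by
  rw [← hγ k (k + 1) (by omega) (by omega) (perm (Equiv.swap m n) p), perm_perm, perm_perm]
  congr 2
  have h1 : k ≠ m := by omega
  have h2 : k ≠ n := by omega
  have h3 : k + 1 ≠ m := by omega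
  have h4 : k + 1 ≠ n := by omega
  ext i
  simp only [Equiv.Perm.mul_apply, Equiv.swap_apply_def]
  grind

theorem swap_point_succ {n k : ℕ} {γ : GenPt K → K} (hγ : SymmOn n γ) (hk : k + 1 ≤ n)
    (p : GenPt K) :
    γ (perm (Equiv.swap (k + 1) n) (sw k p)) = γ (perm (Equiv.swap k n) p) := by
  rcases hk.eq_or_lt with h | h
  · subst h
    rw [Equiv.swap_self]
    rfl
  · rw [← hγ k (k + 1) (by omega) (by omega) (perm (Equiv.swap k n) p), perm_perm, perm_perm]
    congr 2
    ext i
    simp only [Equiv.Perm.mul_apply, Equiv.swap_apply_def]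
    grind

/-- This is the effect of one operator `opS k` in the descending induction of `opRun_lowerProd`,
once the factors invariant under `sw k` have been removed. -/
theorem runSum_step (e : K) (y : ℕ → K) {k n : ℕ} (hk : k + 1 ≤ n) {γ : GenPt K → K}
    (hγ : SymmOn n γ) (p : GenPt K) :
    ((∏ j ∈ Finset.range k, (e * p (k + 1) + y j)) * runSum e y (k + 1) n γ (sw k p) -
      (∏ j ∈ Finset.range k, (e * p k + y j)) * runSum e y (k + 1) n γ p) / (p k - p (k + 1)) =
      (∏ a ∈ Finset.Icc (k + 2) n, (e * p a + y k)) * runSum e y k n γ p := by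
  set S := Finset.Icc (k + 2) n with hS
  have i1 : Finset.Icc (k + 1) n = insert (k + 1) S := by
    ext i; simp only [hS, Finset.mem_Icc, Finset.mem_insert]; omega
  have i2 : Finset.Icc k n = insert k (insert (k + 1) S) := by
    ext i; simp only [hS, Finset.mem_Icc, Finset.mem_insert]; omega
  have n1 : k + 1 ∉ S := by simp [hS]
  have n2 : k ∉ insert (k + 1) S := by simp [hS]
  have hmem : ∀ m ∈ S, k + 2 ≤ m ∧ m ≤ n := fun m hm => Finset.mem_Icc.1 hm
  have e1 : sw k p (k + 1) = p k := sw_right k p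
  have e2 : ∀ m ∈ S, sw k p m = p m := fun m hm =>
    sw_of_ne p (by have := hmem m hm; omega) (by have := hmem m hm; omega)
  set Q : K → K := fun t => ∏ j ∈ Finset.range k, (e * t + y j) with hQ
  have r1 : ∀ q : GenPt K, runSum e y (k + 1) n γ q =
      γ (perm (Equiv.swap (k + 1) n) q) * ∏ l ∈ S, (Q (q l) * (e * q l + y k)) / (q (k + 1) - q l) +
      ∑ m ∈ S, γ (perm (Equiv.swap m n) q) *
        ((Q (q (k + 1)) * (e * q (k + 1) + y k)) / (q m - q (k + 1)) *
          ∏ l ∈ S.erase m, (Q (q l) * (e * q l + y k)) / (q m - q l)) := by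
    intro q
    simp only [runSum, i1, Finset.prod_range_succ]
    exact sum_insert_mul_prod_erase n1 _ fun m l => (Q (q l) * (e * q l + y k)) / (q m - q l)
  have r2 : runSum e y k n γ p =
      γ (perm (Equiv.swap k n) p) * (Q (p (k + 1)) / (p k - p (k + 1)) *
        ∏ l ∈ S, Q (p l) / (p k - p l)) +
      (γ (perm (Equiv.swap (k + 1) n) p) * (Q (p k) / (p (k + 1) - p k) *
        ∏ l ∈ S, Q (p l) / (p (k + 1) - p l)) +
      ∑ m ∈ S, γ (perm (Equiv.swap m n) p) * (Q (p k) / (p m - p k) * (Q (p (k + 1)) /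
        (p m - p (k + 1)) * ∏ l ∈ S.erase m, Q (p l) / (p m - p l)))) := by
    simp only [runSum, i2]
    rw [sum_insert_mul_prod_erase n2 _ fun m l => Q (p l) / (p m - p l), Finset.prod_insert n1,
      Finset.sum_insert n1, Finset.erase_insert n1]
    congr 2
    refine Finset.sum_congr rfl fun m hm => ?_
    have : m ≠ k + 1 := fun h => n1 (h ▸ hm)
    rw [Finset.erase_insert_of_ne this.symm, Finset.prod_insert (by simp [n1])]
  rw [r1, r1, r2, e1, swap_point_succ hγ hk]
  have hab : p k - p (k + 1) ≠ 0 := p.sub_ne (by omega)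
  have hba : p (k + 1) - p k ≠ 0 := p.sub_ne (by omega)
  have s1 : ∏ l ∈ S, Q (sw k p l) * (e * sw k p l + y k) / (p k - sw k p l) =
      ∏ l ∈ S, Q (p l) * (e * p l + y k) / (p k - p l) :=
    Finset.prod_congr rfl fun l hl => by rw [e2 l hl]
  have s2 : ∑ m ∈ S, γ (perm (Equiv.swap m n) (sw k p)) *
        ((Q (p k) * (e * p k + y k)) / (sw k p m - p k) *
          ∏ l ∈ S.erase m, (Q (sw k p l) * (e * sw k p l + y k)) / (sw k p m - sw k p l)) =
      ∑ m ∈ S, γ (perm (Equiv.swap m n) p) *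
        ((Q (p k) * (e * p k + y k)) / (p m - p k) *
          ∏ l ∈ S.erase m, (Q (p l) * (e * p l + y k)) / (p m - p l)) := by
    refine Finset.sum_congr rfl fun m hm => ?_
    rw [swap_point hγ hk p (hmem m hm).1 (hmem m hm).2, e2 m hm]
    congr 2
    exact Finset.prod_congr rfl fun l hl => by rw [e2 l (Finset.mem_erase.1 hl).2]
  rw [s1, s2]
  have t1 : ∀ c : K, ∏ l ∈ S, Q (p l) * (e * p l + y k) / (c - p l) =
      (∏ l ∈ S, (e * p l + y k)) * ∏ l ∈ S, Q (p l) / (c - p l) := fun c => by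
    rw [← Finset.prod_mul_distrib]
    exact Finset.prod_congr rfl fun l _ => by ring
  -- The terms `m ≥ k + 2` combine one by one. With `a = p k`, `b = p (k + 1)`, `c = p m`, `t = y
  -- k`, the identity behind this is `(e a + t)(c - b) - (e b + t)(c - a) = (a - b)(e c + t)`; it
  -- supplies the missing factor `e p_m + y_k`.
  have t3 : (Q (p (k + 1)) * ∑ m ∈ S, γ (perm (Equiv.swap m n) p) *
        ((Q (p k) * (e * p k + y k)) / (p m - p k) *
          ∏ l ∈ S.erase m, (Q (p l) * (e * p l + y k)) / (p m - p l)) -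
      Q (p k) * ∑ m ∈ S, γ (perm (Equiv.swap m n) p) *
        ((Q (p (k + 1)) * (e * p (k + 1) + y k)) / (p m - p (k + 1)) *
          ∏ l ∈ S.erase m, (Q (p l) * (e * p l + y k)) / (p m - p l))) / (p k - p (k + 1)) =
      (∏ a ∈ S, (e * p a + y k)) * ∑ m ∈ S, γ (perm (Equiv.swap m n) p) *
        (Q (p k) / (p m - p k) * (Q (p (k + 1)) / (p m - p (k + 1)) *
          ∏ l ∈ S.erase m, Q (p l) / (p m - p l))) := by
    simp only [Finset.mul_sum, ← Finset.sum_sub_distrib, Finset.sum_div]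
    refine Finset.sum_congr rfl fun m hm => ?_
    have hm' := hmem m hm
    have h1 : p m - p k ≠ 0 := p.sub_ne (by omega)
    have h2 : p m - p (k + 1) ≠ 0 := p.sub_ne (by omega)
    rw [← Finset.mul_prod_erase S _ hm]
    have t2 : ∏ l ∈ S.erase m, Q (p l) * (e * p l + y k) / (p m - p l) =
        (∏ l ∈ S.erase m, (e * p l + y k)) * ∏ l ∈ S.erase m, Q (p l) / (p m - p l) := by
      rw [← Finset.prod_mul_distrib]
      exact Finset.prod_congr rfl fun l _ => by ring
    rw [t2]
    field_simp
    ring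
  rw [t1, t1, mul_add (∏ a ∈ S, _), mul_add (∏ a ∈ S, _), ← t3, ← neg_sub (p k) (p (k + 1))]
  simp only [div_neg]
  ring

theorem lowerProd_sw (e : K) (y : ℕ → K) (k : ℕ) (p : GenPt K) :
    lowerProd e y k (sw k p) = lowerProd e y k p := by
  refine Finset.prod_congr rfl fun a ha => Finset.prod_congr rfl fun b _ => ?_
  have := Finset.mem_range.1 ha
  rw [sw_of_ne p (by omega) (by omega)]

theorem runFactor_sw (e : K) (y : ℕ → K) (k n : ℕ) (p : GenPt K) :
    runFactor e y (k + 1) n (sw k p) = runFactor e y (k + 1) n p := by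
  refine Finset.prod_congr rfl fun a ha => Finset.prod_congr rfl fun b _ => ?_
  have := Finset.mem_Icc.1 ha
  rw [sw_of_ne p (by omega) (by omega)]

/-- The case `k = 0` is the one needed: there the numerators in `runSum` are empty products, and a
plain sum of `γ / ∏ (p m - p l)` over the omitted coordinate `m` remains. -/
theorem opRun_lowerProd (e : K) (y : ℕ → K) {n : ℕ} {γ : GenPt K → K} (hγ : SymmOn n γ) (d : ℕ) :
    ∀ k, k + d = n → ∀ p, opRun k d (fun q => lowerProd e y n q * γ q) p =
      lowerProd e y k p * runFactor e y k n p * runSum e y k n γ p := by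
  induction d with
  | zero =>
    intro k hk p
    obtain rfl : k = n := by omega
    simp only [opRun, runFactor, runSum, Finset.Icc_self, Finset.sum_singleton, Equiv.swap_self]
    simp
    exact Or.inl rfl
  | succ d ih =>
    intro k hk p
    rw [opRun, opS, ih (k + 1) (by omega), ih (k + 1) (by omega), runFactor_sw]
    have h1 : ∀ q : GenPt K, lowerProd e y (k + 1) q =
        lowerProd e y k q * ∏ j ∈ Finset.range k, (e * q k + y j) := fun q => by
      rw [lowerProd, Finset.prod_range_succ, lowerProd]
    rw [runFactor_succ e y k, h1, h1, lowerProd_sw, sw_left]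
    linear_combination (lowerProd e y k p * runFactor e y (k + 1) n p) *
      runSum_step e y (k := k) (n := n) (by omega) hγ p

theorem opRun_const_mul (c : K) (d k : ℕ) (φ : GenPt K → K) :
    opRun k d (fun q => c * φ q) = fun q => c * opRun k d φ q := by
  induction d generalizing k with
  | zero => rfl
  | succ d ih =>
    funext p
    simp only [opRun, ih, opS]
    ring

theorem opRun_neg0 (d : ℕ) : ∀ k, 1 ≤ k → ∀ (φ : GenPt K → K) p,
    opRun k d φ (neg0 p) = opRun k d (fun q => φ (neg0 q)) p := by
  induction d with
  | zero => intro k _ φ p; rfl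
  | succ d ih =>
    intro k hk φ p
    rw [opRun, opS_comp_neg0 hk, opRun]
    congr 1
    funext q
    exact ih (k + 1) (by omega) φ q

theorem symmOn_signSum {n : ℕ} {s : ℤˣ} {F : GenPt K → K} (hF : SymmOn n F) :
    SymmOn n (signSum (Finset.range n) s F) := by
  intro a b ha hb p
  rw [signSum_perm]
  have : (Finset.range n).map (Equiv.swap a b).toEmbedding = Finset.range n := by
    ext i
    simp only [Finset.mem_map_equiv, Equiv.symm_swap, Finset.mem_range, Equiv.swap_apply_def]
    split_ifs <;> omega
  rw [this]
  exact signSum_congr fun N _ => hF a b ha hb _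

theorem map_swap_range {n m : ℕ} (hm : m ≤ n) :
    (Finset.range n).map (Equiv.swap m n).toEmbedding = (Finset.range (n + 1)).erase m := by
  ext i
  simp only [Finset.mem_map_equiv, Equiv.symm_swap, Finset.mem_range, Equiv.swap_apply_def,
    Finset.mem_erase]
  split_ifs <;> omega

theorem prod_range_perm {n a b : ℕ} (ha : a < n) (hb : b < n) (f : K → K) (p : GenPt K) :
    ∏ i ∈ Finset.range n, f (perm (Equiv.swap a b) p i) = ∏ i ∈ Finset.range n, f (p i) := by
  refine Finset.prod_equiv (Equiv.swap a b) (fun i => ?_) fun i _ => rfl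
  simp only [Finset.mem_range, Equiv.swap_apply_def]
  split_ifs <;> omega

theorem symmOn_pairProd (n : ℕ) : SymmOn n (pairProd (K := K) (Finset.range n)) := by
  intro a b ha hb p
  rw [pairProd_perm]
  congr 1
  ext i
  simp only [Finset.mem_map_equiv, Equiv.symm_swap, Finset.mem_range, Equiv.swap_apply_def]
  split_ifs <;> omega

theorem signSum_ratio_perm (e y : K) {n m : ℕ} (hm : m ≤ n) {φ : GenPt K → K}
    (hφ : SymmOn (n + 1) φ) (s : ℤˣ) (p : GenPt K) :
    signSum (Finset.range n) s (fun q => φ q * ratio e y (Finset.range n) q)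
        (perm (Equiv.swap m n) p) =
      signSum ((Finset.range (n + 1)).erase m) s
        (fun q => φ q * ratio e y ((Finset.range (n + 1)).erase m) q) p := by
  rw [signSum_perm, map_swap_range hm]
  refine signSum_congr fun N _ => ?_
  rw [hφ m n (by omega) (by omega), ratio, pairProd_perm, map_swap_range hm, ratio,
    ← map_swap_range hm, Finset.prod_map]
  rfl

theorem pairProd_of_card_lt {S : Finset ℕ} (h : S.card < 2) (p : GenPt K) : pairProd S p = 1 := by
  rw [pairProd, Finset.powersetCard_eq_empty.2 h, Finset.prod_empty]

theorem lowerProd_succ (e : K) (y : ℕ → K) (n : ℕ) (p : GenPt K) :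
    lowerProd e y (n + 1) p = runFactor e (fun j => y (j + 1)) 0 n p *
      ∏ k ∈ (Finset.range (n + 1)).erase 0, (e * p k + y 0) := by
  have h1 : runFactor e (fun j => y (j + 1)) 0 n p =
      ∏ a ∈ (Finset.range (n + 1)).erase 0, ∏ b ∈ Finset.range (a - 1), (e * p a + y (b + 1)) := by
    simp only [runFactor, Nat.Ico_zero_eq_range]
    refine Finset.prod_subset (fun a ha => ?_) fun a ha ha' => ?_
    · simp only [Finset.mem_Icc, Finset.mem_erase, Finset.mem_range] at ha ⊢
      omega
    · simp only [Finset.mem_Icc, Finset.mem_erase, Finset.mem_range] at ha ha'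
      rw [show a - 1 = 0 by omega, Finset.range_zero, Finset.prod_empty]
  rw [h1, ← Finset.prod_mul_distrib, lowerProd, ← Finset.mul_prod_erase _ _
    (Finset.mem_range.2 (Nat.succ_pos n)), Finset.range_zero, Finset.prod_empty, one_mul]
  refine Finset.prod_congr rfl fun a ha => ?_
  have ha := (Finset.mem_erase.1 ha).1
  obtain ⟨a, rfl⟩ := Nat.exists_eq_succ_of_ne_zero ha
  rw [Nat.succ_eq_add_one, Finset.prod_range_succ', Nat.add_sub_cancel]

/-- The parameter `e` serves two purposes: `e = 1` gives the product `Δ`, while `e = 0` with `y =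
-1` makes `upperProd` trivial and identifies `theta` with `psi`. The step applies `opRun_lowerProd`
to both summands of `theta` and joins the results by `signSum_ratio_insert`. -/
theorem theta_upperProd (e : K) (n : ℕ) : ∀ (y : ℕ → K) {φ : GenPt K → K}, SymmOn n φ → ∀ p,
    theta n (fun q => upperProd e y n q * φ q) p =
      (-1) ^ (∑ i ∈ Finset.range n, i) * lowerProd e y n p * psi n φ p := by
  induction n with
  | zero =>
    intro y φ _ p
    simp [theta, upperProd, lowerProd, psi, signSum, Finset.filter_singleton,
      pairProd_of_card_lt (S := ∅) (by simp)]
  | succ n ih =>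
    intro y φ hφ p
    rcases n with _ | n
    · have h1 : Finset.range 1 = insert 0 ∅ := rfl
      simp only [theta, zero_add, upperProd, lowerProd, psi, h1,
        signSum_insert (Finset.notMem_empty 0)]
      simp [signSum, pairProd_of_card_lt, Finset.filter_singleton]
    · have hsym : SymmOn (n + 1) fun q => φ q * ratio e (y 0) (Finset.range (n + 1)) q := by
        intro a b ha hb q
        simp only [ratio]
        rw [hφ a b (by omega) (by omega), symmOn_pairProd _ a b ha hb,
          prod_range_perm ha hb fun t => e * t - y 0]
      have hpsi : ∀ q, theta (n + 1) (fun q => upperProd e y (n + 2) q * φ q) q =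
          (-1) ^ (∑ i ∈ Finset.range (n + 1), i) * (lowerProd e (fun j => y (j + 1)) (n + 1) q *
            signSum (Finset.range (n + 1)) 1
              (fun q => φ q * ratio e (y 0) (Finset.range (n + 1)) q) q) := by
        intro q
        -- The induction hypothesis is applied to `φ` times the symmetric product that contains `y
        -- 0`; dividing this product by `pairProd` gives `ratio`.
        have := ih (fun j => y (j + 1))
          (φ := fun q => φ q * ∏ i ∈ Finset.range (n + 1), (e * q i - y 0)) (fun a b ha hb q => by
            dsimp only
            rw [hφ a b (by omega) (by omega), prod_range_perm ha hb fun t => e * t - y 0]) q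
        simp only [upperProd_succ e y (n + 1)]
        rw [psi] at this
        simp only [ratio, ← mul_div_assoc]
        rw [← mul_assoc, ← this]
        congr 1
        funext r
        ring
      set y' : ℕ → K := fun j => y (j + 1)
      set γ := signSum (Finset.range (n + 1)) 1
        fun q => φ q * ratio e (y 0) (Finset.range (n + 1)) q with hγdef
      set γ' := signSum (Finset.range (n + 1)) (-1)
        fun q => φ q * ratio e (y 0) (Finset.range (n + 1)) q with hγ'def
      set c : K := (-1) ^ (∑ i ∈ Finset.range (n + 1), i) with hc
      have hγ : SymmOn (n + 1) γ := symmOn_signSum hsym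
      have hγ' : SymmOn (n + 1) γ' := symmOn_signSum hsym
      have hfun : theta (n + 1) (fun q => upperProd e y (n + 2) q * φ q) =
          fun q => c * (lowerProd e y' (n + 1) q * γ q) := _root_.funext hpsi
      -- Coordinate `0` does not occur in `lowerProd`, and in `γ` its sign change turns even sign
      -- sums into odd ones.
      have hneg : (fun q : GenPt K => c * (lowerProd e y' (n + 1) (neg0 q) * γ (neg0 q))) =
          fun q => c * (lowerProd e y' (n + 1) q * γ' q) := by
        funext q
        rw [hγdef, signSum_flip (by simp), ← hγ'def]
        congr 2
        refine Finset.prod_congr rfl fun a _ => Finset.prod_congr rfl fun b hb => ?_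
        have : a ≠ 0 := by have := Finset.mem_range.1 hb; omega
        simp [this]
      have hS : Finset.Icc 0 (n + 1) = Finset.range (n + 2) := by
        ext i; simp; omega
      have hrun : ∀ (s : ℤˣ) (q : GenPt K), runSum e y' 0 (n + 1) (signSum (Finset.range (n + 1)) s
          fun q => φ q * ratio e (y 0) (Finset.range (n + 1)) q) q =
          ∑ m ∈ Finset.range (n + 2), signSum ((Finset.range (n + 2)).erase m) s
            (fun q => φ q * ratio e (y 0) ((Finset.range (n + 2)).erase m) q) q *
            ∏ l ∈ (Finset.range (n + 2)).erase m, 1 / (q m - q l) := by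
        intro s q
        rw [runSum, hS]
        refine Finset.sum_congr rfl fun m hm => ?_
        rw [signSum_ratio_perm e (y 0) (by have := Finset.mem_range.1 hm; omega) hφ]
        simp
      have hfac : runFactor e y' 0 (n + 1) (neg0 p) = runFactor e y' 0 (n + 1) p := by
        refine Finset.prod_congr rfl fun a ha => Finset.prod_congr rfl fun b _ => ?_
        have : a ≠ 0 := by have := Finset.mem_Icc.1 ha; omega
        simp [this]
      have hins : Finset.range (n + 2) = insert 0 ((Finset.range (n + 2)).erase 0) :=
        (Finset.insert_erase (by simp)).symm
      have hmain := signSum_ratio_insert e (y 0) φ p (T := (Finset.range (n + 2)).erase 0) (o := 0)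
        (by simp)
      rw [← hins, ← hrun, ← hrun, Finset.card_erase_of_mem (by simp), Finset.card_range] at hmain
      have hA := opRun_lowerProd e y' hγ (n + 1) 0 (by omega) p
      have hB := opRun_lowerProd e y' hγ' (n + 1) 0 (by omega) (neg0 p)
      have h1 : opS 0 (opRun 1 n fun q => c * (lowerProd e y' (n + 1) q * γ q)) p =
          c * opRun 0 (n + 1) (fun q => lowerProd e y' (n + 1) q * γ q) p :=
        congrFun (opRun_const_mul c (n + 1) 0 _) p
      -- Conjugation by `neg0` turns `opBox` into `opS 0` and commutes with the rest of the run, so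
      -- this half is again a run of type `A`, evaluated at `neg0 p`.
      have h2 : opBox (opRun 1 n fun q => c * (lowerProd e y' (n + 1) q * γ q)) p =
          c * opRun 0 (n + 1) (fun q => lowerProd e y' (n + 1) q * γ' q) (neg0 p) := by
        rw [opBox_apply, _root_.funext fun q => opRun_neg0 n 1 le_rfl _ q, hneg]
        exact congrFun (opRun_const_mul c (n + 1) 0 _) (neg0 p)
      rw [theta, hfun, Pi.add_apply, h1, h2, hA, hB, hfac, lowerProd_succ e y (n + 1),
        Finset.sum_range_succ _ (n + 1), pow_add, ← hc, psi]
      simp only [lowerProd, Finset.range_zero, Finset.prod_empty, one_mul]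
      rw [show n + 2 - 1 = n + 1 from rfl] at hmain
      linear_combination (c * runFactor e y' 0 (n + 1) p) * hmain

end Recursion

/-! ### Length in type `D` as half the number of inverted pairs of signed indices. -/

section Lengths

variable {n : ℕ}

/-- The entries of a barred permutation as signed integers, continued by zeros. -/
def sval (w : SignedPerm n) (j : ℕ) : ℤ :=
  if h : j < n then ((entry w ⟨j, h⟩).1 : ℤ) * ((entry w ⟨j, h⟩).2 + 1) else 0

/-- The condition `ℓ(w s_g) < ℓ(w)`. -/
def IsDescent (w : SignedPerm n) : GenD n → Prop
  | .s i => sval w (i + 1) < sval w i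
  | .box _ => sval w 0 + sval w 1 < 0

theorem sval_mul_s (w : SignedPerm n) (i : Fin (n - 1)) (j : ℕ) :
    sval (w * simpleD n (.s i)) j = sval w (Equiv.swap (i : ℕ) (i + 1) j) := by
  have hlt := i.2
  by_cases h : j < n
  · have h1 : Equiv.swap (i : ℕ) (i + 1) j = (simpleA n i ⟨j, h⟩ : ℕ) := by
      simp only [simpleA, Equiv.swap_apply_def, lo, hi, Fin.ext_iff]
      split_ifs <;> rfl
    have h2 : Equiv.swap (i : ℕ) (i + 1) j < n := by rw [h1]; exact Fin.is_lt _
    rw [sval, dif_pos h, sval, dif_pos h2, entry_mul]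
    have h3 : (⟨Equiv.swap (i : ℕ) (i + 1) j, h2⟩ : Fin n) = simpleA n i ⟨j, h⟩ := Fin.ext h1
    rw [h3]
    simp [simpleD, entry]
  · rw [Equiv.swap_apply_of_ne_of_ne (by omega) (by omega), sval, dif_neg h, sval, dif_neg h]

theorem sval_mul_box (w : SignedPerm n) (h2 : 2 ≤ n) (j : ℕ) :
    sval (w * simpleD n (.box h2)) j =
      if j = 0 then -sval w 1 else if j = 1 then -sval w 0 else sval w j := by
  by_cases h : j < n
  · simp only [sval, h, dif_pos, show 0 < n by omega, show 1 < n by omega]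
    rw [simpleD, entry_mul_reflBox]
    simp only
    split_ifs <;> simp
  · rw [if_neg (by omega), if_neg (by omega), sval, dif_neg h, sval, dif_neg h]

theorem natAbs_sval (w : SignedPerm n) (j : Fin n) : (sval w j).natAbs = w.right j + 1 := by
  rw [sval, dif_pos j.2, Int.natAbs_mul]
  simp only [Int.units_natAbs, one_mul, entry, Fin.eta]
  omega

theorem sval_of_lt (w : SignedPerm n) (j : Fin n) :
    sval w j = (w.left (w.right j) : ℤ) * (w.right j + 1) := by
  rw [sval, dif_pos j.2]; rfl

theorem sval_abs_ne (w : SignedPerm n) {i j : ℕ} (hi : i < n) (hj : j < n) (h : i ≠ j) :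
    sval w i ≠ sval w j ∧ sval w i + sval w j ≠ 0 := by
  have h1 := natAbs_sval w ⟨i, hi⟩
  have h2 := natAbs_sval w ⟨j, hj⟩
  have h3 : w.right ⟨i, hi⟩ ≠ w.right ⟨j, hj⟩ := w.right.injective.ne (by simpa using h)
  have h4 : (w.right ⟨i, hi⟩ : ℕ) ≠ w.right ⟨j, hj⟩ := fun h => h3 (Fin.ext h)
  simp only at h1 h2
  omega

theorem sval_ext {u v : SignedPerm n} (h : ∀ j, sval u j = sval v j) : u = v := by
  apply entry_ext
  intro i
  have h1 := natAbs_sval u i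
  have h2 := natAbs_sval v i
  have h3 := h i
  have h4 : u.right i = v.right i := Fin.ext (by rw [h3] at h1; omega)
  rw [sval_of_lt, sval_of_lt, ← h4] at h3
  have h5 := Units.ext (mul_right_cancel₀ (by omega) h3)
  rw [entry, entry, h4] at *
  simpa using h5

theorem sval_one {j : ℕ} (hj : j < n) : sval (1 : SignedPerm n) j = j + 1 := by
  rw [sval, dif_pos hj]; simp [entry]

theorem mul_simpleD_cancel (w : SignedPerm n) (g : GenD n) :
    w * simpleD n g * simpleD n g = w := by rw [mul_assoc, simpleD_mul_self, mul_one]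

theorem isDescent_mul_self (w : SignedPerm n) (g : GenD n) :
    IsDescent (w * simpleD n g) g ↔ ¬ IsDescent w g := by
  cases g with
  | s i =>
    have := (sval_abs_ne w (i := i) (j := i + 1) (by omega) (by omega) (by omega)).1
    simp only [IsDescent, sval_mul_s, Equiv.swap_apply_left, Equiv.swap_apply_right]
    omega
  | box h =>
    have := (sval_abs_ne w (i := 0) (j := 1) (by omega) (by omega) (by omega)).2
    simp only [IsDescent, sval_mul_box]
    simp
    omega

/-- The signed value of `w` at a signed index. -/
def signedVal (w : SignedPerm n) (u : ℤˣ × Fin n) : ℤ := u.1 * sval w u.2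

/-- The action of a simple reflection on signed indices. -/
def reflIndex : GenD n → ℤˣ × Fin n → ℤˣ × Fin n
  | .s i, u => (u.1, simpleA n i u.2)
  | .box h, u => if (u.2 : ℕ) = 0 then (-u.1, ⟨1, by omega⟩)
      else if (u.2 : ℕ) = 1 then (-u.1, ⟨0, by omega⟩) else u

/-- The two pairs of signed indices whose order is reversed by a simple reflection. -/
def reflPair : GenD n → Bool → (ℤˣ × Fin n) × (ℤˣ × Fin n)
  | .s i, true => ((1, lo i), (1, hi i))
  | .s i, false => ((-1, hi i), (-1, lo i))
  | .box h, true => ((-1, ⟨0, by omega⟩), (1, ⟨1, by omega⟩))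
  | .box h, false => ((-1, ⟨1, by omega⟩), (1, ⟨0, by omega⟩))

theorem reflIndex_reflIndex (g : GenD n) (u : ℤˣ × Fin n) : reflIndex g (reflIndex g u) = u := by
  obtain ⟨ε, j, hj⟩ := u
  cases g with
  | s i => simp [reflIndex, simpleA]
  | box h =>
    simp only [reflIndex]
    rcases j with _ | _ | j <;> simp

theorem signedVal_mul (w : SignedPerm n) (g : GenD n) (u : ℤˣ × Fin n) :
    signedVal (w * simpleD n g) u = signedVal w (reflIndex g u) := by
  obtain ⟨ε, j, hj⟩ := u
  cases g with
  | s i =>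
    simp only [signedVal, sval_mul_s, reflIndex]
    congr 2
    simp only [simpleA, Equiv.swap_apply_def, lo, hi, Fin.ext_iff]
    split_ifs <;> rfl
  | box h =>
    simp only [signedVal, sval_mul_box, reflIndex]
    rcases j with _ | _ | j <;> simp

theorem reflIndex_snd_ne (g : GenD n) {u v : ℤˣ × Fin n} (h : u.2 ≠ v.2) :
    (reflIndex g u).2 ≠ (reflIndex g v).2 := by
  obtain ⟨ε, j, hj⟩ := u
  obtain ⟨δ, k, hk⟩ := v
  cases g with
  | s i => simpa [reflIndex] using h
  | box h =>
    simp only [reflIndex, Fin.ext_iff, ne_eq] at h ⊢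
    split_ifs <;> simp at * <;> omega

/-- A simple reflection permutes the positive roots other than its own. -/
theorem reflIndex_lt (g : GenD n) {u v : ℤˣ × Fin n} (h : u.2 ≠ v.2)
    (h1 : signedVal 1 u < signedVal 1 v) (h2 : ∀ b, (u, v) ≠ reflPair g b) :
    signedVal 1 (reflIndex g u) < signedVal 1 (reflIndex g v) := by
  have h2t := h2 true
  have h2f := h2 false
  clear h2
  obtain ⟨ε, j, hj⟩ := u
  obtain ⟨δ, k, hk⟩ := v
  have sv : ∀ (ε : ℤˣ) (j : Fin n), signedVal 1 (ε, j) = ε * ((j : ℕ) + 1) := fun ε j => by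
    rw [signedVal, sval_one j.2]
  cases g with
  | s i =>
    simp only [reflIndex, simpleA, Equiv.swap_apply_def, lo, hi, Fin.ext_iff, reflPair,
      Prod.mk.injEq, ne_eq, sv] at *
    rcases Int.units_eq_one_or ε with rfl | rfl <;> rcases Int.units_eq_one_or δ with rfl | rfl <;>
      simp at * <;> split_ifs <;> simp <;> omega
  | box h0 =>
    simp only [reflIndex, Fin.ext_iff, reflPair, Prod.mk.injEq, ne_eq, sv] at *
    rcases Int.units_eq_one_or ε with rfl | rfl <;> rcases Int.units_eq_one_or δ with rfl | rfl <;>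
      simp at * <;> split_ifs <;> simp <;> omega

theorem isDescent_iff (w : SignedPerm n) (g : GenD n) (b : Bool) :
    IsDescent w g ↔ signedVal w (reflPair g b).2 < signedVal w (reflPair g b).1 := by
  cases g <;> cases b <;> simp [IsDescent, reflPair, signedVal, lo, hi] <;> omega

theorem reflIndex_reflPair (g : GenD n) (b : Bool) :
    reflIndex g (reflPair g b).1 = (reflPair g b).2 ∧
      reflIndex g (reflPair g b).2 = (reflPair g b).1 := by
  cases g <;> cases b <;> simp [reflPair, reflIndex, simpleA, lo, hi]

theorem reflPair_lt (g : GenD n) (b : Bool) :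
    (reflPair g b).1.2 ≠ (reflPair g b).2.2 ∧
      signedVal 1 (reflPair g b).1 < signedVal 1 (reflPair g b).2 := by
  cases g with
  | s i =>
    have := sval_one (n := n) (j := i) (by omega)
    have := sval_one (n := n) (j := i + 1) (by omega)
    cases b <;> simp [reflPair, signedVal, lo, hi] <;> omega
  | box h =>
    have := sval_one (n := n) (j := 0) (by omega)
    have := sval_one (n := n) (j := 1) (by omega)
    cases b <;> simp [reflPair, signedVal] <;> omega

theorem reflPair_ne (g : GenD n) : reflPair g true ≠ reflPair g false := by
  cases g <;> simp [reflPair]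

open Classical in
/-- The pairs of signed indices with distinct absolute values that are inverted by `w`. -/
def inversions (w : SignedPerm n) : Finset ((ℤˣ × Fin n) × (ℤˣ × Fin n)) :=
  Finset.univ.filter fun b =>
    b.1.2 ≠ b.2.2 ∧ signedVal 1 b.1 < signedVal 1 b.2 ∧ signedVal w b.2 < signedVal w b.1

theorem mem_inversions {w : SignedPerm n} {b : (ℤˣ × Fin n) × (ℤˣ × Fin n)} :
    b ∈ inversions w ↔
      b.1.2 ≠ b.2.2 ∧ signedVal 1 b.1 < signedVal 1 b.2 ∧ signedVal w b.2 < signedVal w b.1 := by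
  simp [inversions]

/-- A root of type `D` corresponds to two pairs, `(u, v)` and `(-v, -u)`, hence the increment `2`.
The simple reflection matches the old inversions with the new ones, and only the two pairs of its
own root are added. -/
theorem card_inversions_mul {w : SignedPerm n} {g : GenD n} (h : ¬ IsDescent w g) :
    (inversions (w * simpleD n g)).card = (inversions w).card + 2 := by
  classical
  let f : (ℤˣ × Fin n) × (ℤˣ × Fin n) → (ℤˣ × Fin n) × (ℤˣ × Fin n) :=
    fun b => (reflIndex g b.1, reflIndex g b.2)
  have hff : ∀ b, f (f b) = b := fun b => by simp [f, reflIndex_reflIndex]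
  have hinj : Function.Injective f := Function.LeftInverse.injective hff
  have hw : ∀ b, reflPair g b ∉ inversions w := fun b hb =>
    h ((isDescent_iff w g b).2 (mem_inversions.1 hb).2.2)
  have hw' : ∀ b, reflPair g b ∈ inversions (w * simpleD n g) := fun b =>
    mem_inversions.2 ⟨(reflPair_lt g b).1, (reflPair_lt g b).2,
      (isDescent_iff _ g b).1 ((isDescent_mul_self w g).2 h)⟩
  have hni : ∀ b, reflPair g b ∉ (inversions w).image f := by
    intro b hb
    obtain ⟨c, hc, hcb⟩ := Finset.mem_image.1 hb
    have h1 : c = ((reflPair g b).2, (reflPair g b).1) := by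
      rw [← hff c, hcb]
      simp [f, reflIndex_reflPair]
    have h2 := (mem_inversions.1 hc).2.1
    rw [h1] at h2
    exact lt_asymm h2 (reflPair_lt g b).2
  have hset : inversions (w * simpleD n g) =
      insert (reflPair g true) (insert (reflPair g false) ((inversions w).image f)) := by
    ext b
    constructor
    · intro hb
      by_cases hs : ∃ c, b = reflPair g c
      · obtain ⟨c, rfl⟩ := hs
        cases c <;> simp
      · push Not at hs
        have hb' := mem_inversions.1 hb
        refine Finset.mem_insert_of_mem (Finset.mem_insert_of_mem (Finset.mem_image.2
          ⟨f b, mem_inversions.2 ⟨reflIndex_snd_ne g hb'.1, reflIndex_lt g hb'.1 hb'.2.1 hs, ?_⟩,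
            hff b⟩))
        simpa only [f, signedVal_mul] using hb'.2.2
    · intro hb
      rcases Finset.mem_insert.1 hb with rfl | hb
      · exact hw' _
      rcases Finset.mem_insert.1 hb with rfl | hb
      · exact hw' _
      obtain ⟨c, hc, rfl⟩ := Finset.mem_image.1 hb
      have hc' := mem_inversions.1 hc
      refine mem_inversions.2 ⟨reflIndex_snd_ne g hc'.1, reflIndex_lt g hc'.1 hc'.2.1
        fun b hb => hw b (hb ▸ hc), ?_⟩
      simpa only [f, signedVal_mul, reflIndex_reflIndex] using hc'.2.2
  rw [hset, Finset.card_insert_of_notMem, Finset.card_insert_of_notMem (hni _),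
    Finset.card_image_of_injective _ hinj]
  rw [Finset.mem_insert, not_or]
  exact ⟨reflPair_ne g, hni _⟩

theorem card_inversions_of_isDescent {w : SignedPerm n} {g : GenD n} (h : IsDescent w g) :
    (inversions w).card = (inversions (w * simpleD n g)).card + 2 := by
  have := card_inversions_mul (w := w * simpleD n g) (g := g) fun h' =>
    (isDescent_mul_self w g).1 h' h
  rwa [mul_simpleD_cancel] at this

theorem card_inversions_prod_le (l : List (GenD n)) :
    (inversions (l.map (simpleD n)).prod).card ≤ 2 * l.length := by
  induction l using List.reverseRecOn with
  | nil =>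
    have : inversions (1 : SignedPerm n) = ∅ := by
      ext b
      simp only [mem_inversions, Finset.notMem_empty, iff_false]
      exact fun h => lt_asymm h.2.1 h.2.2
    simp [this]
  | append_singleton l g ih =>
    rw [List.map_append, List.prod_append, List.length_append]
    simp only [List.map_cons, List.map_nil, List.prod_singleton, List.length_singleton]
    by_cases h : IsDescent (l.map (simpleD n)).prod g
    · have := card_inversions_of_isDescent h
      omega
    · rw [card_inversions_mul h]
      omega

/-- Without descents, `|w(1)| < w(2) < w(3) < ⋯`, so the absolute values are in order and only the
first entry could be barred; the parity of the number of bars excludes this. -/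
theorem eq_one_of_no_descent {w : SignedPerm n} (hw : w ∈ WeylD n) (h : ∀ g, ¬ IsDescent w g) :
    w = 1 := by
  have hs : ∀ i, i + 1 < n → sval w i < sval w (i + 1) := fun i hi => by
    have h1 := h (.s ⟨i, by omega⟩)
    have h2 := (sval_abs_ne w (i := i) (j := i + 1) (by omega) (by omega) (by omega)).1
    simp only [IsDescent] at h1
    omega
  have hpos : ∀ i, 1 ≤ i → i < n → 0 < sval w i ∧ |sval w 0| < sval w i := by
    intro i hi
    induction i, hi using Nat.le_induction with
    | base =>
      intro hn
      have h1 := h (.box (by omega))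
      have h2 := (sval_abs_ne w (i := 0) (j := 1) (by omega) (by omega) (by omega)).2
      have h3 := hs 0 (by omega)
      simp only [IsDescent, zero_add] at h1 h3
      rw [abs_lt]
      omega
    | succ i hi ih =>
      intro hn
      have h1 := ih (by omega)
      have h2 := hs i hn
      exact ⟨by omega, by omega⟩
  have hright : w.right = 1 := by
    have hmono : StrictMono w.right := by
      rcases n with _ | n
      · exact fun i => i.elim0
      · refine Fin.strictMono_iff_lt_succ.2 fun i => ?_
        have h1 := natAbs_sval w i.castSucc
        have h2 := natAbs_sval w i.succ
        have h3 := hpos (i + 1) (by omega) (by omega)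
        have h4 := hs i (by omega)
        simp only [Fin.val_castSucc, Fin.val_succ] at h1 h2
        rw [Fin.lt_def]
        rcases Nat.eq_zero_or_pos i with h0 | h0
        · have h5 : sval w (i : ℕ) = sval w 0 := by rw [h0]
          have := abs_lt.1 h3.2
          omega
        · have := hpos i h0 (by omega)
          omega
    let o : Fin n ≃o Fin n := hmono.orderIsoOfSurjective _ w.right.surjective
    have : o = OrderIso.refl _ := Subsingleton.elim _ _
    ext i
    exact congrArg Fin.val (DFunLike.congr_fun this i)
  have hleft : ∀ i : Fin n, 1 ≤ (i : ℕ) → w.left i = 1 := by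
    intro i hi
    have h1 := (hpos i hi i.2).1
    rw [sval_of_lt, hright] at h1
    rcases Int.units_eq_one_or (w.left i) with h2 | h2
    · exact h2
    · simp only [Equiv.Perm.one_apply, h2] at h1
      simp at h1
      omega
  refine SemidirectProduct.ext (funext fun i => ?_) hright
  rcases Nat.eq_zero_or_pos i with h0 | h0
  · rw [mem_weylD_iff, Finset.prod_eq_single i] at hw
    · exact hw
    · exact fun j _ hj => hleft j (by
        have : (j : ℕ) ≠ i := fun h => hj (Fin.ext h)
        omega)
    · simp
  · exact hleft i h0

theorem simpleD_mem (g : GenD n) : simpleD n g ∈ WeylD n := Subgroup.subset_closure ⟨g, rfl⟩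

theorem exists_word_card (m : ℕ) : ∀ w ∈ WeylD n, (inversions w).card ≤ m →
    ∃ l : List (GenD n), (l.map (simpleD n)).prod = w ∧ 2 * l.length = (inversions w).card := by
  induction m using Nat.strong_induction_on with
  | _ m ih =>
    intro w hw hm
    by_cases h : ∃ g, IsDescent w g
    · obtain ⟨g, hg⟩ := h
      have h1 := card_inversions_of_isDescent hg
      obtain ⟨l, hl, hl'⟩ := ih (m - 2) (by omega) _ (mul_mem hw (simpleD_mem g)) (by omega)
      refine ⟨l ++ [g], ?_, ?_⟩
      · rw [List.map_append, List.prod_append, hl]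
        simp [mul_simpleD_cancel]
      · rw [List.length_append, List.length_singleton]
        omega
    · push Not at h
      obtain rfl := eq_one_of_no_descent hw h
      refine ⟨[], rfl, ?_⟩
      have := card_inversions_prod_le (n := n) []
      simp at this
      simp [this]

theorem isReducedWord_iff {w : SignedPerm n} {l : List (GenD n)} :
    IsReducedWord (simpleD n) w l ↔
      (l.map (simpleD n)).prod = w ∧ 2 * l.length = (inversions w).card := by
  refine and_congr_right fun h => ⟨fun h' => ?_, fun h' l' hl' => ?_⟩
  · have hw : w ∈ WeylD n := by
      rw [← h]
      exact Subgroup.list_prod_mem _ fun x hx => by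
        obtain ⟨g, _, rfl⟩ := List.mem_map.1 hx
        exact simpleD_mem g
    obtain ⟨l', hl', hc⟩ := exists_word_card _ w hw le_rfl
    have h1 := h' l' hl'
    have h2 := card_inversions_prod_le l
    rw [h] at h2
    omega
  · have := card_inversions_prod_le l'
    rw [hl'] at this
    omega

end Lengths

/-! ### Independence of `∂'_w` from the reduced word. -/

section Words

variable {n : ℕ} {K : Type*} [Field K]

/-- The operators `∂'_i` and `∂'_□` on functions of generic points. -/
def opD : GenD n → (GenPt K → K) → GenPt K → K
  | .s i => opS i
  | .box _ => opBox

/-- Two commuting generators. -/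
def CommRel (K : Type*) [Field K] (a b : GenD n) : Prop :=
  (∀ w, w * simpleD n a * simpleD n b = w * simpleD n b * simpleD n a) ∧
    (∀ φ : GenPt K → K, opD a (opD b φ) = opD b (opD a φ)) ∧
    ∀ w, IsDescent w a → IsDescent w b → IsDescent (w * simpleD n a) b

/-- Two generators that satisfy a braid relation. -/
def BraidRel (K : Type*) [Field K] (a b : GenD n) : Prop :=
  (∀ w, w * simpleD n a * simpleD n b * simpleD n a =
      w * simpleD n b * simpleD n a * simpleD n b) ∧
    (∀ φ : GenPt K → K, opD a (opD b (opD a φ)) = opD b (opD a (opD b φ))) ∧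
    ∀ w, IsDescent w a → IsDescent w b →
      IsDescent (w * simpleD n a) b ∧ IsDescent (w * simpleD n a * simpleD n b) a

theorem commRel_s {i j : Fin (n - 1)} (h : (i : ℕ) + 2 ≤ j ∨ (j : ℕ) + 2 ≤ i) :
    CommRel K (GenD.s i) (GenD.s j) := by
  refine ⟨fun w => sval_ext fun k => ?_, fun φ => ?_, fun w h1 h2 => ?_⟩
  · simp only [sval_mul_s]
    congr 1
    simp only [Equiv.swap_apply_def]
    grind
  · rcases h with h | h
    · exact opS_comm h φ
    · exact (opS_comm h φ).symm
  · simp only [IsDescent, sval_mul_s] at *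
    rwa [Equiv.swap_apply_of_ne_of_ne (by omega) (by omega),
      Equiv.swap_apply_of_ne_of_ne (by omega) (by omega)]

theorem braidRel_s {i j : Fin (n - 1)} (h : (i : ℕ) + 1 = j ∨ (j : ℕ) + 1 = i) :
    BraidRel K (GenD.s i) (GenD.s j) := by
  refine ⟨fun w => sval_ext fun k => ?_, fun φ => ?_, fun w h1 h2 => ?_⟩
  · simp only [sval_mul_s]
    congr 1
    simp only [Equiv.swap_apply_def]
    grind
  · simp only [opD]
    rcases h with h | h
    · rw [← h]
      exact opS_braid i φ
    · rw [← h]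
      exact (opS_braid j φ).symm
  · simp only [IsDescent, sval_mul_s, Equiv.swap_apply_def] at *
    grind

theorem commRel_box_s {h0 : 2 ≤ n} {j : Fin (n - 1)} (h : (j : ℕ) ≠ 1) :
    CommRel K (GenD.box h0) (GenD.s j) ∧ CommRel K (GenD.s j) (GenD.box h0) := by
  have hg : ∀ w, w * simpleD n (GenD.box h0) * simpleD n (GenD.s j) =
      w * simpleD n (GenD.s j) * simpleD n (GenD.box h0) := by
    refine fun w => sval_ext fun k => ?_
    simp only [sval_mul_s, sval_mul_box, Equiv.swap_apply_def]
    grind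
  refine ⟨⟨hg, fun φ => opBox_comm_opS h φ, fun w h1 h2 => ?_⟩,
    fun w => (hg w).symm, fun φ => (opBox_comm_opS h φ).symm, fun w h1 h2 => ?_⟩
  · simp only [IsDescent, sval_mul_box] at *
    grind
  · simp only [IsDescent, sval_mul_s, Equiv.swap_apply_def] at *
    grind

theorem braidRel_box_s {h0 : 2 ≤ n} {j : Fin (n - 1)} (h : (j : ℕ) = 1) :
    BraidRel K (GenD.box h0) (GenD.s j) ∧ BraidRel K (GenD.s j) (GenD.box h0) := by
  have hg : ∀ w, w * simpleD n (GenD.box h0) * simpleD n (GenD.s j) * simpleD n (GenD.box h0) =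
      w * simpleD n (GenD.s j) * simpleD n (GenD.box h0) * simpleD n (GenD.s j) := by
    refine fun w => sval_ext fun k => ?_
    simp only [sval_mul_s, sval_mul_box, Equiv.swap_apply_def]
    grind
  refine ⟨⟨hg, fun φ => ?_, fun w h1 h2 => ?_⟩,
    fun w => (hg w).symm, fun φ => ?_, fun w h1 h2 => ?_⟩
  · simp only [opD, h]
    exact opBox_braid φ
  · simp only [IsDescent, sval_mul_s, sval_mul_box, Equiv.swap_apply_def] at *
    grind
  · simp only [opD, h]
    exact (opBox_braid φ).symm
  · simp only [IsDescent, sval_mul_s, sval_mul_box, Equiv.swap_apply_def] at *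
    grind

/-- In the Dynkin diagram of type `D` the extra node is joined only to the transposition with index
`1`, and all bonds are simple. -/
theorem commRel_or_braidRel {a b : GenD n} (h : a ≠ b) : CommRel K a b ∨ BraidRel K a b := by
  cases a with
  | s i =>
    cases b with
    | s j =>
      have hij : (i : ℕ) ≠ j := fun h' => h (by rw [Fin.ext h'])
      by_cases h1 : (i : ℕ) + 1 = j ∨ (j : ℕ) + 1 = i
      · exact Or.inr (braidRel_s h1)
      · exact Or.inl (commRel_s (by omega))
    | box h0 =>
      by_cases h1 : (i : ℕ) = 1
      · exact Or.inr (braidRel_box_s h1).2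
      · exact Or.inl (commRel_box_s h1).2
  | box h0 =>
    cases b with
    | s j =>
      by_cases h1 : (j : ℕ) = 1
      · exact Or.inr (braidRel_box_s h1).1
      · exact Or.inl (commRel_box_s h1).1
    | box h1 => exact absurd rfl h

theorem prod_append_singleton (l : List (GenD n)) (a : GenD n) :
    ((l ++ [a]).map (simpleD n)).prod = (l.map (simpleD n)).prod * simpleD n a := by
  rw [List.map_append, List.prod_append]; simp

theorem prod_mem_weylD (l : List (GenD n)) : (l.map (simpleD n)).prod ∈ WeylD n :=
  Subgroup.list_prod_mem _ fun x hx => by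
    obtain ⟨g, _, rfl⟩ := List.mem_map.1 hx
    exact simpleD_mem g

theorem IsReducedWord.of_append_singleton {w : SignedPerm n} {l : List (GenD n)} {a : GenD n}
    (h : IsReducedWord (simpleD n) w (l ++ [a])) :
    IsDescent w a ∧ IsReducedWord (simpleD n) (w * simpleD n a) l := by
  rw [isReducedWord_iff, prod_append_singleton, List.length_append, List.length_singleton] at h
  have h1 : (l.map (simpleD n)).prod = w * simpleD n a := by rw [← h.1, mul_simpleD_cancel]
  have h2 := card_inversions_prod_le l
  rw [h1] at h2
  have h3 : IsDescent w a := by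
    by_contra h'
    have := card_inversions_mul h'
    omega
  have := card_inversions_of_isDescent h3
  exact ⟨h3, isReducedWord_iff.2 ⟨h1, by omega⟩⟩

theorem IsReducedWord.append_singleton {w : SignedPerm n} {l : List (GenD n)} {a : GenD n}
    (h : IsReducedWord (simpleD n) w l) (ha : ¬ IsDescent w a) :
    IsReducedWord (simpleD n) (w * simpleD n a) (l ++ [a]) := by
  rw [isReducedWord_iff] at h ⊢
  rw [prod_append_singleton, h.1, card_inversions_mul ha, List.length_append,
    List.length_singleton]
  exact ⟨rfl, by omega⟩

theorem IsReducedWord.mem_weylD {w : SignedPerm n} {l : List (GenD n)}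
    (h : IsReducedWord (simpleD n) w l) : w ∈ WeylD n := h.1 ▸ prod_mem_weylD l

/-- The composition of the operators of a reduced word depends only on the group element. -/
theorem foldr_opD_eq (m : ℕ) : ∀ {w : SignedPerm n} {l l' : List (GenD n)}, l.length ≤ m →
    IsReducedWord (simpleD n) w l → IsReducedWord (simpleD n) w l' →
    ∀ φ : GenPt K → K, l.foldr opD φ = l'.foldr opD φ := by
  induction m with
  | zero =>
    intro w l l' hm hl hl' φ
    have h1 := (isReducedWord_iff.1 hl).2
    have h2 := (isReducedWord_iff.1 hl').2
    rw [List.length_eq_zero_iff.1 (show l.length = 0 by omega),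
      List.length_eq_zero_iff.1 (show l'.length = 0 by omega)]
  | succ m ih =>
    intro w l l' hm hl hl' φ
    have hlen : l.length = l'.length := by
      have h1 := (isReducedWord_iff.1 hl).2
      have h2 := (isReducedWord_iff.1 hl').2
      omega
    rcases List.eq_nil_or_concat l with rfl | ⟨l₁, a, rfl⟩
    · rw [List.length_eq_zero_iff.1 hlen.symm]
    rcases List.eq_nil_or_concat l' with rfl | ⟨l₂, b, rfl⟩
    · simp at hlen
    simp only [List.concat_eq_append, List.length_append, List.length_singleton] at *
    obtain ⟨ha, h1⟩ := hl.of_append_singleton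
    obtain ⟨hb, h2⟩ := hl'.of_append_singleton
    -- The last letter acts first, so the induction removes letters on the right and changes `φ`.
    rw [List.foldr_append, List.foldr_append]
    simp only [List.foldr_cons, List.foldr_nil]
    by_cases hab : a = b
    · subst hab
      exact ih (by omega) h1 h2 _
    rcases commRel_or_braidRel (K := K) hab with ⟨hg, ho, hd⟩ | ⟨hg, ho, hd⟩
    · have hda := hd w ha hb
      -- Appending `b`, respectively `a`, to a reduced word of `w s_a s_b = w s_b s_a` gives reduced
      -- words of `w s_a` and `w s_b`, which are compared with the given ones by induction.
      obtain ⟨l₀, h0⟩ := exists_isReducedWord (exists_wordD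
        (⟨_, mul_mem h1.mem_weylD (simpleD_mem b)⟩ : WeylD n))
      have h0p : (l₀.map (simpleD n)).prod = w * simpleD n a * simpleD n b := h0.1
      have hn : ¬ IsDescent (w * simpleD n a * simpleD n b) b := fun h =>
        (isDescent_mul_self _ b).1 h hda
      have hb' := h0.append_singleton hn
      simp only [mul_simpleD_cancel] at hb'
      have ha' : IsReducedWord (simpleD n) (w * simpleD n b) (l₀ ++ [a]) := by
        have e1 := (isReducedWord_iff.1 h2)
        have e2 := (isReducedWord_iff.1 hb')
        refine isReducedWord_iff.2 ⟨?_, ?_⟩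
        · rw [prod_append_singleton, h0p, hg, mul_simpleD_cancel]
        · rw [← e1.2, List.length_append] at *
          have e3 := (isReducedWord_iff.1 h1)
          simp at *
          omega
      rw [ih (by omega) h1 hb', ih (by omega) h2 ha', List.foldr_append, List.foldr_append]
      simp only [List.foldr_cons, List.foldr_nil]
      rw [ho]
    · obtain ⟨hd1, hd2⟩ := hd w ha hb
      -- The same with `w s_a s_b s_a = w s_b s_a s_b`, which is three letters shorter than `w`.
      obtain ⟨l₀, h0⟩ := exists_isReducedWord (exists_wordD
        (⟨_, mul_mem (mul_mem h1.mem_weylD (simpleD_mem b)) (simpleD_mem a)⟩ : WeylD n))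
      have h0p : (l₀.map (simpleD n)).prod =
          w * simpleD n a * simpleD n b * simpleD n a := h0.1
      have hn1 : ¬ IsDescent (w * simpleD n a * simpleD n b * simpleD n a) a := fun h =>
        (isDescent_mul_self _ a).1 h hd2
      have hn2 : ¬ IsDescent (w * simpleD n a * simpleD n b) b := fun h =>
        (isDescent_mul_self _ b).1 h hd1
      have hb1 := h0.append_singleton hn1
      simp only [mul_simpleD_cancel] at hb1
      have hb2 := hb1.append_singleton hn2
      simp only [mul_simpleD_cancel] at hb2
      have ha2 : IsReducedWord (simpleD n) (w * simpleD n b) (l₀ ++ [b] ++ [a]) := by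
        have e1 := (isReducedWord_iff.1 h2)
        have e2 := (isReducedWord_iff.1 hb2)
        have e3 := (isReducedWord_iff.1 h1)
        refine isReducedWord_iff.2 ⟨?_, ?_⟩
        · rw [prod_append_singleton, prod_append_singleton, h0p]
          simp only [hg, mul_simpleD_cancel]
        · rw [← e1.2]
          simp at *
          omega
      rw [ih (by omega) h1 hb2, ih (by omega) h2 ha2]
      simp only [List.foldr_append, List.foldr_cons, List.foldr_nil]
      rw [ho]

/-- The operator `∂'_w` on functions of generic points. -/
def opW (w : WeylD n) (φ : GenPt K → K) : GenPt K → K := (reducedWordD w).foldr opD φ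

theorem isReducedWord_reducedWordD (w : WeylD n) :
    IsReducedWord (simpleD n) (w : SignedPerm n) (reducedWordD w) :=
  (exists_isReducedWord (exists_wordD w)).choose_spec

theorem opW_eq {w : WeylD n} {l : List (GenD n)} (h : IsReducedWord (simpleD n) w l)
    (φ : GenPt K → K) : opW w φ = l.foldr opD φ :=
  foldr_opD_eq _ le_rfl (isReducedWord_reducedWordD w) h φ

theorem lengthD_eq (w : WeylD n) : 2 * lengthD w = (inversions (w : SignedPerm n)).card := by
  have h := isReducedWord_reducedWordD w
  have : lengthD w = (reducedWordD w).length := by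
    refine le_antisymm (Nat.sInf_le ⟨_, h.1, rfl⟩) ?_
    refine le_csInf ⟨_, _, h.1, rfl⟩ ?_
    rintro _ ⟨l, hl, rfl⟩
    exact h.2 l hl
  rw [this, (isReducedWord_iff.1 h).2]

theorem isReducedWord_iff_lengthD {w : WeylD n} {l : List (GenD n)} :
    IsReducedWord (simpleD n) (w : SignedPerm n) l ↔
      (l.map (simpleD n)).prod = w ∧ l.length = lengthD w := by
  rw [isReducedWord_iff, ← lengthD_eq]
  refine and_congr_right fun _ => by omega

theorem exists_word_lengthD (w : WeylD n) :
    ∃ l : List (GenD n), (l.map (simpleD n)).prod = (w : SignedPerm n) ∧ l.length = lengthD w :=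
  ⟨_, isReducedWord_iff_lengthD.1 (isReducedWord_reducedWordD w)⟩

theorem lengthD_le {w : WeylD n} {l : List (GenD n)}
    (h : (l.map (simpleD n)).prod = (w : SignedPerm n)) : lengthD w ≤ l.length :=
  Nat.sInf_le ⟨l, h, rfl⟩

theorem prod_map_reverse (l : List (GenD n)) :
    (l.reverse.map (simpleD n)).prod = ((l.map (simpleD n)).prod)⁻¹ := by
  rw [List.prod_inv_reverse, List.map_map, List.map_reverse]
  congr 2
  exact List.map_congr_left fun i _ => (inv_eq_of_mul_eq_one_left (simpleD_mul_self i)).symm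

theorem lengthD_inv_le (w : WeylD n) : lengthD w⁻¹ ≤ lengthD w := by
  obtain ⟨l, hl, hc⟩ := exists_word_lengthD w
  rw [← hc, ← List.length_reverse]
  exact lengthD_le (by rw [prod_map_reverse, hl]; rfl)

theorem lengthD_inv (w : WeylD n) : lengthD w⁻¹ = lengthD w :=
  le_antisymm (lengthD_inv_le w) (by simpa using lengthD_inv_le w⁻¹)

/-- The generators as elements of the Weyl group. -/
def refl (g : GenD n) : WeylD n := ⟨simpleD n g, simpleD_mem g⟩

@[simp] theorem coe_refl (g : GenD n) : (refl g : SignedPerm n) = simpleD n g := rfl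

@[simp] theorem refl_mul_refl (g : GenD n) : refl g * refl g = 1 :=
  Subtype.ext (simpleD_mul_self g)

theorem lengthD_mul_refl (w : WeylD n) (g : GenD n) :
    (IsDescent (w : SignedPerm n) g → lengthD w = lengthD (w * refl g) + 1) ∧
      (¬ IsDescent (w : SignedPerm n) g → lengthD (w * refl g) = lengthD w + 1) := by
  have h1 := lengthD_eq w
  have h2 := lengthD_eq (w * refl g)
  refine ⟨fun h => ?_, fun h => ?_⟩
  · have := card_inversions_of_isDescent h
    simp only [Subgroup.coe_mul, coe_refl] at h2
    omega
  · have := card_inversions_mul h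
    simp only [Subgroup.coe_mul, coe_refl] at h2
    omega

theorem lengthD_refl_mul (w : WeylD n) (g : GenD n) :
    lengthD (refl g * w) = lengthD (w⁻¹ * refl g) := by
  rw [← lengthD_inv, mul_inv_rev]
  congr 2
  exact inv_eq_of_mul_eq_one_left (refl_mul_refl g)

theorem foldr_opD_opW {w u : WeylD n} {l : List (GenD n)}
    (h : (u : SignedPerm n) = (l.map (simpleD n)).prod * w)
    (hl : lengthD u = l.length + lengthD w) (φ : GenPt K → K) :
    l.foldr opD (opW w φ) = opW u φ := by
  rw [opW, ← List.foldr_append]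
  refine (opW_eq (isReducedWord_iff_lengthD.2 ⟨?_, ?_⟩) φ).symm
  · rw [List.map_append, List.prod_append, h, (isReducedWord_reducedWordD w).1]
  · rw [List.length_append, hl,
      (isReducedWord_iff_lengthD.1 (isReducedWord_reducedWordD w)).2]

theorem opD_opW_of_lt {w : WeylD n} {g : GenD n} (h : lengthD (refl g * w) = lengthD w + 1)
    (φ : GenPt K → K) : opD g (opW w φ) = opW (refl g * w) φ :=
  foldr_opD_opW (l := [g]) (by simp) (by rw [h, List.length_singleton, add_comm]) φ

theorem opD_opD (g : GenD n) (φ : GenPt K → K) : opD g (opD g φ) = 0 := by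
  cases g with
  | s i => exact opS_opS i φ
  | box h => exact opBox_opBox φ

/-- Here `w` has a reduced word that begins with `g`, and `opD g` squares to zero. -/
theorem opD_opW_of_gt {w : WeylD n} {g : GenD n} (h : lengthD w = lengthD (refl g * w) + 1)
    (φ : GenPt K → K) : opD g (opW w φ) = 0 := by
  have hw : refl g * (refl g * w) = w := by rw [← mul_assoc, refl_mul_refl, one_mul]
  have := opD_opW_of_lt (w := refl g * w) (g := g) (by rw [hw, h]) φ
  rw [hw] at this
  rw [← this, opD_opD]

end Words

/-! ### The sum over `L(σ)`: its recursion, and its value at the longest permutation. -/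

section Cosets

variable {n : ℕ} {K : Type*} [Field K]

theorem opD_sum {ι : Type*} (g : GenD n) (s : Finset ι) (φ : ι → GenPt K → K) :
    opD g (∑ i ∈ s, φ i) = ∑ i ∈ s, opD g (φ i) := by
  funext p
  cases g <;>
    simp [opD, opS, opBox, Finset.sum_apply, ← Finset.sum_sub_distrib, Finset.sum_div]

theorem foldr_opD_sum {ι : Type*} (l : List (GenD n)) (s : Finset ι) (φ : ι → GenPt K → K) :
    l.foldr opD (∑ i ∈ s, φ i) = ∑ i ∈ s, l.foldr opD (φ i) := by
  induction l with
  | nil => rfl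
  | cons g l ih => simp only [List.foldr_cons, ih, opD_sum]

/-- Replace the additional generator of type `D` by the first simple transposition. -/
def projGen : GenD n → Fin (n - 1)
  | .s i => i
  | .box h => ⟨0, by omega⟩

theorem right_simpleD (g : GenD n) : (simpleD n g).right = simpleA n (projGen g) := by
  cases g with
  | s i => rfl
  | box h => rfl

theorem right_prod (l : List (GenD n)) :
    ((l.map (simpleD n)).prod).right = ((l.map projGen).map (simpleA n)).prod := by
  induction l with
  | nil => rfl
  | cons g l ih =>
    simp only [List.map_cons, List.prod_cons, SemidirectProduct.mul_right, ih, right_simpleD]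

theorem prod_map_s (l : List (Fin (n - 1))) :
    ((l.map GenD.s).map (simpleD n)).prod = SemidirectProduct.inr ((l.map (simpleA n)).prod) := by
  rw [map_list_prod, List.map_map, List.map_map]
  rfl

theorem lengthD_permD_le {l : List (Fin (n - 1))} {σ : Equiv.Perm (Fin n)}
    (h : (l.map (simpleA n)).prod = σ) : lengthD (permD σ) ≤ l.length := by
  have := lengthD_le (w := permD σ) (l := l.map GenD.s) (by rw [prod_map_s, h]; rfl)
  simpa using this

/-- Replacing `s_□` by `s_1` in a word of `w` keeps the absolute values. Thus a permutation is of
minimal length in its coset modulo `H`. -/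
theorem lengthD_permD_right_le (w : WeylD n) :
    lengthD (permD (w : SignedPerm n).right) ≤ lengthD w := by
  obtain ⟨l, hl, hc⟩ := exists_word_lengthD w
  rw [← hc, ← List.length_map (f := projGen)]
  exact lengthD_permD_le (by rw [← right_prod, hl])

/-- By the same replacement, a word of type `A` cannot be shortened by using `s_□`. So reduced words
of type `A` can be treated as reduced words of type `D`. -/
theorem isReducedWord_map_s {σ : Equiv.Perm (Fin n)} {l : List (Fin (n - 1))}
    (h : IsReducedWord (simpleA n) σ l) :
    IsReducedWord (simpleD n) (permD σ : SignedPerm n) (l.map GenD.s) := by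
  refine ⟨by rw [prod_map_s, h.1]; rfl, fun l' hl' => ?_⟩
  have := h.2 (l'.map projGen) (by rw [← right_prod, hl']; rfl)
  simpa using this

theorem mem_lengthCoset {σ : Equiv.Perm (Fin n)} {w : WeylD n} :
    w ∈ lengthCoset σ ↔ (w : SignedPerm n).right = σ ∧ lengthD w = lengthD (permD σ) := by
  simp only [lengthCoset, Finset.mem_filter, Finset.mem_univ, true_and]
  refine and_congr_left fun _ => ⟨?_, fun h => ⟨(permD σ)⁻¹ * w, ?_, by simp⟩⟩
  · rintro ⟨h, hh, rfl⟩
    have : (h : SignedPerm n).right = 1 := hh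
    simp [permD, this]
  · change ((permD σ)⁻¹ * w : SignedPerm n).right = 1
    simp [permD, h]

theorem permD_mul_refl (σ : Equiv.Perm (Fin n)) (i : Fin (n - 1)) :
    permD σ * refl (.s i) = permD (σ * simpleA n i) := by
  apply Subtype.ext
  simp [permD, simpleD, map_mul]

theorem longD_mul_self (n : ℕ) : longD n * longD n = 1 := by
  apply Subtype.ext
  simp only [longD, Subgroup.coe_mul, ← map_mul]
  rw [show (fun k : Fin n => if Odd n ∧ (k : ℕ) = 0 then (1 : ℤˣ) else -1) *
    (fun k : Fin n => if Odd n ∧ (k : ℕ) = 0 then (1 : ℤˣ) else -1) = 1 from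
      _root_.funext fun k => Int.units_mul_self _, map_one]
  rfl

theorem sval_longD_mul (w : SignedPerm n) (j : Fin n) :
    sval ((longD n : SignedPerm n) * w) j =
      (if Odd n ∧ (w.right j : ℕ) = 0 then 1 else -1) * sval w j := by
  rw [sval_of_lt, sval_of_lt]
  have h1 : ((longD n : SignedPerm n) * w).right = w.right := by simp [longD]
  have h2 : ((longD n : SignedPerm n) * w).left (w.right j) =
      (if Odd n ∧ (w.right j : ℕ) = 0 then 1 else -1) * w.left (w.right j) := by
    rw [mul_left_apply]
    simp [longD]
  rw [h1, h2]
  split_ifs <;> simp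

/-- `longD` reverses the sign of every value, except possibly of the value of absolute value `1`.
The sign of that value never decides a comparison with an entry of larger absolute value, so all
comparisons are reversed. -/
theorem isDescent_longD_mul (w : SignedPerm n) (g : GenD n) :
    IsDescent ((longD n : SignedPerm n) * w) g ↔ ¬ IsDescent w g := by
  have key : ∀ i j : Fin n, i ≠ j →
      (sval ((longD n : SignedPerm n) * w) i < sval ((longD n : SignedPerm n) * w) j ↔
        sval w j < sval w i) ∧
      (sval ((longD n : SignedPerm n) * w) i + sval ((longD n : SignedPerm n) * w) j < 0 ↔
        0 < sval w i + sval w j) := by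
    intro i j hij
    have h1 := natAbs_sval w i
    have h2 := natAbs_sval w j
    have h3 : (w.right i : ℕ) ≠ w.right j := fun h => hij (w.right.injective (Fin.ext h))
    rw [sval_longD_mul, sval_longD_mul]
    split_ifs <;> omega
  cases g with
  | s i =>
    have h1 := (sval_abs_ne w (i := i) (j := i + 1) (by omega) (by omega) (by omega)).1
    have h2 := (key (hi i) (lo i) (lo_ne_hi i).symm).1
    simp only [IsDescent]
    simp only [lo, hi] at h2
    omega
  | box h =>
    have h1 := (sval_abs_ne w (i := 0) (j := 1) (by omega) (by omega) (by omega)).2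
    have h2 := (key ⟨0, by omega⟩ ⟨1, by omega⟩ (by simp)).2
    simp only [IsDescent]
    simp only at h2
    omega

theorem opD_opW_inv_mul_longD (w : WeylD n) (g : GenD n) (φ : GenPt K → K) :
    (IsDescent (w : SignedPerm n) g →
      opD g (opW (w⁻¹ * longD n) φ) = opW ((w * refl g)⁻¹ * longD n) φ) ∧
    (¬ IsDescent (w : SignedPerm n) g → opD g (opW (w⁻¹ * longD n) φ) = 0) := by
  have e1 : refl g * (w⁻¹ * longD n) = (w * refl g)⁻¹ * longD n := by
    rw [mul_inv_rev, mul_assoc, inv_eq_of_mul_eq_one_left (refl_mul_refl g)]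
  have e2 : (w⁻¹ * longD n)⁻¹ = longD n * w := by
    rw [mul_inv_rev, inv_inv, inv_eq_of_mul_eq_one_left (longD_mul_self n)]
  have e3 := lengthD_refl_mul (w⁻¹ * longD n) g
  have e4 := lengthD_inv (w⁻¹ * longD n)
  rw [e2] at e3 e4
  have h := lengthD_mul_refl (longD n * w) g
  rw [Subgroup.coe_mul, isDescent_longD_mul, not_not] at h
  refine ⟨fun hd => ?_, fun hd => ?_⟩
  · rw [← e1]
    exact opD_opW_of_lt (by rw [e3, h.2 hd, e4]) φ
  · exact opD_opW_of_gt (by rw [e3, ← e4, h.1 hd]) φ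

theorem sval_permD (σ : Equiv.Perm (Fin n)) (j : Fin n) :
    sval (permD σ : SignedPerm n) j = (σ j : ℕ) + 1 := by
  rw [sval_of_lt]; simp [permD]

theorem isDescent_permD (σ : Equiv.Perm (Fin n)) (i : Fin (n - 1)) :
    IsDescent (permD σ : SignedPerm n) (.s i) ↔ σ (hi i) < σ (lo i) := by
  have h1 := sval_permD σ (hi i)
  have h2 := sval_permD σ (lo i)
  simp only [hi, lo] at h1 h2
  rw [IsDescent, h1, h2, Fin.lt_def, hi, lo]
  omega

/-- The sum of the operators `∂'_{w⁻¹ w₀}` over the set `L(σ)`. -/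
def opCoset (σ : Equiv.Perm (Fin n)) (φ : GenPt K → K) : GenPt K → K :=
  ∑ w ∈ lengthCoset σ, opW (w⁻¹ * longD n) φ

/-- The terms for which `s_i` is not a descent vanish. For the others, `w ↦ w s_i` is a bijection
onto `L(σ s_i)`, by minimality of the length of `σ` in its coset. -/
theorem opS_opCoset {σ : Equiv.Perm (Fin n)} {i : Fin (n - 1)} (h : σ (hi i) < σ (lo i))
    (φ : GenPt K → K) : opS i (opCoset σ φ) = opCoset (σ * simpleA n i) φ := by
  classical
  have hd := (isDescent_permD σ i).2 h
  have hl := (lengthD_mul_refl (permD σ) (.s i)).1 hd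
  rw [permD_mul_refl] at hl
  have h1 : opS i (opCoset σ φ) = ∑ w ∈ (lengthCoset σ).filter
      (fun w : WeylD n => IsDescent (w : SignedPerm n) (.s i)),
      opW ((w * refl (.s i))⁻¹ * longD n) φ := by
    change opD (.s i) _ = _
    rw [opCoset, opD_sum, Finset.sum_filter]
    refine Finset.sum_congr rfl fun w _ => ?_
    split_ifs with hw
    · exact (opD_opW_inv_mul_longD w _ φ).1 hw
    · exact (opD_opW_inv_mul_longD w _ φ).2 hw
  rw [h1, opCoset]
  have hcancel : ∀ w : WeylD n, w * refl (.s i) * refl (.s i) = w := fun w => by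
    rw [mul_assoc, refl_mul_refl, mul_one]
  refine Finset.sum_nbij' (fun w => w * refl (.s i)) (fun w => w * refl (.s i)) ?_ ?_
    (fun w _ => hcancel w) (fun w _ => hcancel w) fun w _ => rfl
  · intro w hw
    rw [Finset.mem_filter, mem_lengthCoset] at hw
    have := (lengthD_mul_refl w (.s i)).1 hw.2
    refine mem_lengthCoset.2 ⟨?_, by omega⟩
    rw [Subgroup.coe_mul, SemidirectProduct.mul_right, hw.1.1, coe_refl, right_simpleD]
    rfl
  · intro w hw
    rw [mem_lengthCoset] at hw
    have hr : ((w * refl (.s i) : WeylD n) : SignedPerm n).right = σ := by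
      rw [Subgroup.coe_mul, SemidirectProduct.mul_right, hw.1, coe_refl, right_simpleD, mul_assoc]
      simp [projGen, simpleA]
    -- `w s_i` lies over `σ`, so it is at least as long as `σ`, which is longer than `w`; hence
    -- `s_i` is an ascent of `w`.
    have h2 := lengthD_permD_right_le (w * refl (.s i))
    rw [hr] at h2
    have h3 := lengthD_mul_refl w (.s i)
    have hw' : ¬ IsDescent (w : SignedPerm n) (.s i) := fun hw' => by
      have := h3.1 hw'
      omega
    refine Finset.mem_filter.2 ⟨mem_lengthCoset.2 ⟨hr, ?_⟩, ?_⟩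
    · rw [h3.2 hw']
      omega
    · exact (isDescent_mul_self _ _).2 hw'

/-- The permutation that reverses the first `k` positions. -/
def revFirst (n k : ℕ) (hk : k ≤ n) : Equiv.Perm (Fin n) :=
  Function.Involutive.toPerm
    (fun i => if (i : ℕ) < k then ⟨k - 1 - i, by have := i.2; omega⟩ else i) fun i => by
      apply Fin.ext
      by_cases h : (i : ℕ) < k
      · simp only [h, if_true]
        rw [if_pos (by omega)]
        simp only
        omega
      · simp [h]

theorem revFirst_apply {k : ℕ} (hk : k ≤ n) (i : Fin n) :
    (revFirst n k hk i : ℕ) = if (i : ℕ) < k then k - 1 - i else i := by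
  change ((if (i : ℕ) < k then (⟨k - 1 - i, _⟩ : Fin n) else i : Fin n) : ℕ) = _
  split_ifs <;> rfl

/-- Each ordered pair of distinct positions among the first `k` gives an inversion: with signs `+`
if increasing, with signs `-` if decreasing. -/
theorem le_card_inversions_revFirst {k : ℕ} (hk : k ≤ n) :
    k * (k - 1) ≤ 2 * lengthD (permD (revFirst n k hk)) := by
  classical
  rw [lengthD_eq]
  let c : Fin k → Fin n := Fin.castLE hk
  let f : Fin k × Fin k → (ℤˣ × Fin n) × (ℤˣ × Fin n) := fun a =>
    if a.1 < a.2 then ((1, c a.1), (1, c a.2)) else ((-1, c a.1), (-1, c a.2))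
  have hf : Function.Injective f := by
    rintro ⟨a, b⟩ ⟨a', b'⟩ h
    simp only [f] at h
    have hc : Function.Injective c := Fin.castLE_injective hk
    split_ifs at h <;> simp only [Prod.mk.injEq, true_and] at h
    · exact Prod.ext (hc h.1) (hc h.2)
    · exact absurd h.1.1 (by decide)
    · exact absurd h.1.1 (by decide)
    · exact Prod.ext (hc h.1) (hc h.2)
  have h1 : (Finset.univ : Finset (Fin k)).offDiag.card = k * (k - 1) := by
    rw [Finset.offDiag_card, Finset.card_univ, Fintype.card_fin, Nat.mul_sub, mul_one]
  rw [← h1, ← Finset.card_image_of_injective _ hf]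
  refine Finset.card_le_card fun b hb => ?_
  obtain ⟨⟨a, a'⟩, ha, rfl⟩ := Finset.mem_image.1 hb
  have hne : a ≠ a' := (Finset.mem_offDiag.1 ha).2.2
  have hv : ∀ a : Fin k, sval (permD (revFirst n k hk) : SignedPerm n) (c a) = (k : ℤ) - a := by
    intro a
    rw [sval_permD, revFirst_apply, if_pos (by simp [c])]
    have := a.2
    simp only [c, Fin.val_castLE]
    omega
  have hv1 : ∀ a : Fin k, sval (1 : SignedPerm n) (c a) = a + 1 := fun a => by
    rw [sval_one (c a).2]; rfl
  rw [mem_inversions]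
  have hne' : (a : ℕ) ≠ a' := fun h => hne (Fin.ext h)
  simp only [f]
  split_ifs with h
  · have h' : (a : ℕ) < a' := h
    simp only [signedVal, hv, hv1]
    refine ⟨fun h => hne (Fin.castLE_injective hk h), ?_, ?_⟩ <;> simp <;> omega
  · have h' : ¬ (a : ℕ) < a' := h
    simp only [signedVal, hv, hv1]
    refine ⟨fun h => hne (Fin.castLE_injective hk h), ?_, ?_⟩ <;> simp <;> omega

/-- The word `s_j ⋯ s_{j + d - 1}`. -/
def runWord (n : ℕ) : (j d : ℕ) → j + d ≤ n - 1 → List (GenD n)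
  | _, 0, _ => []
  | j, d + 1, h => .s ⟨j, by omega⟩ :: runWord n (j + 1) d (by omega)

theorem length_runWord (j d : ℕ) (h : j + d ≤ n - 1) : (runWord n j d h).length = d := by
  induction d generalizing j with
  | zero => rfl
  | succ d ih => rw [runWord, List.length_cons, ih]

theorem foldr_runWord (j d : ℕ) (h : j + d ≤ n - 1) (φ : GenPt K → K) :
    (runWord n j d h).foldr opD φ = opRun j d φ := by
  induction d generalizing j with
  | zero => rfl
  | succ d ih => rw [runWord, List.foldr_cons, ih]; rfl

theorem runWord_left (j d : ℕ) (h : j + d ≤ n - 1) :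
    (((runWord n j d h).map (simpleD n)).prod).left = 1 := by
  induction d generalizing j with
  | zero => rfl
  | succ d ih =>
    funext k
    rw [runWord, List.map_cons, List.prod_cons, mul_left_apply, ih]
    simp [simpleD]

theorem runWord_right (j d : ℕ) (h : j + d ≤ n - 1) (i : Fin n) :
    ((((runWord n j d h).map (simpleD n)).prod).right i : ℕ) =
      if j ≤ i ∧ (i : ℕ) < j + d then (i : ℕ) + 1 else if (i : ℕ) = j + d then j else i := by
  induction d generalizing j with
  | zero =>
    simp [runWord]
    split_ifs <;> omega
  | succ d ih =>
    rw [runWord, List.map_cons, List.prod_cons, SemidirectProduct.mul_right, Equiv.Perm.mul_apply,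
      right_simpleD]
    have ih' := ih (j + 1) (by omega)
    simp only [projGen, simpleA, Equiv.swap_apply_def, lo, hi, Fin.ext_iff]
    have := i.2
    grind

/-- The signed permutations of type `D` that reverse the first `k` positions, up to signs, and
fix the others. -/
def revSet (n k : ℕ) (hk : k ≤ n) : Finset (WeylD n) :=
  letI := Classical.decPred fun w : WeylD n => (w : SignedPerm n).right = revFirst n k hk ∧
    ∀ i : Fin n, k ≤ i → (w : SignedPerm n).left i = 1
  Finset.univ.filter fun w => (w : SignedPerm n).right = revFirst n k hk ∧
    ∀ i : Fin n, k ≤ i → (w : SignedPerm n).left i = 1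

theorem mem_revSet {k : ℕ} {hk : k ≤ n} {w : WeylD n} :
    w ∈ revSet n k hk ↔ (w : SignedPerm n).right = revFirst n k hk ∧
      ∀ i : Fin n, k ≤ i → (w : SignedPerm n).left i = 1 := by
  simp [revSet]

theorem revSet_of_le_one {k : ℕ} (hk : k ≤ n) (h1 : k ≤ 1) : revSet n k hk = {1} := by
  ext w
  have hrev : revFirst n k hk = 1 := by
    ext i
    rw [revFirst_apply]
    simp only [Equiv.Perm.one_apply]
    split_ifs <;> omega
  rw [mem_revSet, hrev, Finset.mem_singleton]
  refine ⟨fun h => Subtype.ext (SemidirectProduct.ext (_root_.funext fun i => ?_) h.1), ?_⟩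
  · by_cases hi : k ≤ i
    · exact h.2 i hi
    · have hw := (mem_weylD_iff _).1 w.2
      rw [Finset.prod_eq_single i] at hw
      · exact hw
      · exact fun j _ hj => h.2 j (by
          have : (j : ℕ) ≠ i := fun h => hj (Fin.ext h)
          omega)
      · simp
  · rintro rfl
    exact ⟨rfl, fun _ _ => rfl⟩

/-- The set for `k + 1` is the disjoint union of the translates by `P` and by `Q` of the set for
`k`, distinguished by the sign that the value `1` carries. Stated for an arbitrary `F`, this also
yields memberships, by taking indicator functions. -/
theorem sum_revSet_succ {k : ℕ} (hk1 : 1 ≤ k) (hk : k + 1 ≤ n) {A : Type*} [AddCommMonoid A]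
    (F : WeylD n → A) {P Q : WeylD n}
    (hP : (P : SignedPerm n) = ((.s ⟨0, by omega⟩ :: runWord n 1 (k - 1) (by omega)).map
      (simpleD n)).prod)
    (hQ : (Q : SignedPerm n) = ((.box (by omega) :: runWord n 1 (k - 1) (by omega)).map
      (simpleD n)).prod) :
    ∑ w ∈ revSet n (k + 1) hk, F w =
      ∑ w ∈ revSet n k (by omega), F (P * w) + ∑ w ∈ revSet n k (by omega), F (Q * w) := by
  classical
  have hPr : (P : SignedPerm n).right = (Q : SignedPerm n).right := by rw [hP, hQ]; rfl
  have hPi : ∀ i : Fin n, ((P : SignedPerm n).right i : ℕ) =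
      if (i : ℕ) < k then (i : ℕ) + 1 else if (i : ℕ) = k then 0 else i := by
    intro i
    have h1 : (P : SignedPerm n) = ((runWord n 0 k (by omega)).map (simpleD n)).prod := by
      obtain ⟨k, rfl⟩ := Nat.exists_eq_add_of_le' hk1
      rw [hP]
      rfl
    rw [h1, runWord_right]
    simp
  have hrev : (P : SignedPerm n).right * revFirst n k (by omega) = revFirst n (k + 1) hk := by
    ext i
    rw [Equiv.Perm.mul_apply, hPi, revFirst_apply, revFirst_apply]
    split_ifs <;> omega
  have hPl : ∀ i, (P : SignedPerm n).left i = 1 := by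
    intro i
    rw [hP, List.map_cons, List.prod_cons, mul_left_apply, runWord_left]
    simp [simpleD]
  have hQl : ∀ i : Fin n, (Q : SignedPerm n).left i = if (i : ℕ) < 2 then -1 else 1 := by
    intro i
    rw [hQ, List.map_cons, List.prod_cons, mul_left_apply, runWord_left]
    simp [simpleD, reflBox]
  have main : ∀ (s : ℤˣ) (R : WeylD n), (R : SignedPerm n).right = (P : SignedPerm n).right →
      (∀ i : Fin n, (i : ℕ) = 0 → (R : SignedPerm n).left i = s) →
      (∀ i : Fin n, 2 ≤ (i : ℕ) → (R : SignedPerm n).left i = 1) →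
      ∑ w ∈ (revSet n (k + 1) hk).filter
        (fun w : WeylD n => (w : SignedPerm n).left ⟨0, by omega⟩ = s), F w =
        ∑ w ∈ revSet n k (by omega), F (R * w) := by
    intro s R hR hR0 hR2
    symm
    have hinv : ∀ i : Fin n, k + 1 ≤ i → ((R : SignedPerm n).right⁻¹ i) = i := by
      intro i hi
      rw [Equiv.Perm.inv_eq_iff_eq, hR]
      apply Fin.ext
      rw [hPi, if_neg (by omega), if_neg (by omega)]
    have hinv0 : ((R : SignedPerm n).right⁻¹ ⟨0, by omega⟩) = ⟨k, by omega⟩ := by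
      rw [Equiv.Perm.inv_eq_iff_eq, hR]
      apply Fin.ext
      rw [hPi]
      simp
    refine Finset.sum_nbij' (fun w : WeylD n => R * w) (fun w : WeylD n => R⁻¹ * w) ?_ ?_
      (by simp) (by simp) (fun _ _ => rfl)
    · intro w hw
      obtain ⟨h1, h2⟩ := mem_revSet.1 hw
      refine Finset.mem_filter.2 ⟨mem_revSet.2 ⟨?_, fun i hi => ?_⟩, ?_⟩
      · rw [Subgroup.coe_mul, SemidirectProduct.mul_right, h1, hR, hrev]
      · rw [Subgroup.coe_mul, mul_left_apply, hinv i hi, hR2 i (by omega), h2 i (by omega),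
          one_mul]
      · rw [Subgroup.coe_mul, mul_left_apply, hinv0, hR0 _ rfl, h2 _ le_rfl, mul_one]
    · intro w hw
      obtain ⟨hw, h0⟩ := Finset.mem_filter.1 hw
      obtain ⟨h1, h2⟩ := mem_revSet.1 hw
      have hm : ∀ i, (w : SignedPerm n).left i = (R : SignedPerm n).left i *
          ((R⁻¹ * w : WeylD n) : SignedPerm n).left ((R : SignedPerm n).right⁻¹ i) := fun i => by
        rw [← mul_left_apply, ← Subgroup.coe_mul, mul_inv_cancel_left]
      refine mem_revSet.2 ⟨?_, fun i hi => ?_⟩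
      · rw [Subgroup.coe_mul, SemidirectProduct.mul_right, h1, ← hrev]
        simp [hR]
      · rcases hi.eq_or_lt with h | h
        · have h3 := hm ⟨0, by omega⟩
          rw [hinv0, h0, hR0 _ rfl] at h3
          have h4 : i = ⟨k, by omega⟩ := Fin.ext h.symm
          rw [h4]
          exact (left_eq_mul.1 h3)
        · have h3 := hm i
          rw [hinv i h, h2 i h, hR2 i (by omega), one_mul] at h3
          exact h3.symm
  rw [← main 1 P rfl (fun i _ => hPl i) (fun i _ => hPl i),
    ← main (-1) Q hPr.symm (fun i hi => by rw [hQl, if_pos (by omega)])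
      (fun i hi => by rw [hQl, if_neg (by omega)]),
    ← Finset.sum_filter_add_sum_filter_not (revSet n (k + 1) hk)
      fun w : WeylD n => (w : SignedPerm n).left ⟨0, by omega⟩ = 1]
  refine congrArg₂ (· + ·) rfl (Finset.sum_congr (Finset.filter_congr fun w _ => ?_) fun _ _ => rfl)
  rcases Int.units_eq_one_or ((w : SignedPerm n).left ⟨0, by omega⟩) with h | h <;> rw [h] <;>
    decide

theorem lengthD_one : lengthD (1 : WeylD n) = 0 :=
  Nat.le_zero.1 (lengthD_le (l := []) rfl)

theorem opW_one (φ : GenPt K → K) : opW (1 : WeylD n) φ = φ :=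
  opW_eq (l := []) ⟨rfl, fun _ _ => Nat.zero_le _⟩ φ

/-- Lengths and operators are treated together: the lengths show that prefixing the words of `P` and
`Q` to reduced words gives reduced words, so that the operators compose to `opW`. -/
theorem theta_eq_sum (k : ℕ) : ∀ hk : k ≤ n,
    (∀ w ∈ revSet n k hk, 2 * lengthD w = k * (k - 1)) ∧
      ∀ φ : GenPt K → K, theta k φ = ∑ w ∈ revSet n k hk, opW w φ := by
  induction k using Nat.twoStepInduction with
  | zero =>
    intro hk
    rw [revSet_of_le_one hk (by omega)]
    simp [lengthD_one, opW_one, theta]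
  | one =>
    intro hk
    rw [revSet_of_le_one hk (by omega)]
    simp [lengthD_one, opW_one, theta]
  | more m _ ih =>
    intro hk
    obtain ⟨ih1, ih2⟩ := ih (by omega)
    have hw : ∀ l : List (GenD n), (l.map (simpleD n)).prod ∈ WeylD n := prod_mem_weylD
    let lP : List (GenD n) := .s ⟨0, by omega⟩ :: runWord n 1 m (by omega)
    let lQ : List (GenD n) := .box (by omega) :: runWord n 1 m (by omega)
    let P : WeylD n := ⟨_, hw lP⟩
    let Q : WeylD n := ⟨_, hw lQ⟩
    have hP : lP.length = m + 1 := by simp [lP, length_runWord]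
    have hQ : lQ.length = m + 1 := by simp [lQ, length_runWord]
    have hle : ∀ (l : List (GenD n)) (w : WeylD n), l.length = m + 1 →
        w ∈ revSet n (m + 1) (by omega) →
        2 * lengthD ((⟨_, hw l⟩ : WeylD n) * w) ≤ (m + 2) * (m + 1) := by
      intro l w hl hw'
      obtain ⟨l', h1, h2⟩ := exists_word_lengthD w
      have h3 := lengthD_le (w := (⟨_, hw l⟩ : WeylD n) * w) (l := l ++ l') (by
        rw [List.map_append, List.prod_append, h1]; rfl)
      have h4 := ih1 w hw'
      rw [List.length_append, hl, h2] at h3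
      simp only [Nat.add_sub_cancel] at h4
      nlinarith
    have hlen : ∀ w ∈ revSet n (m + 2) hk, 2 * lengthD w = (m + 2) * (m + 1) := by
      classical
      intro w hw'
      refine le_antisymm ?_ ?_
      · by_contra hcon
        -- The indicator function of `w` shows that `w` is `P v` or `Q v` for some `v` in the
        -- smaller set, which bounds its length from above.
        have h := sum_revSet_succ (k := m + 1) (by omega) hk (P := P) (Q := Q)
          (fun v => if v = w then 1 else 0) rfl rfl
        simp only [Finset.sum_ite_eq', if_pos hw'] at h
        rw [Finset.sum_eq_zero, Finset.sum_eq_zero] at h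
        · exact absurd h (by norm_num)
        · intro v hv
          refine if_neg fun e => hcon ?_
          rw [← e]
          exact hle lQ v hQ hv
        · intro v hv
          refine if_neg fun e => hcon ?_
          rw [← e]
          exact hle lP v hP hv
      · have h1 := lengthD_permD_right_le w
        -- The lower bound comes from the unsigned reversal, which is shortest in its coset.
        have h2 := le_card_inversions_revFirst hk
        rw [(mem_revSet.1 hw').1] at h1
        exact h2.trans (by omega)
    have hmem : ∀ w ∈ revSet n (m + 1) (by omega),
        P * w ∈ revSet n (m + 2) hk ∧ Q * w ∈ revSet n (m + 2) hk := by
      classical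
      -- The indicator function of the complement has sum zero over the large set, so no translate
      -- leaves it.
      have h := sum_revSet_succ (k := m + 1) (by omega) hk (P := P) (Q := Q)
        (fun v => if v ∈ revSet n (m + 2) hk then 0 else 1) rfl rfl
      rw [Finset.sum_eq_zero fun v hv => if_pos hv, eq_comm, Nat.add_eq_zero_iff,
        Finset.sum_eq_zero_iff, Finset.sum_eq_zero_iff] at h
      intro w hw'
      have h1 := h.1 w hw'
      have h2 := h.2 w hw'
      constructor
      · by_contra hc
        simp [hc] at h1
      · by_contra hc
        simp [hc] at h2
    refine ⟨hlen, fun φ => ?_⟩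
    rw [sum_revSet_succ (k := m + 1) (by omega) hk (P := P) (Q := Q) (fun w => opW w φ) rfl rfl]
    have hfold : ∀ (l : List (GenD n)), l.length = m + 1 →
        (∀ w ∈ revSet n (m + 1) (by omega), (⟨_, hw l⟩ : WeylD n) * w ∈ revSet n (m + 2) hk) →
        l.foldr opD (theta (m + 1) φ) =
          ∑ w ∈ revSet n (m + 1) (by omega), opW ((⟨_, hw l⟩ : WeylD n) * w) φ := by
      intro l hl hl'
      rw [ih2, foldr_opD_sum]
      refine Finset.sum_congr rfl fun w hw' => foldr_opD_opW rfl ?_ φ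
      have h1 := hlen _ (hl' w hw')
      have h2 := ih1 w hw'
      simp only [Nat.add_sub_cancel] at h2
      rw [hl]
      nlinarith
    have e1 := hfold lP hP fun w hw' => (hmem w hw').1
    have e2 := hfold lQ hQ fun w hw' => (hmem w hw').2
    rw [← e1, ← e2, List.foldr_cons, List.foldr_cons, foldr_runWord]
    rfl

theorem lengthCoset_longA : lengthCoset (longA n) = revSet n n le_rfl := by
  have h : revFirst n n le_rfl = longA n := by
    ext i
    rw [revFirst_apply, if_pos i.2, longA, Fin.revPerm_apply, Fin.val_rev]
    omega
  have hlen : 2 * lengthD (permD (longA n)) = n * (n - 1) := by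
    -- The statement on lengths does not involve the field; `ℚ` is an arbitrary choice.
    refine (theta_eq_sum (K := ℚ) n le_rfl).1 _ (mem_revSet.2 ⟨by rw [h]; rfl, fun i hi => ?_⟩)
    exact absurd i.2 (by omega)
  ext w
  rw [mem_lengthCoset, mem_revSet, h]
  refine and_congr_right fun hr => ⟨fun _ i hi => absurd i.2 (by omega), fun hw => ?_⟩
  have := (theta_eq_sum (K := ℚ) n le_rfl).1 w (mem_revSet.2 ⟨by rw [h, hr], hw⟩)
  omega

/-- `w ↦ w⁻¹ w̃₀` permutes the elements that are equal to `(n, …, 1)` in absolute value, since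
reversal is an involution and `w̃₀` only changes signs. -/
theorem opCoset_longA (φ : GenPt K → K) : opCoset (longA n) φ = theta n φ := by
  have hrev : revFirst n n le_rfl * revFirst n n le_rfl = 1 := by
    ext i
    simp [revFirst]
    omega
  have hinv : ∀ w : WeylD n, w ∈ revSet n n le_rfl → w⁻¹ * longD n ∈ revSet n n le_rfl := by
    intro w hw
    refine mem_revSet.2 ⟨?_, fun i hi => absurd i.2 (by omega)⟩
    rw [Subgroup.coe_mul, SemidirectProduct.mul_right, Subgroup.coe_inv,
      SemidirectProduct.inv_right, (mem_revSet.1 hw).1, inv_eq_of_mul_eq_one_left hrev]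
    simp [longD]
  have hinv' : ∀ w : WeylD n, w ∈ revSet n n le_rfl → longD n * w⁻¹ ∈ revSet n n le_rfl := by
    intro w hw
    refine mem_revSet.2 ⟨?_, fun i hi => absurd i.2 (by omega)⟩
    rw [Subgroup.coe_mul, SemidirectProduct.mul_right, Subgroup.coe_inv,
      SemidirectProduct.inv_right, (mem_revSet.1 hw).1, inv_eq_of_mul_eq_one_left hrev]
    simp [longD]
  rw [(theta_eq_sum n le_rfl).2, opCoset, lengthCoset_longA]
  exact Finset.sum_nbij' (fun w : WeylD n => w⁻¹ * longD n) (fun w : WeylD n => longD n * w⁻¹)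
    hinv hinv' (fun w _ => by simp [← mul_assoc])
    (fun w _ => by simp [mul_assoc]) fun _ _ => rfl

theorem exists_lt_of_ne_longA {σ : Equiv.Perm (Fin n)} (h : σ ≠ longA n) :
    ∃ i : Fin (n - 1), σ (lo i) < σ (hi i) := by
  by_contra! hcon
  have hanti : ∀ i : Fin (n - 1), σ (hi i) < σ (lo i) := fun i =>
    lt_of_le_of_ne (hcon i) fun e => lo_ne_hi i (σ.injective e).symm
  apply h
  rcases n with _ | m
  · exact Subsingleton.elim _ _
  · have h1 : StrictAnti σ := Fin.strictAnti_iff_succ_lt.2 fun i => hanti i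
    have h2 : StrictMono (fun i => (σ i).rev) := fun i j hij => Fin.rev_lt_rev.2 (h1 hij)
    have h3 : (fun i => (σ i).rev) = id := by
      have : (⟨σ.trans Fin.revPerm, by
        intro a b
        exact h2.le_iff_le⟩ : Fin (m + 1) ≃o Fin (m + 1)) = OrderIso.refl _ :=
          Subsingleton.elim _ _
      funext i
      exact DFunLike.congr_fun this i
    ext i
    have := congrFun h3 i
    simp only [id] at this
    rw [longA, Fin.revPerm_apply, ← Fin.rev_rev (σ i), this]

/-- Two functions on `S_n` agree if they agree at the longest element and agree at `σ s_i` as soon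
as they agree at `σ` and `σ s_i` is shorter than `σ`. -/
theorem eq_of_longA {A : Type*} {F G : Equiv.Perm (Fin n) → A} (h0 : F (longA n) = G (longA n))
    (hs : ∀ (σ : Equiv.Perm (Fin n)) (i : Fin (n - 1)), σ (hi i) < σ (lo i) → F σ = G σ →
      F (σ * simpleA n i) = G (σ * simpleA n i)) (σ : Equiv.Perm (Fin n)) : F σ = G σ := by
  classical
  obtain ⟨M, hM⟩ : ∃ M, ∀ σ : Equiv.Perm (Fin n), lengthD (permD σ) ≤ M :=
    ⟨Finset.univ.sup fun σ => lengthD (permD σ), fun σ =>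
      Finset.le_sup (f := fun σ => lengthD (permD σ)) (Finset.mem_univ σ)⟩
  induction hk : M - lengthD (permD σ) using Nat.strong_induction_on generalizing σ with
  | _ k ih =>
    by_cases h : σ = longA n
    · rw [h, h0]
    · obtain ⟨i, hi'⟩ := exists_lt_of_ne_longA h
      have hd : (σ * simpleA n i) (hi i) < (σ * simpleA n i) (lo i) := by
        simpa [simpleA] using hi'
      have hc : σ * simpleA n i * simpleA n i = σ := by
        rw [mul_assoc, simpleA, Equiv.swap_mul_self, mul_one]
      have hl := (lengthD_mul_refl (permD (σ * simpleA n i)) (.s i)).1 ((isDescent_permD _ i).2 hd)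
      rw [permD_mul_refl, hc] at hl
      have := hM (σ * simpleA n i)
      rw [← hc]
      exact hs _ i hd (ih _ (by omega) _ rfl)

end Cosets

/-! ### Expansions of Pfaffians along the last column. -/

section Pfaffian

variable {S : Type*} [CommRing S]

theorem pfaffian_nil {ι : Type*} (a : ι → ι → S) : pfaffian a [] = 1 := by
  rw [pfaffian]

theorem pfaffian_cons (a : ℕ → ℕ → S) (h : ℕ) (l : List ℕ) :
    pfaffian a (h :: l) = ∑ j ∈ Finset.range l.length,
      (-1) ^ j * a h (l.getD j 0) * pfaffian a (l.eraseIdx j) := by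
  rw [pfaffian, ← Fin.sum_univ_eq_sum_range
    (fun j => (-1) ^ j * a h (l.getD j 0) * pfaffian a (l.eraseIdx j))]
  refine Finset.sum_congr rfl fun j _ => ?_
  rw [List.getD_eq_getElem _ _ j.2, List.get_eq_getElem]

theorem map_pfaffian {ι T : Type*} [CommRing T] (f : S →+* T) (a : ι → ι → S) (l : List ι) :
    f (pfaffian a l) = pfaffian (fun i j => f (a i j)) l := by
  induction hk : l.length using Nat.strong_induction_on generalizing l with
  | _ k ih =>
    cases l with
    | nil => simp [pfaffian]
    | cons h l =>
      rw [pfaffian, pfaffian, map_sum]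
      refine Finset.sum_congr rfl fun j _ => ?_
      rw [map_mul, map_mul, map_pow, map_neg, map_one, ih (l.eraseIdx j).length _ _ rfl]
      have := List.length_eraseIdx_le l j
      simp only [List.length_cons] at hk
      omega

/-- The `i`-th index different from `j`. -/
def skip (j i : ℕ) : ℕ := if i < j then i else i + 1

/-- Both are signed sums over ordered pairs of distinct positions. Exchanging the two positions
changes the parity of `j + i`, because exactly one of the two is shifted by `skip`. -/
theorem sum_skip (m : ℕ) (H : ℕ → ℕ → S) :
    ∑ j ∈ Finset.range (m + 1), ∑ i ∈ Finset.range m, (-1) ^ (j + i) * H j (skip j i) =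
      -∑ j ∈ Finset.range (m + 1), ∑ i ∈ Finset.range m, (-1) ^ (j + i) * H (skip j i) j := by
  rw [← Finset.sum_product', ← Finset.sum_product', ← Finset.sum_neg_distrib]
  let f : ℕ × ℕ → ℕ × ℕ := fun a => if a.2 < a.1 then (a.2, a.1 - 1) else (a.2 + 1, a.1)
  have hf : ∀ a ∈ Finset.range (m + 1) ×ˢ Finset.range m,
      f a ∈ Finset.range (m + 1) ×ˢ Finset.range m := by
    rintro ⟨j, i⟩ h
    simp only [Finset.mem_product, Finset.mem_range] at h
    simp only [f]
    split_ifs <;> simp only [Finset.mem_product, Finset.mem_range] <;> omega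
  have hff : ∀ a ∈ Finset.range (m + 1) ×ˢ Finset.range m, f (f a) = a := by
    rintro ⟨j, i⟩ _
    by_cases h : i < j
    · simp only [f, if_pos h]
      rw [if_neg (by omega)]
      exact Prod.ext (by simp only; omega) rfl
    · simp only [f, if_neg h]
      rw [if_pos (by omega)]
      rfl
  refine Finset.sum_nbij' f f hf hf hff hff ?_
  rintro ⟨j, i⟩ _
  simp only [f]
  split_ifs with h
  · obtain ⟨k, rfl⟩ : ∃ k, j = k + 1 := ⟨j - 1, by omega⟩
    have h1 : skip (k + 1) i = i := if_pos h
    have h2 : skip i k = k + 1 := if_neg (by omega)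
    simp only [Nat.add_sub_cancel, h1, h2]
    ring
  · have h1 : skip j i = i + 1 := if_neg h
    have h2 : skip (i + 1) j = j := if_pos (by omega)
    simp only [h1, h2]
    ring

theorem getD_eraseIdx (l : List ℕ) (j i : ℕ) : (l.eraseIdx j).getD i 0 = l.getD (skip j i) 0 := by
  rw [List.getD_eq_getElem?_getD, List.getD_eq_getElem?_getD, List.getElem?_eraseIdx, skip]
  split_ifs <;> rfl

/-- Remove the entries in positions `u ≠ v` from a list. -/
def eraseTwo (l : List ℕ) (u v : ℕ) : List ℕ := (l.eraseIdx (max u v)).eraseIdx (min u v)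

theorem eraseTwo_comm (l : List ℕ) (u v : ℕ) : eraseTwo l u v = eraseTwo l v u := by
  rw [eraseTwo, eraseTwo, max_comm, min_comm]

theorem eraseIdx_eraseIdx_of_le {j i : ℕ} (h : j ≤ i) (l : List ℕ) :
    (l.eraseIdx j).eraseIdx i = (l.eraseIdx (i + 1)).eraseIdx j := by
  induction l generalizing i j with
  | nil => simp
  | cons a l ih =>
    cases j with
    | zero => simp
    | succ j =>
      obtain ⟨i, rfl⟩ : ∃ k, i = k + 1 := ⟨i - 1, by omega⟩
      simp [ih (show j ≤ i by omega)]

theorem eraseIdx_eraseIdx (l : List ℕ) (j i : ℕ) :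
    (l.eraseIdx j).eraseIdx i = eraseTwo l j (skip j i) := by
  rw [eraseTwo, skip]
  split_ifs with h
  · rw [max_eq_left h.le, min_eq_right h.le]
  · rw [max_eq_right (by omega), min_eq_left (by omega), eraseIdx_eraseIdx_of_le (by omega)]

/-- Expansion of a Pfaffian along the last column. -/
theorem pfaffian_append_singleton (a : ℕ → ℕ → S) (z : ℕ) (l : List ℕ) (hl : Odd l.length) :
    pfaffian a (l ++ [z]) = ∑ j ∈ Finset.range l.length,
      (-1) ^ j * a (l.getD j 0) z * pfaffian a (l.eraseIdx j) := by
  induction hk : l.length using Nat.strong_induction_on generalizing l with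
  | _ k ih =>
    cases l with
    | nil => simp at hl
    | cons h t =>
      have ht : Even t.length := by simpa [Nat.odd_add_one] using hl
      rw [← hk, List.cons_append, pfaffian_cons, List.length_append, List.length_singleton,
        List.length_cons, Finset.sum_range_succ, Finset.sum_range_succ']
      have h1 : (t ++ [z]).getD t.length 0 = z := by simp
      have h2 : (t ++ [z]).eraseIdx t.length = t := by
        simp [List.eraseIdx_append_of_length_le]
      rw [h1, h2, ht.neg_one_pow]
      simp only [List.getD_cons_zero, List.eraseIdx_cons_zero, pow_zero, List.getD_cons_succ,
        List.eraseIdx_cons_succ]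
      congr 1
      rcases ht' : t.length with _ | m
      · simp
      have hlen : ∀ j ∈ Finset.range (m + 1), (t.eraseIdx j).length = m := fun j hj => by
        rw [List.length_eraseIdx, if_pos (by rw [ht']; simpa using hj), ht', Nat.add_sub_cancel]
      have hm : Odd m := by rw [ht'] at ht; simpa [Nat.even_add_one] using ht
      have e1 : ∀ j ∈ Finset.range (m + 1), (-1) ^ j * a h ((t ++ [z]).getD j 0) *
          pfaffian a ((t ++ [z]).eraseIdx j) = ∑ i ∈ Finset.range m, (-1) ^ (j + i) *
            (a h (t.getD j 0) * a (t.getD (skip j i) 0) z *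
              pfaffian a (eraseTwo t j (skip j i))) := by
        intro j hj
        have hj' : j < t.length := by rw [ht']; simpa using hj
        rw [List.getD_append _ _ _ _ hj', List.eraseIdx_append_of_lt_length hj',
          ih m (by rw [← hk, List.length_cons]; omega) _ (by rw [hlen j hj]; exact hm) (hlen j hj),
          Finset.mul_sum]
        refine Finset.sum_congr rfl fun i _ => ?_
        rw [getD_eraseIdx, eraseIdx_eraseIdx, pow_add]
        ring
      have e2 : ∀ j ∈ Finset.range (m + 1), (-1) ^ (j + 1) * a (t.getD j 0) z *
          pfaffian a (h :: t.eraseIdx j) = -∑ i ∈ Finset.range m, (-1) ^ (j + i) *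
            (a h (t.getD (skip j i) 0) * a (t.getD j 0) z *
              pfaffian a (eraseTwo t (skip j i) j)) := by
        intro j hj
        rw [pfaffian_cons, hlen j hj, Finset.mul_sum, ← Finset.sum_neg_distrib]
        refine Finset.sum_congr rfl fun i _ => ?_
        rw [getD_eraseIdx, eraseIdx_eraseIdx, eraseTwo_comm, pow_add]
        ring
      rw [Finset.sum_congr rfl e1, Finset.sum_congr rfl e2, Finset.sum_neg_distrib]
      exact sum_skip m fun u v => a h (t.getD u 0) * a (t.getD v 0) z * pfaffian a (eraseTwo t u v)

/-- If the last column of `a` is `e`, then the expansion with coefficients `e` of the Pfaffian of a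
list that ends with the index of this column reduces to the last term. -/
theorem sum_pfaffian_eraseIdx_append [NoZeroDivisors S] [CharZero S] (a : ℕ → ℕ → S)
    (z : ℕ) (l : List ℕ) (hl : Even l.length) :
    ∑ j ∈ Finset.range (l ++ [z]).length,
      (-1) ^ j * a ((l ++ [z]).getD j 0) z * pfaffian a ((l ++ [z]).eraseIdx j) =
        a z z * pfaffian a l := by
  have h1 : (l ++ [z]).getD l.length 0 = z := by simp
  have h2 : (l ++ [z]).eraseIdx l.length = l := by simp [List.eraseIdx_append_of_length_le]
  rw [List.length_append, List.length_singleton, Finset.sum_range_succ, h1, h2, hl.neg_one_pow,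
    one_mul, add_eq_right]
  rcases hl' : l.length with _ | m
  · simp
  have hm : Odd m := by rw [hl'] at hl; simpa [Nat.even_add_one] using hl
  have e1 : ∀ j ∈ Finset.range (m + 1), (-1) ^ j * a ((l ++ [z]).getD j 0) z *
      pfaffian a ((l ++ [z]).eraseIdx j) = ∑ i ∈ Finset.range m, (-1) ^ (j + i) *
        (a (l.getD j 0) z * a (l.getD (skip j i) 0) z * pfaffian a (eraseTwo l j (skip j i))) := by
    intro j hj
    have hj' : j < l.length := by rw [hl']; simpa using hj
    have hlen : (l.eraseIdx j).length = m := by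
      rw [List.length_eraseIdx, if_pos hj', hl', Nat.add_sub_cancel]
    rw [List.getD_append _ _ _ _ hj', List.eraseIdx_append_of_lt_length hj',
      pfaffian_append_singleton _ _ _ (by rw [hlen]; exact hm), hlen, Finset.mul_sum]
    refine Finset.sum_congr rfl fun i _ => ?_
    rw [getD_eraseIdx, eraseIdx_eraseIdx, pow_add]
    ring
  rw [Finset.sum_congr rfl e1]
  have := sum_skip m fun u v => a (l.getD u 0) z * a (l.getD v 0) z * pfaffian a (eraseTwo l u v)
  simp only [eraseTwo_comm l (skip _ _), mul_comm (a (l.getD (skip _ _) 0) z)] at this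
  -- The summand is symmetric in the two positions, so the double sum is its own negative.
  exact self_eq_neg.1 this

end Pfaffian

/-! ### The staircase factorization and the degrees of `Q̃`-polynomials. -/

section QPolynomials

variable {S : Type*} [CommRing S]

/-- The expression `e_i e_j + 2 ∑ (-1)^k e_{i+k} e_{j-k}` in a sequence `e`. -/
def qPair (e : ℕ → S) (i j : ℕ) : S :=
  e i * e j + 2 * ∑ k ∈ Finset.Icc 1 j, (-1) ^ k * (e (i + k) * e (j - k))

theorem qPair_zero_right {e : ℕ → S} (h0 : e 0 = 1) (i : ℕ) : qPair e i 0 = e i := by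
  simp [qPair, h0]

theorem sort_Icc_succ (n : ℕ) :
    (Finset.Icc 1 (n + 1)).sort (· ≥ ·) = (n + 1) :: (Finset.Icc 1 n).sort (· ≥ ·) := by
  have h : Finset.Icc 1 (n + 1) = Finset.cons (n + 1) (Finset.Icc 1 n) (by simp) := by
    ext i; simp only [Finset.mem_Icc, Finset.mem_cons]; omega
  rw [h]
  apply Finset.sort_cons
  intro b hb
  have := Finset.mem_Icc.1 hb
  omega

/-- As `e` vanishes beyond `n + 1`, the first row has entries `e (n + 1) * e j`, and `e j = qPair e
j 0` is the entry of the column `0`. After `e (n + 1)` is taken out, the first-row expansion is an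
expansion along the column `0`. For odd `n` this is the Pfaffian of `(n, …, 1, 0)`. For even `n` the
column `0` is already in the list, and only its diagonal term, with `qPair e 0 0 = 1`, survives. -/
theorem pfaffian_qPair_staircase [NoZeroDivisors S] [CharZero S] {e : ℕ → S} (h0 : e 0 = 1)
    {n : ℕ} (he : ∀ i, n + 1 < i → e i = 0) :
    pfaffian (qPair e) (paddedParts (Finset.Icc 1 (n + 1))) =
      e (n + 1) * pfaffian (qPair e) (paddedParts (Finset.Icc 1 n)) := by
  have hlast : ∀ i, qPair e i 0 = e i := qPair_zero_right h0
  have hfirst : ∀ j, qPair e (n + 1) j = e (n + 1) * e j := fun j => by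
    rw [qPair, Finset.sum_eq_zero, mul_zero, add_zero]
    intro k hk
    rw [he _ (by have := (Finset.mem_Icc.1 hk).1; omega)]
    ring
  set l := (Finset.Icc 1 n).sort (· ≥ ·) with hl
  have hlen : l.length = n := by simp [l]
  have key : ∀ m : List ℕ, pfaffian (qPair e) ((n + 1) :: m) = e (n + 1) *
      ∑ j ∈ Finset.range m.length,
        (-1) ^ j * qPair e (m.getD j 0) 0 * pfaffian (qPair e) (m.eraseIdx j) := fun m => by
    rw [pfaffian_cons, Finset.mul_sum]
    refine Finset.sum_congr rfl fun j _ => ?_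
    rw [hfirst, hlast]
    ring
  simp only [paddedParts, Nat.card_Icc, Nat.add_sub_cancel, sort_Icc_succ, ← hl,
    List.cons_append, key]
  rcases Nat.even_or_odd n with hn | hn
  · have h1 : Odd (n + 1) := hn.add_one
    have h2 : ¬ Odd n := Nat.not_odd_iff_even.2 hn
    rw [if_pos h1, if_neg h2, sum_pfaffian_eraseIdx_append _ _ _ (by rw [hlen]; exact hn), hlast,
      h0, one_mul, List.append_nil]
  · have h1 : ¬ Odd (n + 1) := Nat.not_odd_iff_even.2 hn.add_one
    rw [if_neg h1, if_pos hn, List.append_nil,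
      pfaffian_append_singleton _ _ _ (by rw [hlen]; exact hn)]

theorem totalDegree_pfaffian_le {τ R : Type*} [CommRing R] {a : ℕ → ℕ → MvPolynomial τ R}
    (ha : ∀ i j, (a i j).totalDegree ≤ i + j) (l : List ℕ) :
    (pfaffian a l).totalDegree ≤ l.sum := by
  induction hk : l.length using Nat.strong_induction_on generalizing l with
  | _ k ih =>
    cases l with
    | nil => simp [pfaffian_nil]
    | cons h l =>
      rw [pfaffian_cons]
      refine totalDegree_finsetSum_le fun j hj => ?_
      have hj' : j < l.length := Finset.mem_range.1 hj
      have h1 : (pfaffian a (l.eraseIdx j)).totalDegree ≤ (l.eraseIdx j).sum :=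
        ih (l.eraseIdx j).length (by
          have := List.length_eraseIdx_le l j
          simp only [List.length_cons] at hk
          omega) _ rfl
      have h2 := ha h (l.getD j 0)
      have h3 : l.getD j 0 + (l.eraseIdx j).sum = l.sum := by
        rw [List.getD_eq_getElem _ _ hj']
        exact List.add_sum_eraseIdx hj' fun _ _ => AddCommute.all _ _
      have h4 : ((-1 : MvPolynomial τ R) ^ j).totalDegree = 0 := by
        rcases neg_one_pow_eq_or (MvPolynomial τ R) j with h | h <;> simp [h]
      have h5 := totalDegree_mul ((-1) ^ j * a h (l.getD j 0)) (pfaffian a (l.eraseIdx j))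
      have h6 := totalDegree_mul ((-1 : MvPolynomial τ R) ^ j) (a h (l.getD j 0))
      rw [List.sum_cons]
      omega

theorem totalDegree_Qtilde_le (n : ℕ) (R : Type*) [CommRing R] [Nontrivial R] (lam : Finset ℕ) :
    (Qtilde n R lam).totalDegree ≤ ∑ i ∈ lam, i := by
  have he : ∀ i, (esymm (Fin n) R i).totalDegree ≤ i := by
    intro i
    refine totalDegree_finsetSum_le fun t ht => (totalDegree_finsetProd _ _).trans ?_
    simp only [totalDegree_X, Finset.sum_const, smul_eq_mul, mul_one]
    exact (Finset.mem_powersetCard.1 ht).2.le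
  have hee : ∀ i j, (esymm (Fin n) R i * esymm (Fin n) R j).totalDegree ≤ i + j := fun i j =>
    (totalDegree_mul _ _).trans (add_le_add (he i) (he j))
  refine (totalDegree_pfaffian_le (fun i j => ?_) _).trans ?_
  · refine (totalDegree_add _ _).trans (max_le (hee i j) ((totalDegree_mul _ _).trans ?_))
    have h2 : (2 : MvPolynomial (Fin n) R).totalDegree = 0 := totalDegree_C (2 : R)
    rw [h2, zero_add]
    refine totalDegree_finsetSum_le fun k hk => ?_
    have hk := Finset.mem_Icc.1 hk
    refine (totalDegree_mul _ _).trans ?_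
    have h4 : ((-1 : MvPolynomial (Fin n) R) ^ k).totalDegree = 0 := by
      rcases neg_one_pow_eq_or (MvPolynomial (Fin n) R) k with h | h <;> simp [h]
    have := hee (i + k) (j - k)
    omega
  · apply le_of_eq
    have h1 : (lam.sort (· ≥ ·)).sum = ∑ i ∈ lam, i := by
      rw [← Multiset.sum_coe, Finset.sort_eq]
      rw [Finset.sum, Multiset.map_id']
    rw [paddedParts, List.sum_append, h1]
    split_ifs <;> simp

end QPolynomials

/-! ### Comparison with the polynomial divided differences, and their effect on degrees. -/

section Evaluation

variable {n : ℕ} {R K : Type*} [CommRing R] [Field K] [Algebra R K]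

/-- Evaluation of a polynomial in `X` and `Y`. -/
def ev (p y : ℕ → K) : PolyXY n R →ₐ[R] K :=
  aeval (Sum.elim (fun i : Fin n => p i) fun j : Fin n => y j)

theorem ev_x (p y : ℕ → K) (i : Fin n) : ev p y (x i : PolyXY n R) = p i := by simp [ev, x]

theorem ev_y (p z : ℕ → K) (i : Fin n) : ev p z (y i : PolyXY n R) = z i := by simp [ev, y]

/-- A polynomial as a function of the first group of variables. -/
def evFn (z : ℕ → K) (f : PolyXY n R) (p : GenPt K) : K := ev p z f

theorem ev_actS (p : GenPt K) (z : ℕ → K) (i : Fin (n - 1)) (f : PolyXY n R) :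
    ev p z (actS i f) = ev (GenPt.sw i p) z f := by
  suffices h : (ev p z).comp (actS i) = ev (n := n) (R := R) (GenPt.sw i p) z from
    DFunLike.congr_fun h f
  apply MvPolynomial.algHom_ext
  rintro (k | k)
  · simp only [AlgHom.comp_apply, actS, aeval_X, Sum.elim_inl, ev_x]
    simp only [ev, aeval_X, Sum.elim_inl, simpleA, GenPt.perm_apply]
    congr 1
    simp only [Equiv.swap_apply_def, lo, hi, Fin.ext_iff]
    grind
  · simp only [AlgHom.comp_apply, actS, aeval_X, Sum.elim_inr, ev_y]
    simp only [ev, aeval_X, Sum.elim_inr]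

theorem ev_actBox (p : GenPt K) (z : ℕ → K) (h : 2 ≤ n) (f : PolyXY n R) :
    ev p z (actBox h f) = ev (GenPt.neg0 (GenPt.sw 0 (GenPt.neg0 p))) z f := by
  suffices h : (ev p z).comp (actBox h) =
      ev (n := n) (R := R) (GenPt.neg0 (GenPt.sw 0 (GenPt.neg0 p))) z from
    DFunLike.congr_fun h f
  apply MvPolynomial.algHom_ext
  rintro (⟨k, hk⟩ | k)
  · simp only [AlgHom.comp_apply, actBox, aeval_X, Sum.elim_inl]
    rcases k with _ | _ | k
    · simp [ev, x]
    · simp [ev, x]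
    · have : Equiv.swap 0 1 (k + 2) = k + 2 := Equiv.swap_apply_of_ne_of_ne (by simp) (by simp)
      simp [ev, x, this]
  · simp only [AlgHom.comp_apply, actBox, aeval_X, Sum.elim_inr, ev_y]
    simp only [ev, aeval_X, Sum.elim_inr]

theorem opD_ev (z : ℕ → K) (g : GenD n) (f : PolyXY n R) :
    opD g (evFn z f) = evFn z (ddSigned g f) := by
  funext p
  cases g with
  | s i =>
    have h := congrArg (ev p z) (dd_spec i f)
    rw [map_sub, map_mul, map_sub, ev_x, ev_x, ev_actS] at h
    simp only [opD, opS, evFn, ddSigned, map_neg]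
    rw [div_eq_iff (p.sub_ne (by omega))]
    simp only [lo, hi] at h
    linear_combination -h
  | box h2 =>
    have h := congrArg (ev p z) (ddBox_spec h2 f)
    rw [map_sub, map_mul, map_add, ev_x, ev_x, ev_actBox] at h
    rw [opD, opBox]
    simp only [evFn, ddSigned]
    simp only at h
    rw [div_eq_iff (p.add_ne (by omega))]
    linear_combination h

theorem foldr_opD_ev (z : ℕ → K) (l : List (GenD n)) (f : PolyXY n R) :
    l.foldr opD (evFn z f) = evFn z (l.foldr ddSigned f) := by
  induction l with
  | nil => rfl
  | cons g l ih => rw [List.foldr_cons, ih, opD_ev, List.foldr_cons]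

theorem totalDegree_aeval_le {σ τ : Type*} {g : σ → MvPolynomial τ R}
    (hg : ∀ i, (g i).totalDegree ≤ 1) (f : MvPolynomial σ R) :
    (aeval g f).totalDegree ≤ f.totalDegree := by
  rw [aeval_def, eval₂_eq]
  refine totalDegree_finsetSum_le fun d hd => ?_
  refine (totalDegree_mul _ _).trans ?_
  rw [algebraMap_eq, totalDegree_C, zero_add]
  refine (totalDegree_finsetProd _ _).trans (le_trans ?_ (le_totalDegree hd))
  refine Finset.sum_le_sum fun i _ => (totalDegree_pow _ _).trans ?_
  simpa using Nat.mul_le_mul_left (d i) (hg i)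

theorem totalDegree_ddSigned [IsDomain R] (g : GenD n) (f : PolyXY n R) (hne : ddSigned g f ≠ 0) :
    (ddSigned g f).totalDegree + 1 ≤ f.totalDegree := by
  have key : ∀ d e f' : PolyXY n R, d.IsHomogeneous 1 → d ≠ 0 →
      f'.totalDegree ≤ f.totalDegree → f - f' = d * e → e ≠ 0 →
      e.totalDegree + 1 ≤ f.totalDegree := by
    intro d e f' hd hd0 hf' h he
    have h1 := totalDegree_mul_of_isDomain hd0 he
    rw [hd.totalDegree hd0, ← h] at h1
    have h2 := totalDegree_sub f f'
    rw [max_eq_left hf'] at h2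
    omega
  cases g with
  | s i =>
    simp only [ddSigned, totalDegree_neg]
    refine key _ _ _ ((isHomogeneous_X _ _).sub (isHomogeneous_X _ _)) ?_ ?_ (dd_spec i f)
      (neg_ne_zero.1 hne)
    · exact sub_ne_zero.2 fun e => lo_ne_hi i (Sum.inl_injective (X_injective e))
    · refine totalDegree_aeval_le ?_ f
      rintro (k | k) <;> simp [x, y]
  | box h2 =>
    refine key _ _ _ ((isHomogeneous_X _ _).add (isHomogeneous_X _ _)) ?_ ?_ (ddBox_spec h2 f) hne
    · intro h
      have h1 := congrArg
        (eval (Sum.elim (fun k : Fin n => if (k : ℕ) = 0 then (1 : R) else 0) 0)) h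
      simp at h1
    · refine totalDegree_aeval_le ?_ f
      rintro (k | k)
      · simp only [Sum.elim_inl]
        split_ifs <;> simp [x]
      · simp [y]

theorem totalDegree_foldr_ddSigned [IsDomain R] (l : List (GenD n)) (f : PolyXY n R)
    (hne : l.foldr ddSigned f ≠ 0) :
    (l.foldr ddSigned f).totalDegree + l.length ≤ f.totalDegree := by
  induction l with
  | nil => simp
  | cons g l ih =>
    rw [List.foldr_cons] at hne ⊢
    have h1 := totalDegree_ddSigned g _ hne
    have h2 := ih fun h => by
      rw [h] at h1
      simp at h1
    rw [List.length_cons]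
    omega

end Evaluation

/-! ### `theta` and `psi` on symmetric polynomials. -/

section Theta

variable {n : ℕ} {K : Type*} [Field K]

theorem theta_eq_psi {φ : GenPt K → K} (hφ : SymmOn n φ) (p : GenPt K) :
    theta n φ p = psi n φ p := by
  -- With `e = 0` and `y = -1`, every factor of `upperProd` is `1` and every factor of `lowerProd`
  -- is `-1`, which cancels the sign.
  have h := theta_upperProd 0 n (fun _ => -1) hφ p
  have h1 : (fun q => upperProd 0 (fun _ => (-1 : K)) n q * φ q) = φ := by
    funext q
    simp [upperProd]
  rw [h1] at h
  rw [h, lowerProd]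
  simp only [zero_mul, zero_add, Finset.prod_const, Finset.card_range]
  rw [Finset.prod_pow_eq_pow_sum, ← mul_pow]
  simp

theorem opW_evFn {R : Type*} [CommRing R] [Algebra R K] (z : ℕ → K) (w : WeylD n)
    (f : PolyXY n R) : opW w (evFn z f) = evFn z (ddWeylD w f) :=
  foldr_opD_ev z _ f

theorem psi_evFn {R : Type*} [CommRing R] [Algebra R K] {f : PolyXY n R} {z : ℕ → K}
    (hf : SymmOn n (evFn z f)) (p : GenPt K) :
    psi n (evFn z f) p = ∑ w ∈ revSet n n le_rfl, ev p z (ddWeylD w f) := by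
  rw [← theta_eq_psi hf, (theta_eq_sum n le_rfl).2, Finset.sum_apply]
  exact Finset.sum_congr rfl fun w _ => congrFun (opW_evFn z w f) p

theorem totalDegree_ddWeylD {R : Type*} [CommRing R] [IsDomain R] {w : WeylD n}
    (hw : w ∈ revSet n n le_rfl) (f : PolyXY n R) (hne : ddWeylD w f ≠ 0) :
    2 * (ddWeylD w f).totalDegree + n * (n - 1) ≤ 2 * f.totalDegree := by
  have h1 := totalDegree_foldr_ddSigned (reducedWordD w) f hne
  have h2 := (theta_eq_sum (K := ℚ) n le_rfl).1 w hw
  rw [(isReducedWord_iff_lengthD.1 (isReducedWord_reducedWordD w)).2] at h1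
  have h3 : (ddWeylD w f).totalDegree + lengthD w ≤ f.totalDegree := h1
  omega

/-- `psi` is here a sum of compositions of `n(n-1)/2` divided differences, each of which lowers the
degree. -/
theorem psi_evFn_eq_zero {R : Type*} [CommRing R] [IsDomain R] [Algebra R K] {f : PolyXY n R}
    {z : ℕ → K} (hf : SymmOn n (evFn z f)) (hdeg : 2 * f.totalDegree < n * (n - 1))
    (p : GenPt K) : psi n (evFn z f) p = 0 := by
  rw [psi_evFn hf]
  refine Finset.sum_eq_zero fun w hw => ?_
  by_contra h
  have := totalDegree_ddWeylD hw f fun h0 => h (by rw [h0, map_zero])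
  omega

theorem psi_evFn_eq {R : Type*} [CommRing R] [IsDomain R] [Algebra R K] {f : PolyXY n R}
    {z : ℕ → K} (hf : SymmOn n (evFn z f)) (hdeg : 2 * f.totalDegree ≤ n * (n - 1))
    (p q : GenPt K) : psi n (evFn z f) p = psi n (evFn z f) q := by
  rw [psi_evFn hf, psi_evFn hf]
  refine Finset.sum_congr rfl fun w hw => ?_
  by_cases h : ddWeylD w f = 0
  · rw [h, map_zero, map_zero]
  · have := totalDegree_ddWeylD hw f h
    rw [totalDegree_eq_zero_iff_eq_C.1 (show (ddWeylD w f).totalDegree = 0 by omega)]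
    simp [ev]

end Theta

/-! ### The value of `psi` on the kernel. -/

section Kernel

variable {K : Type*} [Field K]

/-- The elementary symmetric polynomials of the first `n` coordinates. -/
def elemSymm (n : ℕ) (p : ℕ → K) : ℕ → K := ((Finset.range n).val.map p).esymm

/-- The value of `Q̃_λ` at the first `n` coordinates. -/
def qValue (n : ℕ) (lam : Finset ℕ) (p : ℕ → K) : K :=
  pfaffian (qPair (elemSymm n p)) (paddedParts lam)

theorem aeval_Qtilde {n : ℕ} {R : Type*} [CommRing R] [Algebra R K] (p : ℕ → K) (lam : Finset ℕ) :
    aeval (fun i : Fin n => p i) (Qtilde n R lam) = qValue n lam p := by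
  have he : ∀ i, aeval (fun i : Fin n => p i) (esymm (Fin n) R i) = elemSymm n p i := by
    intro i
    rw [aeval_esymm_eq_multiset_esymm, elemSymm]
    congr 1
    have h : Finset.range n = Finset.univ.map (Fin.valEmbedding (n := n)) := by
      ext i
      simp only [Finset.mem_range, Finset.mem_map, Finset.mem_univ, true_and,
        Fin.valEmbedding_apply]
      exact ⟨fun h => ⟨⟨i, h⟩, rfl⟩, fun ⟨j, h⟩ => h ▸ j.2⟩
    rw [h, Finset.map_val, Multiset.map_map]
    rfl
  rw [qValue, Qtilde]
  refine (map_pfaffian (aeval fun i : Fin n => p i :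
    MvPolynomial (Fin n) R →ₐ[R] K).toRingHom _ _).trans ?_
  congr 1
  funext i j
  simp only [AlgHom.toRingHom_eq_coe, RingHom.coe_coe, Qtilde₂, qPair, map_add, map_mul, map_sum,
    map_pow, map_neg, map_one, map_ofNat, he]

theorem ev_rename_inl_Qtilde {n : ℕ} {R : Type*} [CommRing R] [Algebra R K] (p z : ℕ → K)
    (lam : Finset ℕ) : ev p z (rename Sum.inl (Qtilde n R lam)) = qValue n lam p := by
  rw [ev, aeval_rename, ← aeval_Qtilde (R := R)]
  rfl

theorem ev_rename_inr_Qtilde {n : ℕ} {R : Type*} [CommRing R] [Algebra R K] (p z : ℕ → K)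
    (lam : Finset ℕ) : ev p z (rename Sum.inr (Qtilde n R lam)) = qValue n lam z := by
  rw [ev, aeval_rename, ← aeval_Qtilde (R := R)]
  rfl

theorem elemSymm_zero (n : ℕ) (p : ℕ → K) : elemSymm n p 0 = 1 := by
  simp [elemSymm, Multiset.esymm]

theorem elemSymm_self (n : ℕ) (p : ℕ → K) : elemSymm n p n = ∏ i ∈ Finset.range n, p i := by
  rw [elemSymm, Finset.esymm_map_val]
  have h := Finset.powersetCard_self (Finset.range n)
  rw [Finset.card_range] at h
  rw [h, Finset.sum_singleton]

theorem elemSymm_of_lt {n i : ℕ} (h : n < i) (p : ℕ → K) : elemSymm n p i = 0 := by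
  rw [elemSymm, Finset.esymm_map_val, Finset.powersetCard_eq_empty.2 (by simpa using h),
    Finset.sum_empty]

theorem elemSymm_succ {n : ℕ} {p : ℕ → K} (h : p n = 0) : elemSymm (n + 1) p = elemSymm n p := by
  funext i
  rw [elemSymm, elemSymm, Finset.range_add_one, Finset.insert_val_of_notMem (by simp),
    Multiset.map_cons, h]
  cases i with
  | zero => simp [Multiset.esymm]
  | succ i => simp [Multiset.esymm, Multiset.map_map]

theorem symmOn_qValue (n : ℕ) (lam : Finset ℕ) :
    SymmOn n fun p : GenPt K => qValue n lam p := by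
  intro a b ha hb p
  have h : elemSymm n (GenPt.perm (Equiv.swap a b) p) = elemSymm n p := by
    have h1 : (Finset.range n).map (Equiv.swap a b).toEmbedding = Finset.range n := by
      ext i
      simp only [Finset.mem_map_equiv, Equiv.symm_swap, Finset.mem_range, Equiv.swap_apply_def]
      split_ifs <;> omega
    funext i
    conv_rhs => rw [elemSymm, ← h1, Finset.map_val, Multiset.map_map]
    rfl
  simp only [qValue, h]

theorem qValue_staircase [CharZero K] {n : ℕ} {p : ℕ → K} (h : p (n + 1) = 0) :
    qValue (n + 2) (Finset.Icc 1 (n + 1)) p =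
      (∏ i ∈ Finset.range (n + 1), p i) * qValue (n + 1) (Finset.Icc 1 n) p := by
  rw [qValue, qValue, elemSymm_succ h, ← elemSymm_self]
  exact pfaffian_qPair_staircase (elemSymm_zero _ _) fun i hi => elemSymm_of_lt hi p

theorem evFn_Qtilde {n : ℕ} (lam : Finset ℕ) :
    (fun p : GenPt K => qValue n lam p) = evFn 0 (rename Sum.inl (Qtilde n ℤ lam)) := by
  funext p
  rw [evFn, ev_rename_inl_Qtilde]

theorem totalDegree_rename_Qtilde_le {n : ℕ} (lam : Finset ℕ) :
    (rename (Sum.inl : Fin n → Fin n ⊕ Fin n) (Qtilde n ℤ lam)).totalDegree ≤ ∑ i ∈ lam, i :=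
  (totalDegree_rename_le _ _).trans (totalDegree_Qtilde_le n ℤ lam)

theorem two_mul_sum_Icc (k : ℕ) : 2 * ∑ i ∈ Finset.Icc 1 k, i = (k + 1) * k := by
  induction k with
  | zero => simp
  | succ k ih =>
    rw [Finset.sum_Icc_succ_top (by omega), mul_add, ih]
    ring

/-- A generic point with vanishing coordinate `n`. -/
def vanishingPt [CharZero K] (n : ℕ) : GenPt K :=
  ⟨fun i => ((if i = n then 0 else i + 1 : ℕ) : K), fun i j h => by
    constructor
    · rw [sub_ne_zero]
      intro e
      have := Nat.cast_injective e
      split_ifs at this <;> omega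
    · intro e
      have : ((if i = n then 0 else i + 1) + (if j = n then 0 else j + 1) : ℕ) = 0 := by
        exact_mod_cast e
      split_ifs at this
      omega⟩

/-- The degree of the staircase polynomial is exactly the drop in degree, so the result is constant
and may be computed where the last coordinate is `0`. There the factor `∏ p i` of `qValue_staircase`
cancels the new factors of `pairProd`, and the sign of the zero coordinate is free, which doubles
the value. -/
theorem psi_qValue_staircase [CharZero K] (n : ℕ) (p : GenPt K) :
    psi (n + 1) (fun q => qValue (n + 1) (Finset.Icc 1 n) q) p = 2 ^ n := by
  induction n generalizing p with
  | zero =>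
    rw [← theta_eq_psi (symmOn_qValue _ _)]
    simp [theta, qValue, paddedParts, pfaffian_nil]
  | succ n ih =>
    have hsymm := symmOn_qValue (K := K) (n + 2) (Finset.Icc 1 (n + 1))
    rw [evFn_Qtilde] at hsymm
    have hconst : psi (n + 2) (fun q => qValue (n + 2) (Finset.Icc 1 (n + 1)) q) p =
        psi (n + 2) (fun q => qValue (n + 2) (Finset.Icc 1 (n + 1)) q)
          (vanishingPt (K := K) (n + 1)) := by
      rw [evFn_Qtilde]
      refine psi_evFn_eq hsymm ?_ _ _
      have h1 := totalDegree_rename_Qtilde_le (n := n + 2) (Finset.Icc 1 (n + 1))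
      have h2 := two_mul_sum_Icc (n + 1)
      rw [show n + 1 + 1 = n + 2 from rfl] at h2
      rw [show n + 2 - 1 = n + 1 by omega]
      omega
    rw [hconst, psi, Finset.range_add_one, signSum_insert (by simp)]
    have h0 : vanishingPt (K := K) (n + 1) (n + 1) = 0 := by simp [vanishingPt]
    have hflip : GenPt.flip {n + 1} (vanishingPt (K := K) (n + 1)) = vanishingPt (n + 1) := by
      ext i
      by_cases h : i = n + 1
      · subst h; simp [h0]
      · simp [h]
    have hF : ∀ s, signSum (Finset.range (n + 1)) s
        (fun q => qValue (n + 2) (Finset.Icc 1 (n + 1)) q /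
          pairProd (insert (n + 1) (Finset.range (n + 1))) q) (vanishingPt (K := K) (n + 1)) =
        signSum (Finset.range (n + 1)) s (fun q => qValue (n + 1) (Finset.Icc 1 n) q /
          pairProd (Finset.range (n + 1)) q) (vanishingPt (n + 1)) := by
      intro s
      refine signSum_congr fun N hN => ?_
      have hq : GenPt.flip N (vanishingPt (K := K) (n + 1)) (n + 1) = 0 := by
        rw [GenPt.flip_apply, h0]
        simp
      rw [qValue_staircase hq, pairProd_insert (by simp), hq]
      simp only [zero_add]
      have hne : ∏ i ∈ Finset.range (n + 1), GenPt.flip N (vanishingPt (K := K) (n + 1)) i ≠ 0 := by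
        refine Finset.prod_ne_zero_iff.2 fun i hi => ?_
        have hi := Finset.mem_range.1 hi
        have := (GenPt.flip N (vanishingPt (K := K) (n + 1))).add_ne (show i ≠ n + 1 by omega)
        rwa [hq, add_zero] at this
      have := pairProd_ne_zero (Finset.range (n + 1)) (GenPt.flip N (vanishingPt (K := K) (n + 1)))
      field_simp
    -- The odd sign sum is the even one at the point with coordinate `0` negated, so the induction
    -- hypothesis gives `2 ^ n` for both.
    rw [hflip, hF, hF, ← signSum_flip (o := 0) (by simp)]
    have e1 := ih (vanishingPt (K := K) (n + 1))
    have e2 := ih (GenPt.flip {0} (vanishingPt (K := K) (n + 1)))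
    rw [psi] at e1 e2
    rw [e1, e2]
    ring

theorem psi_qValue_of_ne [CharZero K] {n : ℕ} {lam : Finset ℕ} (h : lam ⊆ Finset.Icc 1 n)
    (hne : lam ≠ Finset.Icc 1 n) (p : GenPt K) :
    psi (n + 1) (fun q => qValue (n + 1) lam q) p = 0 := by
  have hsymm := symmOn_qValue (K := K) (n + 1) lam
  rw [evFn_Qtilde] at hsymm ⊢
  refine psi_evFn_eq_zero hsymm ?_ p
  have h1 := totalDegree_rename_Qtilde_le (n := n + 1) lam
  have h2 := two_mul_sum_Icc n
  obtain ⟨a, ha, ha'⟩ := Finset.exists_of_ssubset (h.ssubset_of_ne hne)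
  have h3 : ∑ i ∈ lam, i < ∑ i ∈ Finset.Icc 1 n, i :=
    Finset.sum_lt_sum_of_subset h ha ha' (Finset.mem_Icc.1 ha).1 fun _ _ _ => Nat.zero_le _
  rw [Nat.add_sub_cancel]
  omega

theorem psi_sum {ι : Type*} (n : ℕ) (s : Finset ι) (c : ι → K) (φ : ι → GenPt K → K)
    (p : GenPt K) :
    psi n (fun q => ∑ i ∈ s, c i * φ i q) p = ∑ i ∈ s, c i * psi n (φ i) p := by
  simp only [psi, signSum, Finset.sum_div, Finset.mul_sum, mul_div_assoc]
  rw [Finset.sum_comm]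

variable [Algebra ZHalf K]

theorem ev_Ptilde_inl {n : ℕ} (p z : ℕ → K) (lam : Finset ℕ) :
    ev p z (rename Sum.inl (Ptilde n lam)) =
      algebraMap ZHalf K (IsLocalization.Away.invSelf (2 : ℤ)) ^ lam.card * qValue n lam p := by
  rw [Ptilde, map_mul, map_mul, ev_rename_inl_Qtilde, rename_C, ev, aeval_C, map_pow]

theorem ev_Ptilde_inr {n : ℕ} (p z : ℕ → K) (lam : Finset ℕ) :
    ev p z (rename Sum.inr (Ptilde n lam)) =
      algebraMap ZHalf K (IsLocalization.Away.invSelf (2 : ℤ)) ^ lam.card * qValue n lam z := by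
  rw [Ptilde, map_mul, map_mul, ev_rename_inr_Qtilde, rename_C, ev, aeval_C, map_pow]

theorem evFn_kernelP (n k : ℕ) (z : ℕ → K) :
    evFn z (kernelP n k) = fun p : GenPt K => ∑ lam ∈ strictPartitions k,
      (algebraMap ZHalf K (IsLocalization.Away.invSelf (2 : ℤ)) ^ lam.card *
        ev (n := n) 0 z (rename Sum.inr (Ptilde n (Finset.Icc 1 k \ lam)))) * qValue n lam p := by
  funext p
  rw [evFn, kernelP, map_sum]
  refine Finset.sum_congr rfl fun lam _ => ?_
  rw [map_mul, ev_Ptilde_inl, ev_Ptilde_inr, ev_Ptilde_inr]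
  ring

theorem symmOn_evFn_kernelP (n k : ℕ) (z : ℕ → K) :
    SymmOn n (evFn z (kernelP n k) : GenPt K → K) := by
  intro a b ha hb p
  rw [evFn_kernelP]
  exact Finset.sum_congr rfl fun lam _ => congrArg _ (symmOn_qValue n lam a b ha hb p)

theorem psi_evFn_kernelP [CharZero K] (n : ℕ) (z : ℕ → K) (p : GenPt K) :
    psi n (evFn z (kernelP n (n - 1))) p = 1 := by
  rcases n with _ | n
  · rw [← theta_eq_psi (symmOn_evFn_kernelP _ _ _), evFn_kernelP]
    simp [theta, strictPartitions, ev_Ptilde_inr, qValue, paddedParts, pfaffian_nil]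
  have h2 : (2 : K) * algebraMap ZHalf K (IsLocalization.Away.invSelf (2 : ℤ)) = 1 := by
    have h := congrArg (algebraMap ZHalf K) (IsLocalization.Away.mul_invSelf (S := ZHalf) (2 : ℤ))
    rw [map_mul, map_one] at h
    simpa [map_ofNat] using h
  rw [Nat.add_sub_cancel, evFn_kernelP, psi_sum, Finset.sum_eq_single (Finset.Icc 1 n)]
  · rw [psi_qValue_staircase, ev_Ptilde_inr, Finset.sdiff_self]
    simp only [Nat.card_Icc, Nat.add_sub_cancel, Finset.card_empty, pow_zero, one_mul]
    -- The power of `1/2` in `P̃` of the staircase cancels `2 ^ n`; the complementary partition is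
    -- empty and contributes `1`.
    rw [mul_right_comm, ← mul_pow, mul_comm _ (2 : K), h2]
    simp [qValue, paddedParts, pfaffian_nil]
  · intro lam hlam hne
    rw [psi_qValue_of_ne (Finset.mem_powerset.1 hlam) hne, mul_zero]
  · intro h
    exact absurd (Finset.mem_powerset.2 (Finset.Subset.refl _)) h

end Kernel

/-! ### The right-hand side as a function of `X`, and its recursion. -/

section TypeA

variable {n : ℕ} {K : Type*} [Field K]

theorem isReducedWord_reducedWordA (σ : Equiv.Perm (Fin n)) :
    IsReducedWord (simpleA n) σ (reducedWordA σ) :=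
  (exists_isReducedWord (exists_wordA σ)).choose_spec

theorem opS_const_mul (i : ℕ) (c : K) (φ : GenPt K → K) :
    opS i (fun p => c * φ p) = fun p => c * opS i φ p := by
  funext p
  simp only [opS]
  ring

section

variable {R : Type*} [CommRing R] [Algebra R K]

theorem evFn_foldr_dd (z : ℕ → K) (l : List (Fin (n - 1))) (f : PolyXY n R) :
    evFn z (l.foldr dd f) =
      fun p => (-1) ^ l.length * (l.map GenD.s).foldr opD (evFn z f) p := by
  induction l with
  | nil => simp
  | cons i l ih =>
    have h : evFn z (dd i (l.foldr dd f)) = fun p => -1 * opS i (evFn z (l.foldr dd f)) p := by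
      funext p
      have := congrFun (opD_ev z (.s i) (l.foldr dd f)) p
      simp only [opD] at this
      rw [this, evFn, evFn, ddSigned, map_neg, neg_one_mul, neg_neg]
    rw [List.foldr_cons, h, ih, opS_const_mul]
    funext p
    rw [List.length_cons, pow_succ', mul_assoc]
    rfl

theorem evFn_ddPerm (z : ℕ → K) (σ : Equiv.Perm (Fin n)) (f : PolyXY n R) :
    evFn z (ddPerm σ f) = fun p => (-1) ^ lengthD (permD σ) * opW (permD σ) (evFn z f) p := by
  have h := isReducedWord_map_s (isReducedWord_reducedWordA σ)
  have hl := (isReducedWord_iff_lengthD.1 h).2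
  rw [List.length_map] at hl
  rw [ddPerm, evFn_foldr_dd, hl, opW_eq h]

theorem evFn_ddPerm_simpleA_mul (z : ℕ → K) {τ : Equiv.Perm (Fin n)} {j : Fin (n - 1)}
    (h : τ⁻¹ (lo j) < τ⁻¹ (hi j)) (f : PolyXY n R) :
    evFn z (ddPerm (simpleA n j * τ) f) = fun p => -opS j (evFn z (ddPerm τ f)) p := by
  have hmul : permD (simpleA n j * τ) = refl (.s j) * permD τ := by
    apply Subtype.ext
    simp [permD, simpleD, map_mul]
  have hinv : (permD τ)⁻¹ = permD τ⁻¹ := by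
    apply Subtype.ext
    simp [permD]
  have hl : lengthD (refl (.s j) * permD τ) = lengthD (permD τ) + 1 := by
    rw [lengthD_refl_mul, ← lengthD_inv (permD τ), hinv]
    refine (lengthD_mul_refl (permD τ⁻¹) (.s j)).2 fun hd => ?_
    exact absurd ((isDescent_permD _ _).1 hd) (not_lt.2 h.le)
  have hop : opS j (opW (permD τ) (evFn z f)) = opW (refl (.s j) * permD τ) (evFn z f) :=
    opD_opW_of_lt hl _
  rw [evFn_ddPerm, evFn_ddPerm, opS_const_mul, hop, hmul, hl]
  funext p
  ring

theorem ddPerm_one (f : PolyXY n R) : ddPerm 1 f = f := by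
  have h := (isReducedWord_reducedWordA (1 : Equiv.Perm (Fin n))).2 [] rfl
  rw [ddPerm, List.length_eq_zero_iff.1 (Nat.le_zero.1 h)]
  rfl

theorem ev_Delta (p z : ℕ → K) (P : GenPt K) (hP : P.val = p) :
    ev p z (Delta n R) = upperProd 1 z n P := by
  subst hP
  rw [Delta, map_prod, upperProd,
    ← Fin.prod_univ_eq_prod_range (fun i => ∏ j ∈ Finset.range (n - 1 - i), (1 * P i - z j))]
  refine Finset.prod_congr rfl fun i _ => ?_
  rw [map_prod]
  have h : ∀ j : Fin n, ev P z (if (i + 1 : ℕ) + (j + 1) ≤ n then x i - y j else (1 : PolyXY n R)) =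
      if (i + 1 : ℕ) + ((j : ℕ) + 1) ≤ n then 1 * P i - z j else 1 := by
    intro j
    split_ifs
    · rw [map_sub, ev_x, ev_y, one_mul]
    · rw [map_one]
  rw [Finset.prod_congr rfl fun j _ => h j,
    Fin.prod_univ_eq_prod_range (fun j => if (i + 1 : ℕ) + (j + 1) ≤ n then 1 * P i - z j else 1),
    ← Finset.prod_filter]
  refine Finset.prod_congr ?_ fun _ _ => rfl
  ext j
  simp only [Finset.mem_filter, Finset.mem_range]
  omega

end

/-- The permutation of `ℕ` that reverses `{0, …, n - 1}`. -/
def revNat (n : ℕ) : Equiv.Perm ℕ :=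
  Function.Involutive.toPerm (fun i => if i < n then n - 1 - i else i) fun i => by
    simp only
    split_ifs <;> omega

theorem revNat_apply (n i : ℕ) : revNat n i = if i < n then n - 1 - i else i := rfl

/-- Reverse the first `n` coordinates. -/
abbrev revPt (n : ℕ) (p : GenPt K) : GenPt K := GenPt.perm (revNat n) p

theorem sw_revPt {i : ℕ} (h : i + 1 < n) (p : GenPt K) :
    GenPt.sw (n - 2 - i) (revPt n p) = revPt n (GenPt.sw i p) := by
  ext k
  simp only [GenPt.perm_apply, revNat_apply, Equiv.swap_apply_def]
  congr 1
  grind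

theorem upperProd_revPt (z : ℕ → K) (p : GenPt K) :
    upperProd 1 (-z) n (revPt n p) = lowerProd 1 z n p := by
  rw [upperProd, lowerProd, ← Finset.prod_range_reflect]
  refine Finset.prod_congr rfl fun a ha => ?_
  have ha := Finset.mem_range.1 ha
  have h1 : revNat n (n - 1 - a) = a := by
    rw [revNat_apply, if_pos (by omega)]
    omega
  rw [show n - 1 - (n - 1 - a) = a by omega]
  refine Finset.prod_congr rfl fun b _ => ?_
  rw [GenPt.perm_apply, h1, Pi.neg_apply, sub_neg_eq_add]

theorem longA_mul_self (n : ℕ) : longA n * longA n = 1 := by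
  ext i
  simp [longA]

theorem star_inv_mul_longA (σ : Equiv.Perm (Fin n)) : (star σ)⁻¹ * longA n = longA n * σ⁻¹ := by
  have h : (longA n)⁻¹ = longA n := inv_eq_of_mul_eq_one_left (longA_mul_self n)
  rw [star, mul_inv_rev, mul_inv_rev, h, mul_assoc, mul_assoc, longA_mul_self, mul_one]

/-- The function `𝔖_{σ^*}(ϖ₀ X, -Y)`. -/
def schubertFn (z : ℕ → K) (σ : Equiv.Perm (Fin n)) (p : GenPt K) : K :=
  evFn (-z) (schubertA (star σ)) (revPt n p)

theorem schubertFn_longA (z : ℕ → K) (p : GenPt K) :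
    schubertFn z (longA n) p = lowerProd 1 z n p := by
  rw [schubertFn, schubertA, star_inv_mul_longA, mul_inv_cancel, ddPerm_one, evFn,
    ev_Delta _ _ (revPt n p) rfl, upperProd_revPt]

/-- Reversing the variables conjugates each adjacent transposition to its mirror image and reverses
the sign of its root. So the mirror divided difference, applied before the reversal, becomes `-∂_i`.
-/
theorem opS_schubertFn (z : ℕ → K) {σ : Equiv.Perm (Fin n)} {i : Fin (n - 1)}
    (h : σ (hi i) < σ (lo i)) : opS i (schubertFn z σ) = schubertFn z (σ * simpleA n i) := by
  have hi2 := i.2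
  let j : Fin (n - 1) := ⟨n - 2 - i, by omega⟩
  have hlo : longA n (lo j) = hi i := by
    apply Fin.ext
    simp only [longA, Fin.revPerm_apply, Fin.val_rev, lo, hi, j]
    omega
  have hhi : longA n (hi j) = lo i := by
    apply Fin.ext
    simp only [longA, Fin.revPerm_apply, Fin.val_rev, lo, hi, j]
    omega
  have hlong : (longA n)⁻¹ = longA n := inv_eq_of_mul_eq_one_left (longA_mul_self n)
  have hconj : longA n * simpleA n i = simpleA n j * longA n := by
    rw [simpleA, simpleA, ← hlo, ← hhi, Equiv.swap_comm,
      Equiv.swap_apply_apply, hlong, ← mul_assoc, ← mul_assoc, longA_mul_self, one_mul]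
  have hw : (star (σ * simpleA n i))⁻¹ * longA n = simpleA n j * ((star σ)⁻¹ * longA n) := by
    have hs : (simpleA n i)⁻¹ = simpleA n i := Equiv.swap_inv _ _
    rw [star_inv_mul_longA, star_inv_mul_longA, mul_inv_rev, hs, ← mul_assoc, hconj, mul_assoc]
  funext p
  rw [schubertFn, schubertA, hw, evFn_ddPerm_simpleA_mul]
  · have h1 : revNat n (n - 2 - i) = i + 1 := by
      rw [revNat_apply, if_pos (by omega)]
      omega
    have h2 : revNat n (n - 2 - i + 1) = i := by
      rw [revNat_apply, if_pos (by omega)]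
      omega
    simp only [opS, schubertFn, ← sw_revPt (show (i : ℕ) + 1 < n by omega), j]
    rw [GenPt.perm_apply, GenPt.perm_apply, h1, h2, ← div_neg, neg_sub]
    rfl
  · rw [star_inv_mul_longA, mul_inv_rev, inv_inv, hlong, Equiv.Perm.mul_apply,
      Equiv.Perm.mul_apply, hlo, hhi]
    exact h

theorem ev_schubertAAt {R : Type*} [CommRing R] [Algebra R K] (p : GenPt K) (z : ℕ → K)
    (σ : Equiv.Perm (Fin n)) :
    ev p z (schubertAAt (star σ) (fun i => (x (longA n i) : PolyXY n R)) fun j => -y j) =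
      schubertFn z σ p := by
  rw [schubertAAt, ← AlgHom.coe_toRingHom, hom_eval₂, schubertFn, evFn]
  conv_rhs => rw [ev, aeval_def]
  congr 1
  · exact RingHom.ext_int _ _
  · funext k
    rcases k with k | k
    · simp only [Sum.elim_inl, AlgHom.coe_toRingHom, GenPt.perm_apply,
        revNat_apply, if_pos k.2]
      rw [ev_x, longA, Fin.revPerm_apply, Fin.val_rev]
      congr 1
      omega
    · simp only [Sum.elim_inr, AlgHom.coe_toRingHom, Pi.neg_apply, map_neg,
        ev_y]

end TypeA

/-! ### Conclusion: the two recursions agree, and evaluation at independent variables is injective.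
-/

section Main

variable {n : ℕ} {K : Type*} [Field K] [Algebra ZHalf K]

theorem ev_schubertD (p : GenPt K) (z : ℕ → K) (σ : Equiv.Perm (Fin n)) :
    ev p z (∑ w ∈ lengthCoset σ, schubertD w) = (-1) ^ (n * (n - 1) / 2) *
      opCoset σ (evFn z (Delta n ZHalf * kernelP n (n - 1))) p := by
  rw [map_sum, opCoset, Finset.sum_apply, Finset.mul_sum]
  refine Finset.sum_congr rfl fun w _ => ?_
  rw [opW_evFn, schubertD, map_mul, map_pow, map_neg, map_one, evFn]

theorem ev_sum_schubertD [CharZero K] (p : GenPt K) (z : ℕ → K) (σ : Equiv.Perm (Fin n)) :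
    ev p z (∑ w ∈ lengthCoset σ, schubertD w) = schubertFn z σ p := by
  rw [ev_schubertD]
  set φ : GenPt K → K := evFn z (Delta n ZHalf * kernelP n (n - 1)) with hφ
  suffices h : (fun p => (-1) ^ (n * (n - 1) / 2) * opCoset σ φ p) = schubertFn z σ from
    congrFun h p
  refine eq_of_longA (F := fun σ p => (-1) ^ (n * (n - 1) / 2) * opCoset σ φ p)
    (G := schubertFn z) ?_ ?_ σ
  · funext p
    have h1 : φ = fun q => upperProd 1 z n q * evFn z (kernelP n (n - 1)) q := by
      funext q
      rw [hφ, evFn, map_mul, ev_Delta _ _ q rfl, evFn]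
    -- The exponent `0 + 1 + ⋯ + (n - 1)` equals `n(n-1)/2`, so the sign cancels the one in the
    -- definition of `schubertD`.
    rw [opCoset_longA, h1, theta_upperProd 1 n z (symmOn_evFn_kernelP _ _ _), psi_evFn_kernelP,
      Finset.sum_range_id, schubertFn_longA, mul_one, ← mul_assoc, ← mul_pow]
    simp
  · intro σ i h hF
    rw [← opS_opCoset h, ← opS_const_mul, hF, opS_schubertFn z h]

theorem powers_two_le_nonZeroDivisors : Submonoid.powers (2 : ℤ) ≤ nonZeroDivisors ℤ :=
  powers_le_nonZeroDivisors_of_noZeroDivisors two_ne_zero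

instance : CharZero ZHalf :=
  charZero_of_injective_algebraMap (IsLocalization.injective ZHalf powers_two_le_nonZeroDivisors)

/-- The point and the parameters are independent variables in an extension of a polynomial ring, so
an identity of values there is an identity of polynomials. Infinitely many variables are used
because a `GenPt` is an infinite sequence. -/
theorem exists_injective_ev (n : ℕ) [Algebra (MvPolynomial (ℕ ⊕ ℕ) ZHalf) K]
    [IsScalarTower ZHalf (MvPolynomial (ℕ ⊕ ℕ) ZHalf) K]
    (hinj : Function.Injective (algebraMap (MvPolynomial (ℕ ⊕ ℕ) ZHalf) K)) :
    ∃ (p : GenPt K) (z : ℕ → K), Function.Injective (ev (n := n) (R := ZHalf) p z) := by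
  have hX : ∀ i j, i ≠ j → (X (Sum.inl i) : MvPolynomial (ℕ ⊕ ℕ) ZHalf) - X (Sum.inl j) ≠ 0 ∧
      (X (Sum.inl i) : MvPolynomial (ℕ ⊕ ℕ) ZHalf) + X (Sum.inl j) ≠ 0 := by
    intro i j hij
    constructor
    · exact sub_ne_zero.2 fun e => hij (Sum.inl_injective (X_injective e))
    · intro h
      have h1 := congrArg (eval (Sum.elim (fun k => if k = i then (1 : ZHalf) else 0) 0)) h
      simp [hij.symm] at h1
  let p : GenPt K := ⟨fun i => algebraMap (MvPolynomial (ℕ ⊕ ℕ) ZHalf) K (X (Sum.inl i)),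
    fun i j hij => by
    rw [← map_sub, ← map_add]
    exact ⟨(map_ne_zero_iff _ hinj).2 (hX i j hij).1, (map_ne_zero_iff _ hinj).2 (hX i j hij).2⟩⟩
  let z : ℕ → K := fun i => algebraMap (MvPolynomial (ℕ ⊕ ℕ) ZHalf) K (X (Sum.inr i))
  refine ⟨p, z, ?_⟩
  have hev : ev (n := n) (R := ZHalf) p z =
      (IsScalarTower.toAlgHom ZHalf (MvPolynomial (ℕ ⊕ ℕ) ZHalf) K).comp
        (rename (Sum.map (fun i : Fin n => (i : ℕ)) fun i : Fin n => (i : ℕ))) := by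
    apply MvPolynomial.algHom_ext
    rintro (k | k) <;> simp [ev, p, z]
  rw [hev, AlgHom.coe_comp]
  refine Function.Injective.comp hinj (rename_injective _ ?_)
  exact Sum.map_injective.2 ⟨Fin.val_injective, Fin.val_injective⟩

end Main

end

end TypeD

theorem theorem3p6 (n : ℕ) (ϖ : Equiv.Perm (Fin n)) :
    ∑ w ∈ TypeD.lengthCoset ϖ, TypeD.schubertD w =
      TypeD.schubertAAt (TypeD.star ϖ)
        (fun i => (TypeD.x (TypeD.longA n i) : TypeD.PolyXY n TypeD.ZHalf))
        (fun j => -TypeD.y j) := by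
  have : CharZero (FractionRing (MvPolynomial (ℕ ⊕ ℕ) TypeD.ZHalf)) :=
    IsFractionRing.charZero_of_isFractionRing (MvPolynomial (ℕ ⊕ ℕ) TypeD.ZHalf)
  obtain ⟨p, z, h⟩ := TypeD.exists_injective_ev
    (K := FractionRing (MvPolynomial (ℕ ⊕ ℕ) TypeD.ZHalf)) n
    (IsFractionRing.injective (MvPolynomial (ℕ ⊕ ℕ) TypeD.ZHalf) _)
  exact h ((TypeD.ev_sum_schubertD p z ϖ).trans (TypeD.ev_schubertAAt p z ϖ).symm)
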